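/- Fix a finite alphabet $\Sigma$ and a set of variables. A *vset-automaton* (VA) is a finite automaton $A=(Q,q_0,F,\delta)$ whose transitions are labelled by $\varepsilon$, by letters of $\Sigma$, or by operations $x{\vdash}$ (open $x$) and ${\dashv}x$ (close $x$) on variables $x$; $\mathsf{Vars}(A)$ is the set of variables that occur in its transitions. A run of $A$ on a document $\mathbf d=\sigma_1\cdots\sigma_n$ starts in $q_0$ at position $1$, reads $\mathbf d$ (letter transitions advance the position by one, all others keep it) and ends at position $n+1$; it is accepting if it ends in $F$, and valid if every variable is opened at most once and closed at most once, every opened variable is closed later, and every closed variable was opened before. A valid accepting run yields the mapping that sends each variable $x$ operated on to the span $[i,j\rangle$, where $i$ and $j$ are the positions at which $x$ is opened and closed; $[\![A]\!](\mathbf d)$ is the set of these mappings. $A$ is *sequential* if all its accepting runs, on all documents, are valid. Two mappings are compatible if they agree on their common domain, and $[\![A_1\setminus A_2]\!](\mathbf d)$ is the set of all $\mu\in[\![A_1]\!](\mathbf d)$ that are compatible with no element of $[\![A_2]\!](\mathbf d)$. A sequential VA $A$ is *semi-functional* for a set $X$ of variables if for every $x\in X$ and every state $q$ from which an accepting state can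 be reached, one of the following holds: no run from $q_0$ to $q$ opens $x$; all runs from $q_0$ to $q$ open but do not close $x$; all runs from $q_0$ to $q$ open and close $x$. $A$ is *synchronized* for $X$ if for every $x\in X$ all transitions labelled $x{\vdash}$ have the same target state, all transitions labelled ${\dashv}x$ have the same target state, and either all accepting runs of $A$ open and close $x$ or no accepting run of $A$ operates on $x$. **Theorem.** Consider as inputs a document $\mathbf d$ and two sequential VAs $A_1,A_2$ such that, for $X:=\mathsf{Vars}(A_1)\cap\mathsf{Vars}(A_2)$, $A_1$ is semi-functional for $X$ and $A_2$ is synchronized for $X$. 1. There is an algorithm that, given such $\mathbf d,A_1,A_2$, constructs in time polynomial in the combined size of $\mathbf d$, $A_1$ and $A_2$ a sequential VA $A_{\mathbf d}$ with $[\![A_{\mathbf d}]\!](\mathbf d)=[\![A_1\setminus A_2]\!](\mathbf d)$. 2. There is an algorithm that, given such $\mathbf d,A_1,A_2$, enumerates the mappings in $[\![A_1\setminus A_2]\!](\mathbf d)$ without duplicates and with delay polynomial in the combined size of $\mathbf d$, $A_1$ and $A_2$. In both parts one algorithm and one polynomial serve all such inputs; in particular, $|X|$ is unbounded. -/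

import Mathlib

namespace Spanner

/-! ### A machine model with a step count

A small imperative programming model over binary trees (in the style of the WHILE language).  Every
elementary operation is charged the size of the tree that it is applied to, so that a computation
of cost `t` only ever handles trees of size at most `t`; polynomial time in this model is polynomial
time on Turing machines. -/

/-- The values handled by programs: binary trees. -/
inductive Data : Type
  | nil : Data
  | cons : Data → Data → Data
  deriving DecidableEq

/-- The number of nodes of a tree. -/
def Data.size : Data → ℕ
  | .nil => 1
  | .cons a b => a.size + b.size + 1

def Data.head : Data → Data
  | .nil => .nil
  | .cons a _ => a

def Data.tail : Data → Data
  | .nil => .nil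
  | .cons _ b => b

/-- Programs; each of them transforms one tree into another one. -/
inductive Prog : Type
  | nil : Prog
  | skip : Prog
  | head : Prog
  | tail : Prog
  | eq : Prog
  | pair : Prog → Prog → Prog
  | seq : Prog → Prog → Prog
  | ite : Prog → Prog → Prog → Prog
  | loop : Prog → Prog → Prog

/-- `Eval P x y t`: on input `x` the program `P` halts with output `y`, at cost `t`.
As a truth value, `Data.nil` is false and every other tree is true. -/
inductive Eval : Prog → Data → Data → ℕ → Prop
  | nil (x : Data) : Eval .nil x .nil x.size
  | skip (x : Data) : Eval .skip x x x.size
  | head (x : Data) : Eval .head x x.head x.size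
  | tail (x : Data) : Eval .tail x x.tail x.size
  /-- compares the two subtrees of the input -/
  | eq (x : Data) :
      Eval .eq x (if x.head = x.tail then .cons .nil .nil else .nil) (x.size + 2)
  | pair {P R : Prog} {x a b : Data} {s t : ℕ} :
      Eval P x a s → Eval R x b t → Eval (.pair P R) x (.cons a b) (s + t + 1)
  /-- `P`, then `R` -/
  | seq {P R : Prog} {x y z : Data} {s t : ℕ} :
      Eval P x y s → Eval R y z t → Eval (.seq P R) x z (s + t + 1)
  | ite_true {C P R : Prog} {x c y : Data} {s t : ℕ} :
      Eval C x c s → c ≠ .nil → Eval P x y t → Eval (.ite C P R) x y (s + t + 1)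
  | ite_false {C P R : Prog} {x y : Data} {s t : ℕ} :
      Eval C x .nil s → Eval R x y t → Eval (.ite C P R) x y (s + t + 1)
  /-- `loop C P`: while `C` is true, do `P` -/
  | loop_stop {C P : Prog} {x : Data} {s : ℕ} :
      Eval C x .nil s → Eval (.loop C P) x x (s + x.size + 1)
  | loop_step {C P : Prog} {x c y z : Data} {s t u : ℕ} :
      Eval C x c s → c ≠ .nil → Eval P x y t → Eval (.loop C P) y z u →
      Eval (.loop C P) x z (s + t + u + 1)

/-- An enumeration with delay at most `b`: `Enumerates P b s ys` says that, from the memory content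
`s`, repeated use of the program `P` outputs the trees `ys` one after the other and then reports the
end.  Each use either outputs the next tree and updates the memory, or (result `nil`) stops, and it
costs at most `b`. -/
inductive Enumerates (P : Prog) (b : ℕ) : Data → List Data → Prop
  | done {s : Data} {t : ℕ} : Eval P s .nil t → t ≤ b → Enumerates P b s []
  | step {s s' y : Data} {ys : List Data} {t : ℕ} :
      Eval P s (.cons y s') t → t ≤ b → Enumerates P b s' ys → Enumerates P b s (y :: ys)

/-! ### Spans, mappings, spanners -/

/-- Spans `[i, j⟩` with `1 ≤ i ≤ j`. -/
@[ext]
structure Span where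
  lower : ℕ
  upper : ℕ
  one_le : 1 ≤ lower
  le : lower ≤ upper

/-- Mappings: partial functions from variables to spans. -/
abbrev Mapping (V : Type*) := V → Option Span

def Mapping.Compatible {V : Type*} (μ ν : Mapping V) : Prop :=
  ∀ x s t, μ x = some s → ν x = some t → s = t

/-- Schemaless spanners over the alphabet `α`, with variables in `V`. -/
abbrev SchemalessSpanner (α V : Type*) := List α → Set (Mapping V)

/-- The difference of two spanners. -/
def SchemalessSpanner.difference {α V : Type*} (P₁ P₂ : SchemalessSpanner α V) :
    SchemalessSpanner α V :=
  fun d => {μ | μ ∈ P₁ d ∧ ∀ ν ∈ P₂ d, ¬ Mapping.Compatible μ ν}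

/-! ### Vset-automata -/

/-- Labels of transitions: `ε`, letters, and the operations that open or close a variable. -/
inductive Label (α V : Type*)
  | eps : Label α V
  | letter : α → Label α V
  | op : V → Label α V
  | cl : V → Label α V

/-- A vset-automaton (VA) with alphabet `α`, variables in `V`, and states named by elements of `Q`.
The finite sets of a VA are given by lists of their elements. -/
structure VA (α V Q : Type*) where
  states : List Q
  start : Q
  accept : List Q
  trans : List (Q × Label α V × Q)
  start_mem : start ∈ states
  accept_mem : ∀ q ∈ accept, q ∈ states
  trans_mem : ∀ e ∈ trans, e.1 ∈ states ∧ e.2.2 ∈ states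

/-- The word of letters that is read by a sequence of labels. -/
def letters {α V : Type*} (w : List (Label α V)) : List α :=
  w.filterMap fun o => match o with
    | .letter a => some a
    | _ => none

/-- The position in the document at which the `k`-th label (counted from `0`) is executed. -/
def pos {α V : Type*} (w : List (Label α V)) (k : ℕ) : ℕ :=
  (letters (w.take k)).length + 1

/-- A sequence of labels is valid if each variable is opened at most once, is closed at most once,
is closed (later) whenever it is opened, and is opened (earlier) whenever it is closed. -/
def Valid {α V : Type*} (w : List (Label α V)) : Prop :=
  ∀ x : V,
    (∀ i j : ℕ, w[i]? = some (.op x) → w[j]? = some (.op x) → i = j) ∧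
    (∀ i j : ℕ, w[i]? = some (.cl x) → w[j]? = some (.cl x) → i = j) ∧
    (∀ i : ℕ, w[i]? = some (.op x) → ∃ j : ℕ, i ≤ j ∧ w[j]? = some (.cl x)) ∧
    (∀ j : ℕ, w[j]? = some (.cl x) → ∃ i : ℕ, i ≤ j ∧ w[i]? = some (.op x))

/-- `μ` is the mapping of the (valid) sequence of labels `w`: it maps `x` to `[i, j⟩` exactly if `x`
is opened at position `i` and closed at position `j`. -/
def IsMappingOf {α V : Type*} (w : List (Label α V)) (μ : Mapping V) : Prop :=
  ∀ (x : V) (s : Span), μ x = some s ↔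
    ∃ i j : ℕ, w[i]? = some (.op x) ∧ w[j]? = some (.cl x) ∧ s.lower = pos w i ∧ s.upper = pos w j

namespace VA

variable {α V Q : Type*}

/-- `A.Path p w q`: `A` can go from state `p` to state `q` by transitions labelled `w`. -/
inductive Path (A : VA α V Q) : Q → List (Label α V) → Q → Prop
  | nil (q : Q) : Path A q [] q
  | cons {p q r : Q} {o : Label α V} {w : List (Label α V)} :
      (p, o, q) ∈ A.trans → Path A q w r → Path A p (o :: w) r

/-- `w` is the label sequence of an accepting run of `A` on the document `d`.  (The positions of
the run are determined by its labels, see `pos`.) -/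
def AcceptingRun (A : VA α V Q) (d : List α) (w : List (Label α V)) : Prop :=
  letters w = d ∧ ∃ f ∈ A.accept, A.Path A.start w f

/-- The spanner represented by `A`. -/
def spanner (A : VA α V Q) : SchemalessSpanner α V :=
  fun d => {μ | ∃ w, A.AcceptingRun d w ∧ Valid w ∧ IsMappingOf w μ}

/-- The variables mentioned in the transitions of `A`. -/
def vars (A : VA α V Q) : Set V :=
  {x | ∃ p q, (p, .op x, q) ∈ A.trans ∨ (p, .cl x, q) ∈ A.trans}

/-- All accepting runs are valid. -/
def Sequential (A : VA α V Q) : Prop :=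
  ∀ d w, A.AcceptingRun d w → Valid w

/-- Labels of the extended variable configurations. -/
inductive Config
  | unseen
  | opened
  | closed
  | done

/-- `A.HasConfig q x c`: the extended variable configuration of the state `q` maps `x` to `c`. -/
def HasConfig (A : VA α V Q) (q : Q) (x : V) : Config → Prop
  | .unseen => ∀ w, A.Path A.start w q → .op x ∉ w
  | .opened => ∀ w, A.Path A.start w q → .op x ∈ w ∧ .cl x ∉ w
  | .closed => ∀ w, A.Path A.start w q → .op x ∈ w ∧ .cl x ∈ w
  | .done => (∃ w, A.Path A.start w q ∧ .op x ∈ w ∧ .cl x ∈ w) ∧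
      ∃ w, A.Path A.start w q ∧ .op x ∉ w

/-- `A` is semi-functional for `X`.  Extended variable configurations make sense for the states that
can still reach an accepting state (runs to other states need not respect the variables at all), so
nothing is required of the other states. -/
def SemiFunctional (A : VA α V Q) (X : Set V) : Prop :=
  ∀ x ∈ X, ∀ q ∈ A.states, (∃ f ∈ A.accept, ∃ w, A.Path q w f) →
    A.HasConfig q x .unseen ∨ A.HasConfig q x .opened ∨ A.HasConfig q x .closed

/-- All transitions labelled `o` lead to the same state. -/
def UniqueTarget (A : VA α V Q) (o : Label α V) : Prop :=
  ∃ r, ∀ p q, (p, o, q) ∈ A.trans → q = r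

/-- `A` is synchronized for `X`. -/
def Synchronized (A : VA α V Q) (X : Set V) : Prop :=
  ∀ x ∈ X, A.UniqueTarget (.op x) ∧ A.UniqueTarget (.cl x) ∧
    ((∀ d w, A.AcceptingRun d w → .op x ∈ w ∧ .cl x ∈ w) ∨
     (∀ d w, A.AcceptingRun d w → .op x ∉ w ∧ .cl x ∉ w))

end VA

/-! ### Encodings as trees

Letters and variables are named by trees through injections `nα` and `nV`; states are named by
arbitrary trees. -/

def encList : List Data → Data
  | [] => .nil
  | a :: l => .cons a (encList l)

/-- Unary encoding of numbers. -/
def encNat (n : ℕ) : Data := encList (List.replicate n .nil)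

section

variable {α V : Type*} (nα : α ↪ Data) (nV : V ↪ Data)

def encLabel : Label α V → Data
  | .eps => .cons (encNat 0) .nil
  | .letter a => .cons (encNat 1) (nα a)
  | .op x => .cons (encNat 2) (nV x)
  | .cl x => .cons (encNat 3) (nV x)

def encVA (A : VA α V Data) : Data :=
  .cons (encList A.states) (.cons A.start (.cons (encList A.accept)
    (encList (A.trans.map fun e => .cons e.1 (.cons (encLabel nα nV e.2.1) e.2.2)))))

/-- The encoding of a document and two VAs. -/
def encInput (d : List α) (A₁ A₂ : VA α V Data) : Data :=
  .cons (encList (d.map nα)) (.cons (encVA nα nV A₁) (encVA nα nV A₂))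

/-- The tree `y` lists the domain of the mapping `μ`, each variable once and with its span. -/
def EncodesMapping (y : Data) (μ : Mapping V) : Prop :=
  ∃ l : List (V × Span), (l.map Prod.fst).Nodup ∧
    (∀ x s, μ x = some s ↔ (x, s) ∈ l) ∧
    y = encList (l.map fun e => .cons (nV e.1) (.cons (encNat e.2.lower) (encNat e.2.upper)))

end

end Spanner

/-! Call an operation shared, relative to an accepting state `f` of `A₁`, if it occurs on some run
of `A₁` to `f` and on some accepting run of `A₂`. Semi-functionality of `A₁` puts every shared
operation on every run to `f`, and synchronization puts it on every accepting run of `A₂`. Hence the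
mappings of two such runs are compatible exactly if both execute each shared operation at the same
position of the document (`compatible_iff`).

The automaton for the difference guesses `f`, simulates `A₁` on `d` and tracks the set `W` of states
that `A₂` can occupy after reading the same letters with the shared operations at the same positions
(`DiffInv`). Operations between two letters may come in different orders, so they are compared only
when the next letter is read: a state of `A₂` survives if it has executed the same shared operations
as the state of `A₁`. What has been executed is a property of the state, because runs are valid
(`FunctionalOn.done_iff`). After the last letter nothing is left to compare: both runs execute all
shared operations, so those not executed earlier fall at the last position in both. The run is
accepted iff `W` contains no accepting state of `A₂`.

A subset construction could produce exponentially many sets; unique targets prevent this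
(`Tracked.letter`). If `A₁` executes a new shared operation between two letters, every surviving
state of `A₂` has passed through the unique target `t` of that operation, so for the next step `W`
may be replaced by the silent closure of `t`. If it executes none, the test for survival is the same
as at the previous letter. So every set arises from the empty set or the silent closure of one state
by reading letters with a fixed test, and is determined by a state of `A₂` or the empty set, a state
of `A₁` representing the test, and two suffixes of `d`. These polynomially many sets are listed in
`trackedSets`.

For the enumeration, a mapping of a sequential automaton corresponds to the set of events
(operation, rest of the document) of any run producing it. These sets are found by binary search:
decide for one possible event after another whether to take it, visiting only nodes below which a
solution exists. The required oracle asks for an accepting run whose events contain `C` and avoid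
`N`. As no event repeats on a valid run, it suffices to count the events in `C`, so the oracle is
reachability in a product graph of polynomial size (`isOracle_runExists`). No branch of the search
fails, so the delay is polynomial. Applying this to the automaton for the difference gives the
second part.

All algorithms are written as functions on encoded types, and `PolyTime` is closed under the
required constructions, so that `fun_prop` supplies the programs. -/

namespace Spanner

set_option linter.unusedSectionVars false

/-! ### Types encoded as trees -/

/-- Types whose elements are named by trees. -/
class Enc (β : Type*) where
  enc : β → Data
  inj : Function.Injective enc

open Enc (enc)

theorem encList_injective : Function.Injective encList := by
  intro l
  induction l with
  | nil => intro l' h; cases l' <;> simp_all [encList]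
  | cons a l ih =>
    intro l' h
    cases l' with
    | nil => simp [encList] at h
    | cons b l' =>
      simp only [encList, Data.cons.injEq] at h
      rw [h.1, ih h.2]

theorem encNat_injective : Function.Injective encNat := by
  intro m n h
  have := congrArg List.length (encList_injective h)
  simpa using this

instance : Enc Data := ⟨id, Function.injective_id⟩

instance {β γ : Type*} [Enc β] [Enc γ] : Enc (β × γ) :=
  ⟨fun p => .cons (enc p.1) (enc p.2), fun p q h => by
    simp only [Data.cons.injEq] at h
    exact Prod.ext (Enc.inj h.1) (Enc.inj h.2)⟩

instance {β : Type*} [Enc β] : Enc (List β) :=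
  ⟨fun l => encList (l.map enc), fun _ _ h =>
    List.map_injective_iff.2 Enc.inj (encList_injective h)⟩

instance : Enc Bool :=
  ⟨fun b => if b then .cons .nil .nil else .nil, fun a b h => by cases a <;> cases b <;> simp_all⟩

instance : Enc ℕ := ⟨encNat, encNat_injective⟩

theorem encLabel_injective {α V : Type*} (nα : α ↪ Data) (nV : V ↪ Data) :
    Function.Injective (encLabel nα nV) := by
  intro a b h
  cases a <;> cases b <;> simp_all [encLabel, encNat_injective.eq_iff]

instance {α V : Type*} [Enc α] [Enc V] : Enc (Label α V) :=
  ⟨encLabel ⟨enc, Enc.inj⟩ ⟨enc, Enc.inj⟩, encLabel_injective _ _⟩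

section

variable {β γ δ σ : Type*} [Enc β] [Enc γ] [Enc δ] [Enc σ]

@[simp] theorem enc_pair (a : β) (b : γ) : enc (a, b) = .cons (enc a) (enc b) := rfl
@[simp] theorem enc_nil : enc ([] : List β) = .nil := rfl
@[simp] theorem enc_cons (a : β) (l : List β) : enc (a :: l) = .cons (enc a) (enc l) := rfl
@[simp] theorem enc_true : enc true = .cons .nil .nil := rfl
@[simp] theorem enc_false : enc false = .nil := rfl
theorem enc_prod (p : β × γ) : enc p = .cons (enc p.1) (enc p.2) := rfl

/-- The size of the code of `x`. -/
def esize (x : β) : ℕ := (enc x).size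

theorem Data.size_pos (x : Data) : 1 ≤ x.size := by cases x <;> simp [Data.size]

@[simp] theorem esize_pair (a : β) (b : γ) : esize (a, b) = esize a + esize b + 1 := rfl
theorem esize_prod (p : β × γ) : esize p = esize p.1 + esize p.2 + 1 := rfl
@[simp] theorem esize_nil : esize ([] : List β) = 1 := rfl
@[simp] theorem esize_cons (a : β) (l : List β) : esize (a :: l) = esize a + esize l + 1 := rfl

theorem esize_append (l l' : List β) : esize (l ++ l') + 1 = esize l + esize l' := by
  induction l with
  | nil => simp; omega
  | cons a l ih => simp; omega

theorem length_lt_esize (l : List β) : l.length < esize l := by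
  induction l with
  | nil => simp
  | cons a l ih => simp; omega

theorem esize_le_of_forall {l : List β} {k : ℕ} (h : ∀ a ∈ l, esize a ≤ k) :
    esize l ≤ l.length * (k + 1) + 1 := by
  induction l with
  | nil => simp
  | cons a l ih =>
    have h1 := h a (by simp)
    have h2 := ih fun b hb => h b (by simp [hb])
    simp only [esize_cons, List.length_cons, Nat.add_mul]
    omega

theorem esize_le_of_mem {l : List β} {a : β} (h : a ∈ l) : esize a ≤ esize l := by
  induction l with
  | nil => simp at h
  | cons b l ih =>
    rcases List.mem_cons.1 h with rfl | h
    · simp; omega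
    · have := ih h; simp; omega

theorem esize_le_of_sublist {l l' : List β} (h : l.Sublist l') : esize l ≤ esize l' := by
  induction h with
  | slnil => simp
  | cons a _ ih => simp; omega
  | cons_cons a _ ih => simp; omega

/-! ### Functions computable in polynomial time -/

theorem eval_mono (p : Polynomial ℕ) {m n : ℕ} (h : m ≤ n) : p.eval m ≤ p.eval n := by
  rw [Polynomial.eval_eq_sum_range, Polynomial.eval_eq_sum_range]
  gcongr

/-- Each instruction is charged for the tree it handles. Thus polynomial cost implies outputs of
polynomial size, which makes polynomial time closed under composition. -/
theorem Eval.size_le {P : Prog} {x y : Data} {t : ℕ} (h : Eval P x y t) : y.size ≤ t := by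
  induction h with
  | nil x => exact Data.size_pos x
  | skip x => exact le_rfl
  | head x => cases x with
    | nil => exact le_rfl
    | cons a b => simp only [Data.head, Data.size]; omega
  | tail x => cases x with
    | nil => exact le_rfl
    | cons a b => simp only [Data.tail, Data.size]; omega
  | eq x =>
    have := Data.size_pos x
    split
    · simp only [Data.size]; omega
    · simp only [Data.size]; omega
  | pair _ _ h1 h2 => simp [Data.size]; omega
  | _ => omega

/-- Functions that are computed by a program in polynomial time. -/
@[fun_prop]
def PolyTime (f : β → γ) : Prop :=
  ∃ (P : Prog) (p : Polynomial ℕ), ∀ x, ∃ t, Eval P (enc x) (enc (f x)) t ∧ t ≤ p.eval (esize x)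

namespace PolyTime

theorem esize_le {f : β → γ} (hf : PolyTime f) :
    ∃ p : Polynomial ℕ, ∀ x, esize (f x) ≤ p.eval (esize x) := by
  obtain ⟨P, p, h⟩ := hf
  refine ⟨p, fun x => ?_⟩
  obtain ⟨t, h1, h2⟩ := h x
  exact h1.size_le.trans h2

@[fun_prop]
theorem id' : PolyTime fun x : β => x :=
  ⟨.skip, .X, fun x => ⟨_, .skip _, by simp [esize]⟩⟩

theorem comp' {g : γ → δ} {f : β → γ} (hg : PolyTime g) (hf : PolyTime f) :
    PolyTime fun x => g (f x) := by
  obtain ⟨P, p, hP⟩ := hf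
  obtain ⟨R, q, hR⟩ := hg
  refine ⟨.seq P R, p + q.comp p + 1, fun x => ?_⟩
  obtain ⟨s, h1, h2⟩ := hP x
  obtain ⟨t, h3, h4⟩ := hR (f x)
  refine ⟨_, .seq h1 h3, ?_⟩
  have := eval_mono q (h1.size_le.trans h2)
  simp only [Polynomial.eval_add, Polynomial.eval_comp, Polynomial.eval_one]
  simp only [esize] at *
  omega

@[fun_prop]
theorem prodMk {f : β → γ} {g : β → δ} (hf : PolyTime f) (hg : PolyTime g) :
    PolyTime fun x => (f x, g x) := by
  obtain ⟨P, p, hP⟩ := hf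
  obtain ⟨R, q, hR⟩ := hg
  refine ⟨.pair P R, p + q + 1, fun x => ?_⟩
  obtain ⟨s, h1, h2⟩ := hP x
  obtain ⟨t, h3, h4⟩ := hR x
  refine ⟨_, .pair h1 h3, ?_⟩
  simp only [Polynomial.eval_add, Polynomial.eval_one]
  omega

/-- Programs see only codes, so a program also serves any other function that acts on the same codes
in the same way. -/
theorem congr_enc {β' γ' : Type*} [Enc β'] [Enc γ'] {f : β → γ} {g : β' → γ'} (e : β' → β)
    (hf : PolyTime f) (he : ∀ x, enc (e x) = enc x) (hg : ∀ x, enc (f (e x)) = enc (g x)) :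
    PolyTime g := by
  obtain ⟨P, p, hP⟩ := hf
  refine ⟨P, p, fun x => ?_⟩
  obtain ⟨t, h1, h2⟩ := hP (e x)
  rw [he, hg] at h1
  refine ⟨t, h1, ?_⟩
  simpa only [esize, he] using h2

theorem toData {f : β → γ} (hf : PolyTime f) : PolyTime fun x => enc (f x) :=
  hf.congr_enc _root_.id (fun _ => rfl) fun _ => rfl

theorem ofData {F : Data → Data} (hF : PolyTime F) {f : β → γ} (h : ∀ x, F (enc x) = enc (f x)) :
    PolyTime f :=
  hF.congr_enc enc (fun _ => rfl) h

theorem const_data (c : Data) : PolyTime fun _ : β => c := by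
  induction c with
  | nil => exact ⟨.nil, .X, fun x => ⟨_, .nil _, by simp [esize]⟩⟩
  | cons a b ha hb => exact (ha.prodMk hb).toData

@[fun_prop]
theorem const (c : γ) : PolyTime fun _ : β => c :=
  (const_data (β := β) (enc c)).congr_enc _root_.id (fun _ => rfl) fun _ => rfl

@[fun_prop]
theorem data_head : PolyTime Data.head :=
  ⟨.head, .X, fun x => ⟨_, .head _, by simp [esize]⟩⟩

@[fun_prop]
theorem data_tail : PolyTime Data.tail :=
  ⟨.tail, .X, fun x => ⟨_, .tail _, by simp [esize]⟩⟩

theorem fst' : PolyTime fun p : β × γ => p.1 := data_head.ofData fun _ => rfl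
theorem snd' : PolyTime fun p : β × γ => p.2 := data_tail.ofData fun _ => rfl

@[fun_prop]
theorem fst {f : β → γ × δ} (hf : PolyTime f) : PolyTime fun x => (f x).1 := fst'.comp' hf
@[fun_prop]
theorem snd {f : β → γ × δ} (hf : PolyTime f) : PolyTime fun x => (f x).2 := snd'.comp' hf

@[fun_prop]
theorem comp {g : γ → δ} {f : β → γ} (hg : PolyTime g) (hf : PolyTime f) :
    PolyTime fun x => g (f x) := hg.comp' hf

@[fun_prop]
theorem listCons {f : β → γ} {g : β → List γ} (hf : PolyTime f) (hg : PolyTime g) :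
    PolyTime fun x => f x :: g x :=
  (hf.prodMk hg).congr_enc _root_.id (fun _ => rfl) fun _ => rfl

@[fun_prop]
theorem listTail {f : β → List γ} (hf : PolyTime f) : PolyTime fun x => (f x).tail := by
  have : PolyTime fun l : List γ => l.tail :=
    data_tail.ofData fun l => by cases l <;> rfl
  exact this.comp hf

@[fun_prop]
theorem ite {c : β → Bool} {f g : β → γ} (hc : PolyTime c) (hf : PolyTime f) (hg : PolyTime g) :
    PolyTime fun x => if c x = true then f x else g x := by
  obtain ⟨C, r, hC⟩ := hc
  obtain ⟨P, p, hP⟩ := hf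
  obtain ⟨R, q, hR⟩ := hg
  refine ⟨.ite C P R, r + p + q + 1, fun x => ?_⟩
  obtain ⟨u, h5, h6⟩ := hC x
  simp only [Polynomial.eval_add, Polynomial.eval_one]
  cases h : c x
  · obtain ⟨t, h3, h4⟩ := hR x
    rw [h] at h5
    exact ⟨_, .ite_false h5 (by simpa using h3), by omega⟩
  · obtain ⟨t, h3, h4⟩ := hP x
    rw [h] at h5
    exact ⟨_, .ite_true h5 (by simp) (by simpa using h3), by omega⟩

end PolyTime

/-! ### Equality tests and Boolean connectives -/

/-- Equality, as a truth value. -/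
def eqb (a b : β) : Bool := decide (enc a = enc b)

@[simp] theorem eqb_iff {a b : β} : eqb a b = true ↔ a = b := by
  simp [eqb, Enc.inj.eq_iff]

namespace PolyTime

@[fun_prop]
theorem eqb {f g : β → γ} (hf : PolyTime f) (hg : PolyTime g) :
    PolyTime fun x => Spanner.eqb (f x) (g x) := by
  have : PolyTime fun p : γ × γ => Spanner.eqb p.1 p.2 :=
    ⟨.eq, .X + 2, fun p => ⟨_, by
      convert Eval.eq (enc p) using 1
      by_cases h : enc p.1 = enc p.2 <;> simp [Spanner.eqb, enc_prod, Data.head, Data.tail, h], by simp [esize]⟩⟩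
  exact this.comp (hf.prodMk hg)

@[fun_prop]
theorem not {f : β → Bool} (hf : PolyTime f) : PolyTime fun x => !(f x) := by
  have := hf.ite (const false) (const true)
  convert this using 2 with x
  cases f x <;> rfl

@[fun_prop]
theorem and {f g : β → Bool} (hf : PolyTime f) (hg : PolyTime g) :
    PolyTime fun x => f x && g x := by
  have := hf.ite hg (const false)
  convert this using 2 with x
  cases f x <;> rfl

@[fun_prop]
theorem or {f g : β → Bool} (hf : PolyTime f) (hg : PolyTime g) :
    PolyTime fun x => f x || g x := by
  have := hf.ite (const true) hg
  convert this using 2 with x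
  cases f x <;> rfl

@[fun_prop]
theorem isEmpty {f : β → List γ} (hf : PolyTime f) : PolyTime fun x => (f x).isEmpty := by
  have : PolyTime fun x => Spanner.eqb (f x) [] := by fun_prop
  convert this using 2 with x
  cases f x <;> simp [Spanner.eqb]

end PolyTime

end

section

variable {β γ δ σ : Type*} [Enc β] [Enc γ] [Enc δ] [Enc σ]

/-! ### Bounded loops -/

/-- A left fold whose step also sees the rest of the list. -/
def foldTails (g : σ → β → List β → σ) : σ → List β → σ
  | s, [] => s
  | s, a :: l => foldTails g (g s a l) l

theorem Eval.loop_of_false {C P : Prog} {x : Data} {s : ℕ} (h : Eval C x .nil s) :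
    Eval (.loop C P) x x (s + x.size + 1) := by
  constructor
  exact h

/-- The memory holds parameter, accumulator and remaining list. The guard reads the list; the body
lets `G` compute the new accumulator from the whole memory and drops the head of the list. `M`
bounds the cost of `G` and `N` the size of the memory; the extra round in the bound is the failing
guard. -/
theorem eval_loop_foldTails {G : Prog} {g : γ → σ → β → List β → σ} {M N : ℕ}
    {Inv : γ → List β → σ → Prop} (c : γ)
    (hG : ∀ s a l, Inv c (a :: l) s →
      ∃ t, Eval G (enc (c, s, a :: l)) (enc (g c s a l)) t ∧ t ≤ M)
    (hstep : ∀ s a l, Inv c (a :: l) s → Inv c l (g c s a l))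
    (hsize : ∀ s l, Inv c l s → esize (c, s, l) ≤ N) (l : List β) :
    ∀ s, Inv c l s →
      ∃ t, Eval (.loop (.seq .tail .tail) (.pair .head (.pair G (.seq .tail (.seq .tail .tail)))))
        (enc (c, s, l)) (enc (c, foldTails (g c) s l, ([] : List β))) t ∧
        t ≤ (l.length + 1) * (M + 10 * N + 10) := by
  induction l with
  | nil =>
    intro s hs
    have h1 := hsize s [] hs
    refine ⟨_, .loop_of_false (.seq (.tail _) (.tail _)), ?_⟩
    simp only [esize, enc_pair, enc_nil, Data.size, Data.tail] at h1 ⊢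
    simp only [List.length_nil]
    omega
  | cons a l ih =>
    intro s hs
    have h1 := hsize s _ hs
    obtain ⟨t, h2, h3⟩ := hG s a l hs
    obtain ⟨u, h4, h5⟩ := ih _ (hstep s a l hs)
    refine ⟨_, .loop_step (.seq (.tail _) (.tail _)) (by simp [Data.tail])
      (.pair (.head _) (.pair h2 (.seq (.tail _) (.seq (.tail _) (.tail _))))) h4, ?_⟩
    simp only [esize, enc_pair, enc_cons, Data.size, Data.tail] at h1 ⊢
    simp only [List.length_cons]
    rw [Nat.add_mul (l.length + 1), one_mul]
    omega

theorem foldTails_invariant {Inv : List β → σ → Prop} {g : σ → β → List β → σ}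
    (hstep : ∀ s a l, Inv (a :: l) s → Inv l (g s a l)) (l : List β) :
    ∀ s, Inv l s → Inv [] (foldTails g s l) := by
  induction l with
  | nil => exact fun s hs => hs
  | cons a l ih => exact fun s hs => ih _ (hstep s a l hs)

namespace PolyTime

/-- A polynomial-time step may double the accumulator, so its iteration need not be polynomial. The
invariant has to bound the accumulator in terms of the parameter alone. -/
theorem foldTails_of_invariant {g : γ → σ → β → List β → σ}
    (hg : PolyTime fun p : γ × σ × β × List β => g p.1 p.2.1 p.2.2.1 p.2.2.2)
    {s : γ → σ} (hs : PolyTime s) {l : γ → List β} (hl : PolyTime l)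
    (Inv : γ → List β → σ → Prop) (h0 : ∀ c, Inv c (l c) (s c))
    (hstep : ∀ c s a l, Inv c (a :: l) s → Inv c l (g c s a l))
    (q : Polynomial ℕ) (hq : ∀ c s l, Inv c l s → esize s ≤ q.eval (esize c)) :
    PolyTime fun c => Spanner.foldTails (g c) (s c) (l c) := by
  obtain ⟨L, hL⟩ := hl.esize_le
  obtain ⟨G, p, hG⟩ := hg
  have hinit : PolyTime fun c => (c, s c, l c) := by fun_prop
  obtain ⟨P, r, hP⟩ := hinit
  let N : Polynomial ℕ := .X + q + L + 2
  let M : Polynomial ℕ := p.comp N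
  refine ⟨.seq P (.seq (.loop (.seq .tail .tail) (.pair .head (.pair G (.seq .tail (.seq .tail .tail)))))
    (.seq .tail .head)), r + (L + 1) * (M + 10 * N + 10) + 3 * N + 10, fun c => ?_⟩
  obtain ⟨t, ht, ht'⟩ := hP c
  let Inv' : γ → List β → σ → Prop := fun c l' s' => Inv c l' s' ∧ esize l' ≤ esize (l c)
  have hN : ∀ s' l', Inv' c l' s' → esize (c, s', l') ≤ N.eval (esize c) := by
    intro s' l' h
    have h1 := hq _ _ _ h.1
    have h2 := h.2.trans (hL c)
    simp [N]
    omega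
  obtain ⟨u, hu, hu'⟩ := eval_loop_foldTails (G := G) (g := g) (M := M.eval (esize c))
    (N := N.eval (esize c)) (Inv := Inv') c (by
      intro s' a l' h
      obtain ⟨v, hv, hv'⟩ := hG (c, s', a, l')
      refine ⟨v, hv, hv'.trans ?_⟩
      simp only [M, Polynomial.eval_comp]
      exact eval_mono _ (hN s' (a :: l') h)) (by
      intro s' a l' h
      refine ⟨hstep _ _ _ _ h.1, le_trans ?_ h.2⟩
      simp; omega) hN (l c) (s c) ⟨h0 c, le_rfl⟩
  refine ⟨_, .seq ht (.seq hu (.seq (.tail _) (.head _))), ?_⟩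
  have h3 := hN _ _ (foldTails_invariant (Inv := Inv' c) (g := g c) (by
      intro s' a l' h
      refine ⟨hstep _ _ _ _ h.1, le_trans ?_ h.2⟩
      simp; omega) (l c) (s c) ⟨h0 c, le_rfl⟩)
  have h4 : ((l c).length + 1) * (M.eval (esize c) + 10 * N.eval (esize c) + 10) ≤
      (L.eval (esize c) + 1) * (M.eval (esize c) + 10 * N.eval (esize c) + 10) := by
    have := (length_lt_esize (l c)).le.trans (hL c)
    gcongr
  simp only [esize, enc_pair, enc_nil, Data.size, Data.tail] at h3 ⊢
  simp only [Polynomial.eval_add, Polynomial.eval_mul, Polynomial.eval_one, Polynomial.eval_ofNat]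
  simp only [esize] at h4 ht' hu'
  omega

/-- Folds in which each step adds a polynomially bounded amount. -/
theorem foldTails_of_add {g : γ → σ → β → List β → σ}
    (hg : PolyTime fun p : γ × σ × β × List β => g p.1 p.2.1 p.2.2.1 p.2.2.2)
    {s : γ → σ} (hs : PolyTime s) {l : γ → List β} (hl : PolyTime l)
    (q : Polynomial ℕ) (hq : ∀ c s a l', (a :: l') <:+ l c →
      esize (g c s a l') ≤ esize s + q.eval (esize c)) :
    PolyTime fun c => Spanner.foldTails (g c) (s c) (l c) := by
  obtain ⟨L, hL⟩ := hl.esize_le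
  obtain ⟨S, hS⟩ := hs.esize_le
  -- A potential argument: each remaining element of the list pays in advance for the growth that
  -- its step may cause.
  refine foldTails_of_invariant hg hs hl
    (fun c l' s' => l' <:+ l c ∧
      esize s' + l'.length * q.eval (esize c) ≤ esize (s c) + (l c).length * q.eval (esize c))
    (fun c => ⟨List.suffix_refl _, le_rfl⟩) ?_ (S + L * q) ?_
  · rintro c s' a l' ⟨h1, h2⟩
    have h3 := hq c s' a l' h1
    refine ⟨(List.suffix_cons a l').trans h1, le_trans ?_ h2⟩
    simp only [List.length_cons, Nat.add_mul, one_mul]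
    omega
  · rintro c s' l' ⟨-, h2⟩
    have h3 := hS c
    have h4 : (l c).length * q.eval (esize c) ≤ L.eval (esize c) * q.eval (esize c) := by
      have := (length_lt_esize (l c)).le.trans (hL c)
      gcongr
    simp only [Polynomial.eval_add, Polynomial.eval_mul]
    omega

end PolyTime

theorem foldTails_reverse (l acc : List β) :
    foldTails (fun acc a _ => a :: acc) acc l = l.reverse ++ acc := by
  induction l generalizing acc with
  | nil => rfl
  | cons a l ih => simp [foldTails, ih]

/-- Prepending reverses the order of the blocks; `PolyTime.flatMap` therefore folds over the
reversed list. -/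
theorem foldTails_flatMap (f : β → List γ) (l : List β) (acc : List γ) :
    foldTails (fun acc a _ => f a ++ acc) acc l = l.reverse.flatMap f ++ acc := by
  induction l generalizing acc with
  | nil => rfl
  | cons a l ih => simp [foldTails, ih]

/-! ### List operations as folds -/

namespace PolyTime

@[fun_prop]
theorem reverse {f : β → List γ} (hf : PolyTime f) : PolyTime fun x => (f x).reverse := by
  obtain ⟨p, hp⟩ := hf.esize_le
  have := foldTails_of_add (g := fun (_ : β) (acc : List γ) a _ => a :: acc) (by fun_prop)
    (const []) hf (p + 1) (by
      intro c s a l' h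
      have h1 := esize_le_of_mem (h.subset (List.mem_cons_self))
      have h2 := hp c
      simp
      omega)
  simpa only [foldTails_reverse, List.append_nil] using this

@[fun_prop]
theorem append {f g : β → List γ} (hf : PolyTime f) (hg : PolyTime g) :
    PolyTime fun x => f x ++ g x := by
  have hf' := hf.reverse
  obtain ⟨p, hp⟩ := hf'.esize_le
  have := foldTails_of_add (g := fun (_ : β) (acc : List γ) a _ => a :: acc) (by fun_prop)
    hg hf' (p + 1) (by
      intro c s a l' h
      have h1 := esize_le_of_mem (h.subset (List.mem_cons_self))
      have h2 := hp c
      simp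
      omega)
  simpa only [foldTails_reverse, List.reverse_reverse] using this

@[fun_prop]
theorem flatMap {l : β → List γ} {f : β → γ → List δ} (hl : PolyTime l)
    (hf : PolyTime fun p : β × γ => f p.1 p.2) : PolyTime fun x => (l x).flatMap (f x) := by
  have hl' := hl.reverse
  obtain ⟨p, hp⟩ := hl'.esize_le
  obtain ⟨q, hq⟩ := hf.esize_le
  have := foldTails_of_add (g := fun (c : β) (acc : List δ) a _ => f c a ++ acc)
    (by
      have : PolyTime fun p : β × List δ × γ × List γ => f p.1 p.2.2.1 :=
        hf.comp (f := fun p : β × List δ × γ × List γ => (p.1, p.2.2.1)) (by fun_prop)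
      fun_prop)
    (const []) hl' (q.comp (.X + p + 1)) (by
      intro c s a l' h
      have h1 := esize_le_of_mem (h.subset (List.mem_cons_self))
      have h2 := hp c
      have h3 : esize (f c a) ≤ q.eval (esize (c, a)) := hq (c, a)
      have h4 := esize_append (f c a) s
      have h5 := eval_mono q (m := esize (c, a)) (n := esize c + p.eval (esize c) + 1)
        (by simp; omega)
      simp
      omega)
  simpa only [foldTails_flatMap, List.append_nil, List.reverse_reverse] using this

@[fun_prop]
theorem map {l : β → List γ} {f : β → γ → δ} (hl : PolyTime l)
    (hf : PolyTime fun p : β × γ => f p.1 p.2) : PolyTime fun x => (l x).map (f x) := by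
  have : PolyTime fun x => (l x).flatMap fun a => [f x a] :=
    hl.flatMap (hf.listCons (const []))
  simpa only [List.map_eq_flatMap] using this

@[fun_prop]
theorem filter {l : β → List γ} {f : β → γ → Bool} (hl : PolyTime l)
    (hf : PolyTime fun p : β × γ => f p.1 p.2) : PolyTime fun x => (l x).filter (f x) := by
  have : PolyTime fun x => (l x).flatMap fun a => if f x a = true then [a] else [] :=
    hl.flatMap (hf.ite (snd'.listCons (const [])) (const []))
  convert this using 2 with x
  induction l x with
  | nil => rfl
  | cons a t ih => by_cases h : f x a = true <;> simp [h, ih]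

@[fun_prop]
theorem any {l : β → List γ} {f : β → γ → Bool} (hl : PolyTime l)
    (hf : PolyTime fun p : β × γ => f p.1 p.2) : PolyTime fun x => (l x).any (f x) := by
  have := (hl.filter hf).isEmpty.not
  convert this using 2 with x
  rw [Bool.eq_iff_iff]
  simp

@[fun_prop]
theorem all {l : β → List γ} {f : β → γ → Bool} (hl : PolyTime l)
    (hf : PolyTime fun p : β × γ => f p.1 p.2) : PolyTime fun x => (l x).all (f x) := by
  have := (hl.any (f := fun x b => !f x b) hf.not).not
  convert this using 2 with x
  rw [Bool.eq_iff_iff]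
  simp

end PolyTime

/-- Membership, as a truth value. -/
def memb (a : β) (l : List β) : Bool := l.any (eqb a)

@[simp] theorem memb_iff {a : β} {l : List β} : memb a l = true ↔ a ∈ l := by
  simp [memb]

@[fun_prop]
theorem PolyTime.memb {f : β → γ} {l : β → List γ} (hf : PolyTime f) (hl : PolyTime l) :
    PolyTime fun x => Spanner.memb (f x) (l x) := by
  unfold Spanner.memb
  fun_prop

end

section

variable {β γ δ σ : Type*} [Enc β] [Enc γ] [Enc δ] [Enc σ]

attribute [fun_prop] PolyTime.toData

@[fun_prop]
theorem PolyTime.dataCons {f g : β → Data} (hf : PolyTime f) (hg : PolyTime g) :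
    PolyTime fun x => Data.cons (f x) (g x) :=
  (hf.prodMk hg).toData

/-! ### Suffixes, lengths, duplicates -/

/-- The suffixes of a list. -/
def suffixes (l : List β) : List (List β) := foldTails (fun acc a t => (a :: t) :: acc) [[]] l

theorem mem_suffixes {s l : List β} : s ∈ suffixes l ↔ s <:+ l := by
  suffices ∀ acc : List (List β), s ∈ foldTails (fun acc a t => (a :: t) :: acc) acc l ↔
      s ∈ acc ∨ (s <:+ l ∧ s ≠ []) by
    rw [suffixes, this]
    by_cases h : s = [] <;> simp [h]
  induction l with
  | nil => intro acc; simp +contextual [foldTails]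
  | cons a l ih =>
    intro acc
    rw [foldTails, ih, List.suffix_cons_iff, List.mem_cons]
    by_cases h : s = a :: l <;> simp [h]

@[fun_prop]
theorem PolyTime.suffixes {f : β → List γ} (hf : PolyTime f) :
    PolyTime fun x => Spanner.suffixes (f x) := by
  obtain ⟨p, hp⟩ := hf.esize_le
  refine foldTails_of_add (g := fun _ acc a t => (a :: t) :: acc) (by fun_prop)
    (const [[]]) hf (p + 1) fun c s a l' h => ?_
  have h1 := esize_le_of_sublist h.sublist
  have h2 := hp c
  simp at h1 ⊢
  omega

-- Numbers are coded in unary, as lists of `nil`, so blanking the entries of a list yields its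
-- length.
@[fun_prop]
theorem PolyTime.length {f : β → List γ} (hf : PolyTime f) : PolyTime fun x => (f x).length := by
  have : PolyTime fun x => (f x).map fun _ => Data.nil := by fun_prop
  refine this.congr_enc id (fun _ => rfl) fun x => ?_
  change encList (((f x).map fun _ => Data.nil).map id) = encNat _
  simp [encNat]

@[fun_prop]
theorem PolyTime.succ {f : β → ℕ} (hf : PolyTime f) : PolyTime fun x => f x + 1 := by
  have : PolyTime fun x => Data.cons .nil (enc (f x)) := by fun_prop
  exact this.congr_enc id (fun _ => rfl) fun x => rfl

theorem foldTails_tail (l : List β) (m : List γ) :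
    foldTails (fun l _ _ => l.tail) l m = l.drop m.length := by
  induction m generalizing l with
  | nil => rfl
  | cons a m ih => simp [foldTails, ih]

-- Serves as subtraction of lengths: `posOf` is built from it.
@[fun_prop]
theorem PolyTime.drop_length {f : β → List γ} {g : β → List δ} (hf : PolyTime f)
    (hg : PolyTime g) : PolyTime fun x => (f x).drop (g x).length := by
  have := foldTails_of_add (g := fun (_ : β) (l : List γ) (_ : δ) _ => l.tail) (by fun_prop)
    hf hg 0 (by
      intro c s a l' h
      cases s <;> simp; omega)
  simpa only [foldTails_tail] using this

/-- Removes duplicates. -/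
def dedupl (l : List β) : List β :=
  foldTails (fun acc a _ => if memb a acc then acc else a :: acc) [] l

theorem mem_dedupl {a : β} {l : List β} : a ∈ dedupl l ↔ a ∈ l := by
  suffices ∀ acc : List β, a ∈ foldTails
      (fun acc a _ => if memb a acc then acc else a :: acc) acc l ↔ a ∈ acc ∨ a ∈ l by
    simp [dedupl, this]
  induction l with
  | nil => simp [foldTails]
  | cons b l ih =>
    intro acc
    rw [foldTails, ih]
    by_cases h : b ∈ acc <;> simp [h] <;> grind

theorem nodup_dedupl (l : List β) : (dedupl l).Nodup := by
  suffices ∀ acc : List β, acc.Nodup → (foldTails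
      (fun acc a _ => if memb a acc then acc else a :: acc) acc l).Nodup from this _ List.nodup_nil
  induction l with
  | nil => exact fun acc h => h
  | cons b l ih =>
    intro acc h
    refine ih _ ?_
    simp only [memb_iff]
    split <;> simp_all

@[fun_prop]
theorem PolyTime.dedupl {f : β → List γ} (hf : PolyTime f) :
    PolyTime fun x => Spanner.dedupl (f x) := by
  obtain ⟨p, hp⟩ := hf.esize_le
  refine foldTails_of_add (g := fun _ acc a _ => if Spanner.memb a acc then acc else a :: acc)
    (by fun_prop) (const []) hf (p + 1) fun c s a l' h => ?_
  have h1 := esize_le_of_mem (h.subset (List.mem_cons_self))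
  have h2 := hp c
  split <;> simp
  omega

/-! ### Reachability in finite graphs -/

/-- `S` together with the targets of the edges that leave `R`. -/
def closureStep (E : List (β × β)) (S R : List β) : List β :=
  S ++ (E.filter fun e => memb e.1 R).map fun e => e.2

/-- The list of the nodes reachable from `S` by edges in `E`. -/
def closure (E : List (β × β)) (S : List β) : List β :=
  closureStep E S (foldTails (fun R _ _ => closureStep E S R) S E)

theorem mem_closureStep {E : List (β × β)} {S R : List β} {y : β} :
    y ∈ closureStep E S R ↔ y ∈ S ∨ ∃ x ∈ R, (x, y) ∈ E := by
  simp [closureStep]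
  grind

theorem foldTails_const (f : σ → σ) (s : σ) (l : List β) :
    foldTails (fun s _ _ => f s) s l = f^[l.length] s := by
  induction l generalizing s with
  | nil => rfl
  | cons a l ih => simp [foldTails, ih]

/-- Iterating `closureStep` gives an increasing chain of sets. A round that does not yield a closed
set enables at least one further edge, so `E.length` rounds and the final extra step suffice. -/
theorem mem_closure {E : List (β × β)} {S : List β} {y : β} :
    y ∈ closure E S ↔ ∃ x ∈ S, Relation.ReflTransGen (fun a b => (a, b) ∈ E) x y := by
  rw [closure, foldTails_const]
  let R : ℕ → List β := fun k => (closureStep E S)^[k] S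
  have hR : ∀ k, R (k + 1) = closureStep E S (R k) := fun k => Function.iterate_succ_apply' _ _ _
  change y ∈ closureStep E S (R E.length) ↔ _
  rw [← hR]
  have hsub : ∀ k, S ⊆ R k := by
    intro k
    cases k with
    | zero => exact fun _ h => h
    | succ k => rw [hR]; exact List.subset_append_left _ _
  have hmono : ∀ k, R k ⊆ R (k + 1) := by
    intro k
    induction k with
    | zero => exact hsub 1
    | succ k ih =>
      intro y hy
      rw [hR, mem_closureStep] at hy
      rw [hR, mem_closureStep]
      exact hy.imp_right fun ⟨x, hx, h⟩ => ⟨x, ih hx, h⟩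
  have hsound : ∀ k, ∀ y ∈ R k, ∃ x ∈ S, Relation.ReflTransGen (fun a b => (a, b) ∈ E) x y := by
    intro k
    induction k with
    | zero => exact fun y hy => ⟨y, hy, .refl⟩
    | succ k ih =>
      intro y hy
      rw [hR, mem_closureStep] at hy
      rcases hy with hy | ⟨x, hx, h⟩
      · exact ⟨y, hy, .refl⟩
      · obtain ⟨z, hz, hzx⟩ := ih x hx
        exact ⟨z, hz, hzx.tail h⟩
  let F : ℕ → List (β × β) := fun k => E.filter fun e => memb e.1 (R k)
  have hF : ∀ k, (F k).Sublist (F (k + 1)) := fun k =>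
    List.monotone_filter_right _ fun e he => memb_iff.2 (hmono k (memb_iff.1 he))
  let Closed : ℕ → Prop := fun k => ∀ e ∈ E, e.1 ∈ R k → e.2 ∈ R k
  have hstep : ∀ k, (∀ e ∈ E, e.1 ∈ R (k + 1) → e.1 ∈ R k) → Closed (k + 1) := by
    intro k h e he h1
    rw [hR, mem_closureStep]
    exact .inr ⟨e.1, h e he h1, he⟩
  have hsucc : ∀ k, Closed k → Closed (k + 1) := by
    refine fun k h => hstep k fun e he h1 => ?_
    rw [hR, mem_closureStep] at h1
    rcases h1 with h1 | ⟨x, hx, h1⟩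
    · exact hsub k h1
    · exact h _ h1 hx
  -- `F k` consists of the edges whose source has been reached after `k` rounds; if it stops
  -- growing, the next set is closed.
  have hclaim : ∀ k, Closed k ∨ k ≤ (F k).length := by
    intro k
    induction k with
    | zero => simp
    | succ k ih =>
      rcases ih with ih | ih
      · exact .inl (hsucc k ih)
      · by_cases hk : (F (k + 1)).length ≤ (F k).length
        · refine .inl (hstep k fun e he h1 => ?_)
          have h2 := (hF k).eq_of_length_le hk
          have h3 : e ∈ F (k + 1) := List.mem_filter.2 ⟨he, memb_iff.2 h1⟩
          rw [← h2] at h3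
          exact memb_iff.1 (List.mem_filter.1 h3).2
        · exact .inr (by omega)
  have hclosed : Closed (E.length + 1) := by
    rcases hclaim E.length with h | h
    · exact hsucc _ h
    · refine hstep _ fun e he _ => ?_
      have h1 : F E.length = E := List.filter_sublist.eq_of_length_le h
      rw [← h1] at he
      exact memb_iff.1 (List.mem_filter.1 he).2
  refine ⟨hsound _ y, ?_⟩
  rintro ⟨x, hx, h⟩
  clear hsound
  induction h with
  | refl => exact hsub _ hx
  | tail _ h ih => exact hclosed _ h ih

@[fun_prop]
theorem PolyTime.closureStep {f : β → List (γ × γ)} {g h : β → List γ} (hf : PolyTime f)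
    (hg : PolyTime g) (hh : PolyTime h) :
    PolyTime fun x => Spanner.closureStep (f x) (g x) (h x) := by
  unfold Spanner.closureStep
  fun_prop

/-- The step adds to `S` and not to `R`, so the bound does not involve `R` and iterates do not
accumulate duplicates. -/
theorem esize_closureStep_le (E : List (β × β)) (S R : List β) :
    esize (closureStep E S R) ≤ esize S + esize E := by
  have h1 : ∀ l : List (β × β), esize (l.map fun e => e.2) ≤ esize l := by
    intro l
    induction l with
    | nil => simp
    | cons e l ih => have := esize_prod e; simp; omega
  have h2 := h1 (E.filter fun e => memb e.1 R)
  have h3 := esize_le_of_sublist (List.filter_sublist (l := E) (p := fun e => memb e.1 R))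
  have h4 := esize_append S ((E.filter fun e => memb e.1 R).map fun e => e.2)
  rw [closureStep]
  omega

@[fun_prop]
theorem PolyTime.closure {f : β → List (γ × γ)} {g : β → List γ} (hf : PolyTime f)
    (hg : PolyTime g) : PolyTime fun x => Spanner.closure (f x) (g x) := by
  obtain ⟨p, hp⟩ := hf.esize_le
  obtain ⟨q, hq⟩ := hg.esize_le
  have : PolyTime fun x => foldTails (fun R _ _ => Spanner.closureStep (f x) (g x) R)
      (g x) (f x) := by
    refine foldTails_of_invariant
      (g := fun x R (_ : γ × γ) _ => Spanner.closureStep (f x) (g x) R) (by fun_prop) hg hf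
      (fun x _ R => esize R ≤ esize (g x) + esize (f x)) (fun x => by omega)
      (fun x R _ _ _ => esize_closureStep_le _ _ _) (q + p) fun x R _ h => ?_
    have h1 := hp x
    have h2 := hq x
    simp only [Polynomial.eval_add]
    omega
  unfold Spanner.closure
  fun_prop

end

/-! ### Labels -/

section

variable {α V β : Type*} [Enc α] [Enc V] [Enc β]

/-- Is the label a letter? -/
def Label.isLetter (o : Label α V) : Bool := eqb (enc o).head (encNat 1)

/-- Does the label operate on a variable? -/
def Label.isVarOp (o : Label α V) : Bool :=
  eqb (enc o).head (encNat 2) || eqb (enc o).head (encNat 3)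

/-- Is the label the letter at the beginning of `s`? -/
def Label.isHead (o : Label α V) (s : List α) : Bool :=
  eqb (enc o) (.cons (encNat 1) (enc s).head) && !s.isEmpty

@[simp] theorem Label.isLetter_eps : (Label.eps : Label α V).isLetter = false := rfl
@[simp] theorem Label.isLetter_letter (a : α) : (Label.letter a : Label α V).isLetter = true := rfl
@[simp] theorem Label.isLetter_op (x : V) : (Label.op x : Label α V).isLetter = false := rfl
@[simp] theorem Label.isLetter_cl (x : V) : (Label.cl x : Label α V).isLetter = false := rfl
@[simp] theorem Label.isVarOp_eps : (Label.eps : Label α V).isVarOp = false := rfl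
@[simp] theorem Label.isVarOp_letter (a : α) : (Label.letter a : Label α V).isVarOp = false := rfl
@[simp] theorem Label.isVarOp_op (x : V) : (Label.op x : Label α V).isVarOp = true := rfl
@[simp] theorem Label.isVarOp_cl (x : V) : (Label.cl x : Label α V).isVarOp = true := rfl

/-- The test for emptiness matters: `Data.head` yields `nil` on the empty list, and `nil` may be the
code of a letter. -/
theorem Label.isHead_iff {o : Label α V} {s : List α} :
    o.isHead s = true ↔ ∃ a t, o = .letter a ∧ s = a :: t := by
  have h : ∀ a : α, enc (Label.letter a : Label α V) = .cons (encNat 1) (enc a) := fun _ => rfl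
  cases s with
  | nil => simp [Label.isHead]
  | cons b t =>
    have : o.isHead (b :: t) = true ↔ o = .letter b := by
      simp only [Label.isHead, enc_cons, Data.head, ← h, List.isEmpty_cons, Bool.not_false,
        Bool.and_true]
      simp [eqb, Enc.inj.eq_iff]
    rw [this]
    simp

@[fun_prop]
theorem PolyTime.isLetter {f : β → Label α V} (hf : PolyTime f) :
    PolyTime fun x => (f x).isLetter := by
  unfold Label.isLetter
  fun_prop

@[fun_prop]
theorem PolyTime.isVarOp {f : β → Label α V} (hf : PolyTime f) :
    PolyTime fun x => (f x).isVarOp := by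
  unfold Label.isVarOp
  fun_prop

@[fun_prop]
theorem PolyTime.isHead {f : β → Label α V} {g : β → List α} (hf : PolyTime f)
    (hg : PolyTime g) : PolyTime fun x => (f x).isHead (g x) := by
  unfold Label.isHead
  fun_prop

end

section

variable {α V Q : Type*}

/-! ### Occurrences of operations in runs -/

@[simp] theorem letters_nil : letters ([] : List (Label α V)) = [] := rfl

theorem letters_append (w u : List (Label α V)) : letters (w ++ u) = letters w ++ letters u := by
  simp [letters]

@[simp] theorem letters_cons_letter (a : α) (w : List (Label α V)) :
    letters (.letter a :: w) = a :: letters w := rfl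
@[simp] theorem letters_cons_eps (w : List (Label α V)) : letters (.eps :: w) = letters w := rfl
@[simp] theorem letters_cons_op (x : V) (w : List (Label α V)) :
    letters (.op x :: w) = letters w := rfl
@[simp] theorem letters_cons_cl (x : V) (w : List (Label α V)) :
    letters (.cl x :: w) = letters w := rfl

theorem letters_cons_of_not_isLetter [Enc α] [Enc V] {o : Label α V} (h : o.isLetter = false)
    (w : List (Label α V)) : letters (o :: w) = letters w := by
  cases o <;> first | rfl | simp at h

/-- `o` occurs in `w` at the position `k` of the document. -/
def OccursAt (w : List (Label α V)) (o : Label α V) (k : ℕ) : Prop :=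
  ∃ w₁ w₂, w = w₁ ++ o :: w₂ ∧ (letters w₁).length + 1 = k

theorem occursAt_iff {w : List (Label α V)} {o : Label α V} {k : ℕ} :
    OccursAt w o k ↔ ∃ i, w[i]? = some o ∧ pos w i = k := by
  constructor
  · rintro ⟨w₁, w₂, rfl, rfl⟩
    exact ⟨w₁.length, by simp, by simp [pos]⟩
  · rintro ⟨i, hi, rfl⟩
    obtain ⟨hi', rfl⟩ := List.getElem?_eq_some_iff.1 hi
    exact ⟨w.take i, w.drop (i + 1), by simp, rfl⟩

theorem OccursAt.mem {w : List (Label α V)} {o : Label α V} {k : ℕ} (h : OccursAt w o k) :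
    o ∈ w := by
  obtain ⟨w₁, w₂, rfl, -⟩ := h
  simp

theorem OccursAt.one_le {w : List (Label α V)} {o : Label α V} {k : ℕ} (h : OccursAt w o k) :
    1 ≤ k := by
  obtain ⟨w₁, w₂, rfl, rfl⟩ := h
  omega

theorem exists_occursAt {w : List (Label α V)} {o : Label α V} (h : o ∈ w) :
    ∃ k, OccursAt w o k := by
  obtain ⟨w₁, w₂, rfl⟩ := List.append_of_mem h
  exact ⟨_, w₁, w₂, rfl, rfl⟩

theorem OccursAt.le {w : List (Label α V)} {o : Label α V} {k : ℕ} (h : OccursAt w o k) :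
    k ≤ (letters w).length + 1 := by
  obtain ⟨w₁, w₂, rfl, rfl⟩ := h
  simp [letters_append]

theorem occursAt_append {w u : List (Label α V)} {o : Label α V} {k : ℕ} :
    OccursAt (w ++ u) o k ↔ OccursAt w o k ∨ ∃ j, OccursAt u o j ∧ (letters w).length + j = k := by
  constructor
  · rintro ⟨w₁, w₂, h, rfl⟩
    rcases List.append_eq_append_iff.1 h with ⟨v, rfl, rfl⟩ | ⟨v, rfl, h'⟩
    · exact .inr ⟨_, ⟨v, w₂, rfl, rfl⟩, by simp [letters_append]; omega⟩
    · cases v with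
      | nil =>
        refine .inr ⟨1, ⟨[], w₂, by simpa [eq_comm] using h', rfl⟩, by simp⟩
      | cons o' v =>
        simp only [List.cons_append, List.cons.injEq] at h'
        exact .inl ⟨w₁, v, by rw [h'.1], rfl⟩
  · rintro (⟨w₁, w₂, rfl, rfl⟩ | ⟨_, ⟨w₁, w₂, rfl, rfl⟩, rfl⟩)
    · exact ⟨w₁, w₂ ++ u, by simp, rfl⟩
    · exact ⟨w ++ w₁, w₂, by simp, by simp [letters_append]; omega⟩

theorem not_occursAt_nil {o : Label α V} {k : ℕ} : ¬ OccursAt ([] : List (Label α V)) o k :=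
  fun h => by simpa using h.mem

theorem occursAt_cons {w : List (Label α V)} {o l : Label α V} {k : ℕ} :
    OccursAt (l :: w) o k ↔
      (l = o ∧ k = 1) ∨ ∃ j, OccursAt w o j ∧ (letters [l]).length + j = k := by
  rw [show l :: w = [l] ++ w from rfl, occursAt_append]
  refine or_congr ⟨?_, ?_⟩ Iff.rfl
  · rintro ⟨w₁, w₂, h, rfl⟩
    cases w₁ <;> simp_all
  · rintro ⟨rfl, rfl⟩
    exact ⟨[], [], rfl, rfl⟩

theorem Label.isVarOp_iff [Enc α] [Enc V] {o : Label α V} :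
    o.isVarOp = true ↔ ∃ x, o = .op x ∨ o = .cl x := by
  cases o <;> simp

theorem Label.isLetter_of_isVarOp [Enc α] [Enc V] {o : Label α V} (h : o.isVarOp = true) :
    o.isLetter = false := by
  obtain ⟨x, rfl | rfl⟩ := Label.isVarOp_iff.1 h <;> rfl

theorem Valid.index_unique [Enc α] [Enc V] {w : List (Label α V)} (hw : Valid w) {o : Label α V}
    (ho : o.isVarOp = true) {i j : ℕ} (hi : w[i]? = some o) (hj : w[j]? = some o) : i = j := by
  obtain ⟨x, rfl | rfl⟩ := Label.isVarOp_iff.1 ho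
  · exact (hw x).1 i j hi hj
  · exact (hw x).2.1 i j hi hj

theorem Valid.occursAt_unique [Enc α] [Enc V] {w : List (Label α V)} (hw : Valid w)
    {o : Label α V} (ho : o.isVarOp = true) {k k' : ℕ} (h : OccursAt w o k)
    (h' : OccursAt w o k') : k = k' := by
  obtain ⟨i, hi, rfl⟩ := occursAt_iff.1 h
  obtain ⟨j, hj, rfl⟩ := occursAt_iff.1 h'
  rw [hw.index_unique ho hi hj]

theorem Valid.not_mem_append [Enc α] [Enc V] {w u : List (Label α V)} (hw : Valid (w ++ u))
    {o : Label α V} (ho : o.isVarOp = true) (h : o ∈ w) : o ∉ u := by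
  intro h'
  obtain ⟨i, hi, hi'⟩ := List.mem_iff_getElem.1 h
  obtain ⟨j, hj, hj'⟩ := List.mem_iff_getElem.1 h'
  have := hw.index_unique ho (i := i) (j := w.length + j)
    (by rw [List.getElem?_append_left hi, List.getElem?_eq_getElem hi, hi'])
    (by rw [List.getElem?_append_right (by omega)]; simp [hj, hj'])
  omega

theorem Valid.mem_iff {w : List (Label α V)} (hw : Valid w) {x : V} : .op x ∈ w ↔ .cl x ∈ w := by
  constructor
  · intro h
    obtain ⟨i, hi⟩ := List.mem_iff_getElem?.1 h
    obtain ⟨j, -, hj⟩ := (hw x).2.2.1 i hi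
    exact List.mem_iff_getElem?.2 ⟨j, hj⟩
  · intro h
    obtain ⟨i, hi⟩ := List.mem_iff_getElem?.1 h
    obtain ⟨j, -, hj⟩ := (hw x).2.2.2 i hi
    exact List.mem_iff_getElem?.2 ⟨j, hj⟩

theorem valid_cons_eps {w : List (Label α V)} : Valid (.eps :: w) ↔ Valid w := by
  refine forall_congr' fun x => ?_
  have h : ∀ (o : Label α V), o ≠ .eps → ∀ i, (Label.eps :: w)[i]? = some o ↔
      ∃ j, i = j + 1 ∧ w[j]? = some o := by
    intro o ho i
    cases i with
    | zero => simp [ho.symm]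
    | succ i => simp
  simp only [h (.op x) (by simp), h (.cl x) (by simp)]
  refine and_congr ?_ (and_congr ?_ (and_congr ?_ ?_))
  · constructor
    · intro H i j hi hj
      have := H _ _ ⟨i, rfl, hi⟩ ⟨j, rfl, hj⟩
      omega
    · rintro H _ _ ⟨i, rfl, hi⟩ ⟨j, rfl, hj⟩
      rw [H i j hi hj]
  · constructor
    · intro H i j hi hj
      have := H _ _ ⟨i, rfl, hi⟩ ⟨j, rfl, hj⟩
      omega
    · rintro H _ _ ⟨i, rfl, hi⟩ ⟨j, rfl, hj⟩
      rw [H i j hi hj]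
  · constructor
    · intro H i hi
      obtain ⟨_, h1, j, rfl, h2⟩ := H _ ⟨i, rfl, hi⟩
      exact ⟨j, by omega, h2⟩
    · rintro H _ ⟨i, rfl, hi⟩
      obtain ⟨j, h1, h2⟩ := H i hi
      exact ⟨j + 1, by omega, j, rfl, h2⟩
  · constructor
    · intro H i hi
      obtain ⟨_, h1, j, rfl, h2⟩ := H _ ⟨i, rfl, hi⟩
      exact ⟨j, by omega, h2⟩
    · rintro H _ ⟨i, rfl, hi⟩
      obtain ⟨j, h1, h2⟩ := H i hi
      exact ⟨j + 1, by omega, j, rfl, h2⟩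

/-- Indices of labels are eliminated: a mapping depends only on the document positions at which
operations occur. -/
theorem isMappingOf_iff {w : List (Label α V)} {μ : Mapping V} :
    IsMappingOf w μ ↔
      ∀ x s, μ x = some s ↔ OccursAt w (.op x) s.lower ∧ OccursAt w (.cl x) s.upper := by
  refine forall_congr' fun x => forall_congr' fun s => ?_
  rw [occursAt_iff, occursAt_iff]
  refine iff_congr Iff.rfl ⟨?_, ?_⟩
  · rintro ⟨i, j, h1, h2, h3, h4⟩
    exact ⟨⟨i, h1, h3.symm⟩, ⟨j, h2, h4.symm⟩⟩
  · rintro ⟨⟨i, h1, h3⟩, ⟨j, h2, h4⟩⟩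
    exact ⟨i, j, h1, h2, h3.symm, h4.symm⟩

theorem pos_le_pos (w : List (Label α V)) {i j : ℕ} (h : i ≤ j) : pos w i ≤ pos w j := by
  have : (w.take i).Sublist (w.take j) := (List.take_prefix_take_left h).sublist
  have := (this.filterMap (fun o : Label α V => match o with
    | .letter a => some a
    | _ => none)).length_le
  exact Nat.succ_le_succ this

theorem Valid.exists_span {w : List (Label α V)} (hw : Valid w) {x : V} (hx : .op x ∈ w) :
    ∃ s : Span, OccursAt w (.op x) s.lower ∧ OccursAt w (.cl x) s.upper := by
  obtain ⟨i, hi⟩ := List.mem_iff_getElem?.1 hx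
  obtain ⟨j, hij, hj⟩ := (hw x).2.2.1 i hi
  exact ⟨⟨pos w i, pos w j, by simp [pos], pos_le_pos w hij⟩, occursAt_iff.2 ⟨i, hi, rfl⟩,
    occursAt_iff.2 ⟨j, hj, rfl⟩⟩

theorem Valid.span_unique {w : List (Label α V)} (hw : Valid w) {x : V} {s t : Span}
    (hs : OccursAt w (.op x) s.lower ∧ OccursAt w (.cl x) s.upper)
    (ht : OccursAt w (.op x) t.lower ∧ OccursAt w (.cl x) t.upper) : s = t := by
  have key : ∀ (o : Label α V), (o = .op x ∨ o = .cl x) → ∀ k k', OccursAt w o k →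
      OccursAt w o k' → k = k' := by
    intro o ho k k' h h'
    obtain ⟨i, hi, rfl⟩ := occursAt_iff.1 h
    obtain ⟨j, hj, rfl⟩ := occursAt_iff.1 h'
    rcases ho with rfl | rfl
    · rw [(hw x).1 i j hi hj]
    · rw [(hw x).2.1 i j hi hj]
  exact Span.ext (key _ (.inl rfl) _ _ hs.1 ht.1) (key _ (.inr rfl) _ _ hs.2 ht.2)

open Classical in
theorem Valid.exists_isMappingOf {w : List (Label α V)} (hw : Valid w) :
    ∃ μ : Mapping V, IsMappingOf w μ := by
  refine ⟨fun x => if h : ∃ s : Span, OccursAt w (.op x) s.lower ∧ OccursAt w (.cl x) s.upper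
    then some h.choose else none, isMappingOf_iff.2 fun x s => ?_⟩
  by_cases h : ∃ s : Span, OccursAt w (.op x) s.lower ∧ OccursAt w (.cl x) s.upper
  · simp only [h, dif_pos, Option.some.injEq]
    exact ⟨fun h' => h' ▸ h.choose_spec, fun h' => hw.span_unique h.choose_spec h'⟩
  · simp only [h, dif_neg, not_false_eq_true, reduceCtorEq, false_iff]
    exact fun h' => h ⟨s, h'⟩

/-! ### Paths -/

namespace VA

variable {A : VA α V Q}

theorem Path.append {p q r : Q} {w u : List (Label α V)} (h : A.Path p w q) (h' : A.Path q u r) :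
    A.Path p (w ++ u) r := by
  induction h with
  | nil => exact h'
  | cons he _ ih => exact .cons he (ih h')

theorem Path.single {p q : Q} {o : Label α V} (h : (p, o, q) ∈ A.trans) : A.Path p [o] q :=
  .cons h (.nil q)

theorem path_append_iff {p r : Q} {w u : List (Label α V)} :
    A.Path p (w ++ u) r ↔ ∃ q, A.Path p w q ∧ A.Path q u r := by
  refine ⟨fun h => ?_, fun ⟨q, h, h'⟩ => h.append h'⟩
  induction w generalizing p with
  | nil => exact ⟨p, .nil p, h⟩
  | cons o w ih =>
    cases h with
    | cons he h =>
      obtain ⟨q, h1, h2⟩ := ih h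
      exact ⟨q, .cons he h1, h2⟩

theorem path_cons_iff {p r : Q} {o : Label α V} {w : List (Label α V)} :
    A.Path p (o :: w) r ↔ ∃ q, (p, o, q) ∈ A.trans ∧ A.Path q w r := by
  refine ⟨fun h => ?_, fun ⟨q, h, h'⟩ => .cons h h'⟩
  cases h with
  | cons he h => exact ⟨_, he, h⟩

/-- Some path leads from `p` to `q`. -/
def Reaches (A : VA α V Q) (p q : Q) : Prop := ∃ w, A.Path p w q

/-- Some path that reads no letters leads from `p` to `q`. -/
def SilentReaches (A : VA α V Q) (p q : Q) : Prop := ∃ w, letters w = [] ∧ A.Path p w q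

theorem Reaches.trans {p q r : Q} (h : A.Reaches p q) (h' : A.Reaches q r) : A.Reaches p r := by
  obtain ⟨w, h⟩ := h
  obtain ⟨u, h'⟩ := h'
  exact ⟨_, h.append h'⟩

theorem SilentReaches.reaches {p q : Q} (h : A.SilentReaches p q) : A.Reaches p q := by
  obtain ⟨w, -, h⟩ := h
  exact ⟨w, h⟩

theorem reaches_iff {p q : Q} :
    A.Reaches p q ↔ Relation.ReflTransGen (fun a b => ∃ o, (a, o, b) ∈ A.trans) p q := by
  constructor
  · rintro ⟨w, h⟩
    induction h with
    | nil => exact .refl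
    | cons he _ ih => exact .head ⟨_, he⟩ ih
  · intro h
    induction h with
    | refl => exact ⟨[], .nil _⟩
    | tail _ h ih =>
      obtain ⟨o, h⟩ := h
      exact ih.trans ⟨_, .single h⟩

theorem silentReaches_iff [Enc α] [Enc V] {p q : Q} :
    A.SilentReaches p q ↔
      Relation.ReflTransGen (fun a b => ∃ o, o.isLetter = false ∧ (a, o, b) ∈ A.trans) p q := by
  constructor
  · rintro ⟨w, hw, h⟩
    induction h with
    | nil => exact .refl
    | @cons p q r o w he _ ih =>
      have ho : o.isLetter = false := by cases o <;> first | rfl | simp at hw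
      rw [letters_cons_of_not_isLetter ho] at hw
      exact .head ⟨_, ho, he⟩ (ih hw)
  · intro h
    induction h with
    | refl => exact ⟨[], rfl, .nil _⟩
    | tail _ h ih =>
      obtain ⟨o, ho, h⟩ := h
      obtain ⟨w, hw, h'⟩ := ih
      exact ⟨w ++ [o], by rw [letters_append, hw, letters_cons_of_not_isLetter ho]; rfl,
        h'.append (.single h)⟩

/-- Some path from the initial state to `q` contains `o`. -/
def Done (A : VA α V Q) (o : Label α V) (q : Q) : Prop := ∃ w, A.Path A.start w q ∧ o ∈ w

theorem Done.mono {o : Label α V} {p q : Q} (h : A.Done o p) (h' : A.Reaches p q) : A.Done o q := by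
  obtain ⟨w, h1, h2⟩ := h
  obtain ⟨u, h3⟩ := h'
  exact ⟨w ++ u, h1.append h3, by simp [h2]⟩

/-- Every path from the initial state to a state in `F` is valid and contains all labels in `O`. -/
def FunctionalOn (A : VA α V Q) (F : Set Q) (O : Set (Label α V)) : Prop :=
  ∀ f ∈ F, ∀ w, A.Path A.start w f → Valid w ∧ ∀ o ∈ O, o ∈ w

/-- Suppose some path `u` to `q` contains `o`, and let `v` lead on to `f`. Validity of `u ++ v`
keeps `o` out of `v`, while `w ++ v` must contain `o`; hence `o ∈ w`. So a state that can still
reach `f` knows which operations have been executed. -/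
theorem FunctionalOn.done_iff [Enc α] [Enc V] {F : Set Q} {O : Set (Label α V)}
    (hA : A.FunctionalOn F O) {o : Label α V} (ho : o ∈ O) (ho' : o.isVarOp = true) {q f : Q}
    (hf : f ∈ F) (hqf : A.Reaches q f) {w : List (Label α V)} (hw : A.Path A.start w q) :
    A.Done o q ↔ o ∈ w := by
  refine ⟨?_, fun h => ⟨w, hw, h⟩⟩
  rintro ⟨u, hu, hou⟩
  obtain ⟨v, hv⟩ := hqf
  have h1 := (hA f hf _ (hu.append hv)).1.not_mem_append ho' hou
  have h2 := (hA f hf _ (hw.append hv)).2 o ho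
  rcases List.mem_append.1 h2 with h | h
  · exact h
  · exact absurd h h1

end VA

end

section

variable {α V β : Type*} [Enc α] [Enc V] [Enc β]

/-! ### The components of automata as lists -/

/-- The lists that describe a VA: states, initial state, accepting states, transitions. -/
abbrev RawVA (α V : Type*) := List Data × Data × List Data × List (Data × Label α V × Data)

/-- The lists that describe `A`. -/
def VA.raw (A : VA α V Data) : RawVA α V := (A.states, A.start, A.accept, A.trans)

theorem enc_raw (nα : α ↪ Data) (nV : V ↪ Data) (hα : ∀ a, nα a = enc a) (hV : ∀ x, nV x = enc x)
    (A : VA α V Data) : encVA nα nV A = enc A.raw := by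
  obtain rfl : nα = ⟨enc, Enc.inj⟩ := by ext; apply hα
  obtain rfl : nV = ⟨enc, Enc.inj⟩ := by ext; apply hV
  change _ = Data.cons (encList (A.states.map id)) (.cons A.start
    (.cons (encList (A.accept.map id)) (encList (A.trans.map enc))))
  rw [List.map_id, List.map_id]
  rfl

section

variable (T : List (Data × Label α V × Data))

/-- The pairs of states joined by a transition. -/
def edges : List (Data × Data) := T.map fun e => (e.1, e.2.2)

/-- The pairs of states joined by a transition that reads no letter. -/
def silentEdges : List (Data × Data) := (T.filter fun e => !e.2.1.isLetter).map fun e => (e.1, e.2.2)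

/-- The states reached from `S` without reading letters, in the order of `Q`. -/
def silentClosure (Q S : List Data) : List Data :=
  Q.filter fun q => memb q (closure (silentEdges T) S)

/-- Does some path from `start` to `q` contain `o`? -/
def doneb (start : Data) (o : Label α V) (q : Data) : Bool :=
  T.any fun e => eqb e.2.1 o &&
    (memb e.1 (closure (edges T) [start]) && memb q (closure (edges T) [e.2.2]))

end

section

variable {T : β → List (Data × Label α V × Data)}

@[fun_prop]
theorem PolyTime.silentClosure {Q S : β → List Data} (hT : PolyTime T) (hQ : PolyTime Q)
    (hS : PolyTime S) : PolyTime fun x => Spanner.silentClosure (T x) (Q x) (S x) := by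
  unfold Spanner.silentClosure Spanner.silentEdges
  fun_prop

@[fun_prop]
theorem PolyTime.edges (hT : PolyTime T) : PolyTime fun x => Spanner.edges (T x) := by
  unfold Spanner.edges
  fun_prop

@[fun_prop]
theorem PolyTime.doneb {s q : β → Data} {o : β → Label α V} (hT : PolyTime T) (hs : PolyTime s)
    (ho : PolyTime o) (hq : PolyTime q) :
    PolyTime fun x => Spanner.doneb (T x) (s x) (o x) (q x) := by
  unfold Spanner.doneb
  fun_prop

end

/-- The operations that occur on accepting runs of the second automaton and on runs of the first
automaton that end in `f`. -/
def sharedOps (R₁ R₂ : RawVA α V) (f : Data) : List (Label α V) :=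
  (R₁.2.2.2.map fun e => e.2.1).filter fun o => o.isVarOp && (doneb R₁.2.2.2 R₁.2.1 o f &&
    R₂.2.2.1.any fun f₂ => doneb R₂.2.2.2 R₂.2.1 o f₂)

/-- Can `q₂` still accept, and have the same shared operations been executed at `q₁` and `q₂`? -/
def agreeb (R₁ R₂ : RawVA α V) (f q₁ q₂ : Data) : Bool :=
  ((closure (edges R₂.2.2.2) [q₂]).any fun q => memb q R₂.2.2.1) &&
    (sharedOps R₁ R₂ f).all fun o =>
      eqb (doneb R₁.2.2.2 R₁.2.1 o q₁) (doneb R₂.2.2.2 R₂.2.1 o q₂)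

/-- The states of the second automaton reached from those states in `W` that agree with `q₁`, by
reading the letter `o`. -/
def nextStates (R₁ R₂ : RawVA α V) (f q₁ : Data) (o : Label α V) (W : List Data) : List Data :=
  silentClosure R₂.2.2.2 R₂.1 ((R₂.2.2.2.filter fun e =>
    eqb e.2.1 o && (memb e.1 W && agreeb R₁ R₂ f q₁ e.1)).map fun e => e.2.2)

@[fun_prop]
theorem PolyTime.sharedOps {R₁ R₂ : β → RawVA α V} {f : β → Data} (h₁ : PolyTime R₁)
    (h₂ : PolyTime R₂) (hf : PolyTime f) :
    PolyTime fun x => Spanner.sharedOps (R₁ x) (R₂ x) (f x) := by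
  unfold Spanner.sharedOps
  fun_prop

@[fun_prop]
theorem PolyTime.agreeb {R₁ R₂ : β → RawVA α V} {f q₁ q₂ : β → Data} (h₁ : PolyTime R₁)
    (h₂ : PolyTime R₂) (hf : PolyTime f) (hq₁ : PolyTime q₁) (hq₂ : PolyTime q₂) :
    PolyTime fun x => Spanner.agreeb (R₁ x) (R₂ x) (f x) (q₁ x) (q₂ x) := by
  unfold Spanner.agreeb
  fun_prop

@[fun_prop]
theorem PolyTime.nextStates {R₁ R₂ : β → RawVA α V} {f q₁ : β → Data} {o : β → Label α V}
    {W : β → List Data} (h₁ : PolyTime R₁) (h₂ : PolyTime R₂) (hf : PolyTime f)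
    (hq₁ : PolyTime q₁) (ho : PolyTime o) (hW : PolyTime W) :
    PolyTime fun x => Spanner.nextStates (R₁ x) (R₂ x) (f x) (q₁ x) (o x) (W x) := by
  unfold Spanner.nextStates
  fun_prop

/-! ### Runs of sets of states -/

/-- The sets obtained from `W` along the document `l`, each with the rest of the document. -/
def setRun (nx : α → List Data → List Data) : List α → List Data → List (List α × List Data)
  | [], W => [([], W)]
  | a :: l, W => (a :: l, W) :: setRun nx l (nx a W)

theorem foldTails_setRun (nx : α → List Data → List Data) (l : List α) (W : List Data)
    (out : List (List α × List Data)) :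
    ((([] : List α), (foldTails (fun (s : List Data × List (List α × List Data)) a t =>
      (nx a s.1, (a :: t, s.1) :: s.2)) (W, out) l).1) :: (foldTails
      (fun (s : List Data × List (List α × List Data)) a t =>
      (nx a s.1, (a :: t, s.1) :: s.2)) (W, out) l).2).reverse = out.reverse ++ setRun nx l W := by
  induction l generalizing W out with
  | nil => simp [foldTails, setRun]
  | cons a l ih => rw [foldTails, ih]; simp [setRun]

-- The bound on `nx` must not depend on the current set: otherwise the sets could grow exponentially
-- along the document.
@[fun_prop]
theorem PolyTime.setRun {nx : β → α → List Data → List Data}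
    (hnx : PolyTime fun p : β × α × List Data => nx p.1 p.2.1 p.2.2)
    {l : β → List α} (hl : PolyTime l) {W : β → List Data} (hW : PolyTime W)
    (q : Polynomial ℕ) (hq : ∀ x a W, esize (nx x a W) ≤ q.eval (esize x)) :
    PolyTime fun x => Spanner.setRun (nx x) (l x) (W x) := by
  obtain ⟨p, hp⟩ := hl.esize_le
  have hnx' : PolyTime fun p : β × (List Data × List (List α × List Data)) × α × List α =>
      nx p.1 p.2.2.1 p.2.1.1 :=
    hnx.comp (f := fun p : β × (List Data × List (List α × List Data)) × α × List α =>
      (p.1, p.2.2.1, p.2.1.1)) (by fun_prop)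
  have := foldTails_of_add
    (g := fun x (s : List Data × List (List α × List Data)) a t =>
      (nx x a s.1, (a :: t, s.1) :: s.2))
    (s := fun x => (W x, [])) (by fun_prop) (by fun_prop) hl (q + p + 2) (by
      rintro x ⟨W', out⟩ a t h
      have h1 := hq x a W'
      have h2 := esize_le_of_sublist h.sublist
      have h3 := hp x
      simp at h2 ⊢
      omega)
  have h2 : PolyTime fun x => ((([] : List α), (foldTails
      (fun (s : List Data × List (List α × List Data)) a t =>
      (nx x a s.1, (a :: t, s.1) :: s.2)) (W x, []) (l x)).1) :: (foldTails
      (fun (s : List Data × List (List α × List Data)) a t =>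
      (nx x a s.1, (a :: t, s.1) :: s.2)) (W x, []) (l x)).2).reverse := by fun_prop
  simpa only [foldTails_setRun, List.reverse_nil, List.nil_append] using h2

theorem mem_setRun_self (nx : α → List Data → List Data) (l : List α) (W : List Data) :
    (l, W) ∈ setRun nx l W := by
  cases l <;> simp [setRun]

theorem mem_setRun_next {nx : α → List Data → List Data} {l : List α} {W : List Data} {a : α}
    {s : List α} {U : List Data} (h : (a :: s, U) ∈ setRun nx l W) :
    (s, nx a U) ∈ setRun nx l W := by
  induction l generalizing W with
  | nil => simp [setRun] at h
  | cons b l ih =>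
    rw [setRun, List.mem_cons] at h ⊢
    rcases h with h | h
    · simp only [Prod.mk.injEq, List.cons.injEq] at h
      obtain ⟨⟨rfl, rfl⟩, rfl⟩ := h
      exact .inr (mem_setRun_self _ _ _)
    · exact .inr (ih h)

/-! ### The automaton for the difference -/

/-- The sets of states of the second automaton that are tracked: a rest of the document, a state of
the first automaton and a set. -/
def trackedSets (R₁ R₂ : RawVA α V) (d : List α) (f : Data) :
    List (List α × Data × List Data) :=
  R₁.1.flatMap fun q => (suffixes d).flatMap fun s =>
    ([] :: R₂.1.map fun r => silentClosure R₂.2.2.2 R₂.1 [r]).flatMap fun W =>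
      (setRun (fun a U => nextStates R₁ R₂ f q (.letter a) U) s W).map fun c => (c.1, q, c.2)

@[fun_prop]
theorem PolyTime.letter {f : β → α} (hf : PolyTime f) :
    PolyTime fun x => (Label.letter (f x) : Label α V) := by
  have : PolyTime fun x => Data.cons (encNat 1) (enc (f x)) := by fun_prop
  exact this.congr_enc id (fun _ => rfl) fun _ => rfl

/-- This bound, independent of `S`, is what `PolyTime.setRun` needs for `nextStates`. -/
theorem esize_silentClosure_le (T : List (Data × Label α V × Data)) (Q S : List Data) :
    esize (silentClosure T Q S) ≤ esize Q :=
  esize_le_of_sublist List.filter_sublist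

-- The list is indexed by a state of the first automaton, a suffix of the document, a starting set
-- (empty or the closure of one state) and the number of letters read since; each index has
-- polynomially many values.
@[fun_prop]
theorem PolyTime.trackedSets {R₁ R₂ : β → RawVA α V} {d : β → List α} {f : β → Data}
    (h₁ : PolyTime R₁) (h₂ : PolyTime R₂) (hd : PolyTime d) (hf : PolyTime f) :
    PolyTime fun x => Spanner.trackedSets (R₁ x) (R₂ x) (d x) (f x) := by
  obtain ⟨q, hq⟩ := (h₂.fst).esize_le
  have key : PolyTime fun p : ((β × Data) × List α) × List Data =>
      Spanner.setRun (fun a U => Spanner.nextStates (R₁ p.1.1.1) (R₂ p.1.1.1) (f p.1.1.1) p.1.1.2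
        (.letter a) U) p.1.2 p.2 := by
    refine PolyTime.setRun (by fun_prop) (by fun_prop) (by fun_prop) q fun x a W => ?_
    refine (esize_silentClosure_le _ _ _).trans ((hq _).trans (eval_mono q ?_))
    obtain ⟨⟨⟨x, y⟩, s⟩, W'⟩ := x
    simp
    omega
  unfold Spanner.trackedSets
  refine .flatMap (by fun_prop) (.flatMap (by fun_prop) (.flatMap (by fun_prop) (.map key ?_)))
  fun_prop

/-- The accepting states of the automaton for the difference. -/
def diffAccept (R₁ R₂ : RawVA α V) (d : List α) : List Data :=
  R₁.2.2.1.flatMap fun f => ((trackedSets R₁ R₂ d f).filter fun c =>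
    c.1.isEmpty && !(c.2.2.any fun q => memb q R₂.2.2.1)).map fun c => enc (f, f, c.1, c.2.2)

/-- The transitions of the automaton for the difference. -/
def diffTrans (R₁ R₂ : RawVA α V) (d : List α) : List (Data × Label α V × Data) :=
  R₁.2.2.1.flatMap fun f =>
    (.nil, .eps, enc (f, R₁.2.1, d, silentClosure R₂.2.2.2 R₂.1 [R₂.2.1])) ::
    (R₁.2.2.2.flatMap fun e => (trackedSets R₁ R₂ d f).flatMap fun c =>
      if e.2.1.isLetter = true then
        if e.2.1.isHead c.1 = true then
          [(enc (f, e.1, c.1, c.2.2), e.2.1,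
            enc (f, e.2.2, c.1.tail, nextStates R₁ R₂ f e.1 e.2.1 c.2.2))]
        else []
      else [(enc (f, e.1, c.1, c.2.2), e.2.1, enc (f, e.2.2, c.1, c.2.2))])

/-- The states of the automaton for the difference. -/
def diffStates (R₁ R₂ : RawVA α V) (d : List α) : List Data :=
  .nil :: (diffAccept R₁ R₂ d ++ (diffTrans R₁ R₂ d).flatMap fun e => [e.1, e.2.2])

theorem PolyTime.diffAccept {R₁ R₂ : β → RawVA α V} {d : β → List α}
    (h₁ : PolyTime R₁) (h₂ : PolyTime R₂) (hd : PolyTime d) :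
    PolyTime fun x => Spanner.diffAccept (R₁ x) (R₂ x) (d x) := by
  unfold Spanner.diffAccept
  fun_prop

theorem PolyTime.diffTrans {R₁ R₂ : β → RawVA α V} {d : β → List α}
    (h₁ : PolyTime R₁) (h₂ : PolyTime R₂) (hd : PolyTime d) :
    PolyTime fun x => Spanner.diffTrans (R₁ x) (R₂ x) (d x) := by
  unfold Spanner.diffTrans
  fun_prop

theorem PolyTime.diffStates {R₁ R₂ : β → RawVA α V} {d : β → List α}
    (h₁ : PolyTime R₁) (h₂ : PolyTime R₂) (hd : PolyTime d) :
    PolyTime fun x => Spanner.diffStates (R₁ x) (R₂ x) (d x) := by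
  have h3 := h₁.diffAccept h₂ hd
  have h4 := h₁.diffTrans h₂ hd
  unfold Spanner.diffStates
  fun_prop

/-- A VA for the difference of `A₁` and `A₂` on the document `d`. -/
def VA.diff (A₁ A₂ : VA α V Data) (d : List α) : VA α V Data where
  states := diffStates A₁.raw A₂.raw d
  start := .nil
  accept := diffAccept A₁.raw A₂.raw d
  trans := diffTrans A₁.raw A₂.raw d
  start_mem := List.mem_cons_self
  accept_mem _ h := List.mem_cons_of_mem _ (List.mem_append_left _ h)
  trans_mem e h := by
    constructor <;>
    exact List.mem_cons_of_mem _ (List.mem_append_right _ (List.mem_flatMap.2 ⟨e, h, by simp⟩))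

end

section

variable {α V : Type*} [Enc α] [Enc V] {A A₁ A₂ : VA α V Data} {f : Data} {d : List α}

/-! ### Meaning of the tests on automata -/

namespace VA

theorem Path.mem_states {Q : Type*} {A : VA α V Q} {p q : Q} {w : List (Label α V)}
    (h : A.Path p w q) (hp : p ∈ A.states) : q ∈ A.states := by
  induction h with
  | nil => exact hp
  | cons he _ ih => exact ih (A.trans_mem _ he).2

theorem Reaches.mem_states {Q : Type*} {A : VA α V Q} {p q : Q}
    (h : A.Reaches p q) (hp : p ∈ A.states) : q ∈ A.states := by
  obtain ⟨w, h⟩ := h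
  exact h.mem_states hp

/-- Can an accepting state be reached? -/
def CoReachable {Q : Type*} (A : VA α V Q) (q : Q) : Prop := ∃ f ∈ A.accept, A.Reaches q f

theorem mem_closure_edges {p q : Data} : q ∈ closure (edges A.trans) [p] ↔ A.Reaches p q := by
  rw [mem_closure, reaches_iff]
  simp [edges]

theorem mem_silentClosure {q : Data} {S : List Data} :
    q ∈ silentClosure A.trans A.states S ↔ q ∈ A.states ∧ ∃ r ∈ S, A.SilentReaches r q := by
  simp [silentClosure, mem_closure, silentReaches_iff, silentEdges, and_comm]

/-- A path through `o` splits into a path to the source of a transition labelled `o`, that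
transition, and a path from its target. -/
theorem doneb_iff {o : Label α V} {q : Data} :
    doneb A.trans A.start o q = true ↔ A.Done o q := by
  simp only [doneb, List.any_eq_true, Bool.and_eq_true, eqb_iff, memb_iff, mem_closure_edges]
  constructor
  · rintro ⟨⟨p, o', r⟩, he, rfl, ⟨w, hw⟩, ⟨u, hu⟩⟩
    exact ⟨w ++ o' :: u, hw.append (.cons he hu), by simp⟩
  · rintro ⟨w, hw, ho⟩
    obtain ⟨w₁, w₂, rfl⟩ := List.append_of_mem ho
    obtain ⟨p, hp, h⟩ := path_append_iff.1 hw
    obtain ⟨r, he, hr⟩ := path_cons_iff.1 h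
    exact ⟨_, he, rfl, ⟨_, hp⟩, ⟨_, hr⟩⟩

theorem mem_sharedOps {o : Label α V} (h : o ∈ sharedOps A₁.raw A₂.raw f) :
    o.isVarOp = true ∧ A₁.Done o f ∧ ∃ f₂ ∈ A₂.accept, A₂.Done o f₂ := by
  simp only [sharedOps, raw, List.mem_filter, Bool.and_eq_true, List.any_eq_true, doneb_iff] at h
  exact h.2

theorem mem_sharedOps_of {o : Label α V} (ho : o.isVarOp = true) (h : A₁.Done o f) {f₂ : Data}
    (hf₂ : f₂ ∈ A₂.accept) (h₂ : A₂.Done o f₂) : o ∈ sharedOps A₁.raw A₂.raw f := by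
  simp only [sharedOps, raw, List.mem_filter, Bool.and_eq_true, List.any_eq_true, doneb_iff]
  refine ⟨?_, ho, h, f₂, hf₂, h₂⟩
  obtain ⟨w, hw, ho⟩ := h
  obtain ⟨w₁, w₂, rfl⟩ := List.append_of_mem ho
  obtain ⟨p, -, h⟩ := path_append_iff.1 hw
  obtain ⟨r, he, -⟩ := path_cons_iff.1 h
  exact List.mem_map.2 ⟨_, he, rfl⟩

theorem agreeb_iff {q₁ q₂ : Data} : agreeb A₁.raw A₂.raw f q₁ q₂ = true ↔
    A₂.CoReachable q₂ ∧ ∀ o ∈ sharedOps A₁.raw A₂.raw f, (A₁.Done o q₁ ↔ A₂.Done o q₂) := by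
  simp only [agreeb, Bool.and_eq_true, List.any_eq_true, List.all_eq_true, eqb_iff, memb_iff]
  refine and_congr ?_ (forall₂_congr fun o _ => ?_)
  · simp only [raw, mem_closure_edges, CoReachable, and_comm]
  · rw [← doneb_iff, ← doneb_iff, Bool.eq_iff_iff]
    rfl

theorem mem_nextStates {q q₁ : Data} {o : Label α V} {W : List Data} :
    q ∈ nextStates A₁.raw A₂.raw f q₁ o W ↔
      ∃ z ∈ W, agreeb A₁.raw A₂.raw f q₁ z = true ∧
        ∃ z', (z, o, z') ∈ A₂.trans ∧ A₂.SilentReaches z' q := by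
  have : ∀ S, silentClosure A₂.raw.2.2.2 A₂.raw.1 S = silentClosure A₂.trans A₂.states S :=
    fun _ => rfl
  simp only [nextStates, this, mem_silentClosure, List.mem_map, List.mem_filter, Bool.and_eq_true,
    eqb_iff, memb_iff]
  constructor
  · rintro ⟨-, _, ⟨⟨z, o', z'⟩, ⟨h1, rfl, h2, h3⟩, rfl⟩, h4⟩
    exact ⟨z, h2, h3, z', h1, h4⟩
  · rintro ⟨z, h2, h3, z', h1, h4⟩
    exact ⟨h4.reaches.mem_states (A₂.trans_mem _ h1).2, z', ⟨_, ⟨h1, rfl, h2, h3⟩, rfl⟩, h4⟩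

/-- Only the states that pass the agreement test matter for the next set. This allows one to
exchange both the representative of the test and the set it is applied to. -/
theorem nextStates_congr {p q : Data} {o : Label α V} {U W : List Data}
    (h : ∀ z, agreeb A₁.raw A₂.raw f p z = agreeb A₁.raw A₂.raw f q z)
    (h' : ∀ z, agreeb A₁.raw A₂.raw f q z = true → (z ∈ U ↔ z ∈ W)) :
    nextStates A₁.raw A₂.raw f p o U = nextStates A₁.raw A₂.raw f q o W := by
  unfold nextStates
  congr 2
  refine List.filter_congr fun e _ => ?_
  rw [h, Bool.eq_iff_iff]
  simp only [Bool.and_eq_true, memb_iff]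
  have := h' e.1
  tauto

theorem mem_trackedSets_nil {s : List α} {q : Data} (hq : q ∈ A₁.states) (hs : s <:+ d) :
    (s, q, []) ∈ trackedSets A₁.raw A₂.raw d f := by
  simp only [trackedSets, List.mem_flatMap]
  exact ⟨q, hq, s, mem_suffixes.2 hs, [], by simp, List.mem_map.2 ⟨_, mem_setRun_self _ _ _, rfl⟩⟩

theorem mem_trackedSets_singleton {s : List α} {q r : Data} (hq : q ∈ A₁.states) (hs : s <:+ d)
    (hr : r ∈ A₂.states) :
    (s, q, silentClosure A₂.trans A₂.states [r]) ∈ trackedSets A₁.raw A₂.raw d f := by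
  simp only [trackedSets, List.mem_flatMap]
  exact ⟨q, hq, s, mem_suffixes.2 hs, _, List.mem_cons_of_mem _ (List.mem_map.2 ⟨r, hr, rfl⟩),
    List.mem_map.2 ⟨_, mem_setRun_self _ _ _, rfl⟩⟩

/-- `setRun` records all iterates, so the list is closed under reading a letter as long as the test
uses the same `q`. -/
theorem mem_trackedSets_next {s : List α} {a : α} {q : Data} {W : List Data}
    (h : (a :: s, q, W) ∈ trackedSets A₁.raw A₂.raw d f) :
    (s, q, nextStates A₁.raw A₂.raw f q (.letter a) W) ∈ trackedSets A₁.raw A₂.raw d f := by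
  simp only [trackedSets, List.mem_flatMap, List.mem_map] at h ⊢
  obtain ⟨q, hq, s', hs', W', hW', ⟨c, U⟩, hc, h⟩ := h
  simp only [Prod.mk.injEq] at h
  obtain ⟨rfl, rfl, rfl⟩ := h
  exact ⟨q, hq, s', hs', W', hW', _, mem_setRun_next hc, rfl⟩

/-! ### Transitions of the automaton for the difference -/

/-- The states of the automaton for the difference, other than the initial one. -/
def diffState (f q : Data) (s : List α) (W : List Data) : Data := enc (f, q, s, W)

theorem diffState_def (f q : Data) (s : List α) (W : List Data) :
    diffState f q s W = enc (f, q, s, W) := rfl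

theorem diffState_inj {f f' q q' : Data} {s s' : List α} {W W' : List Data} :
    diffState f q s W = diffState f' q' s' W' ↔ f = f' ∧ q = q' ∧ s = s' ∧ W = W' := by
  rw [diffState, diffState, Enc.inj.eq_iff]
  simp

/-- Codes of tuples are never `nil`, so the name `nil` is free for the initial state. -/
theorem diffState_ne_nil {q : Data} {s : List α} {W : List Data} : diffState f q s W ≠ .nil :=
  nofun

/-- The set of states of the second automaton that is tracked initially. -/
def initSet (A₂ : VA α V Data) : List Data := silentClosure A₂.trans A₂.states [A₂.start]

theorem diff_trans_nil {l : Label α V} {z : Data} (h : (.nil, l, z) ∈ (A₁.diff A₂ d).trans) :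
    l = .eps ∧ ∃ f ∈ A₁.accept, z = diffState f A₁.start d (initSet A₂) := by
  obtain ⟨f, hf, h⟩ := List.mem_flatMap.1 h
  rcases List.mem_cons.1 h with h | h
  · simp only [Prod.mk.injEq] at h
    exact ⟨h.2.1, f, hf, h.2.2⟩
  · exfalso
    simp only [List.mem_flatMap] at h
    obtain ⟨e, -, c, -, h⟩ := h
    split at h
    · split at h
      · simp at h
      · simp at h
    · simp at h

theorem diff_trans_start (hf : f ∈ A₁.accept) :
    (.nil, .eps, diffState f A₁.start d (initSet A₂)) ∈ (A₁.diff A₂ d).trans :=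
  List.mem_flatMap.2 ⟨f, hf, List.mem_cons_self⟩

theorem diff_trans_diffState {p z : Data} {s : List α} {W : List Data} {l : Label α V}
    (h : (diffState f p s W, l, z) ∈ (A₁.diff A₂ d).trans) :
    ∃ q, (p, l, q) ∈ A₁.trans ∧
      ((l.isLetter = false ∧ z = diffState f q s W) ∨
        ∃ a t, l = .letter a ∧ s = a :: t ∧
          z = diffState f q t (nextStates A₁.raw A₂.raw f p (.letter a) W)) := by
  obtain ⟨f', hf, h⟩ := List.mem_flatMap.1 h
  rcases List.mem_cons.1 h with h | h
  · simp only [Prod.mk.injEq] at h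
    exact absurd h.1 diffState_ne_nil
  · simp only [List.mem_flatMap] at h
    obtain ⟨⟨p', l', q⟩, he, ⟨s', q', W'⟩, hc, h⟩ := h
    split at h
    · split at h
      · next h' =>
        obtain ⟨a, t, h1, h2⟩ := Label.isHead_iff.1 h'
        simp only at h1 h2
        subst h1 h2
        simp only [List.mem_singleton, Prod.mk.injEq, ← diffState_def, diffState_inj] at h
        obtain ⟨⟨rfl, rfl, rfl, rfl⟩, rfl, rfl⟩ := h
        exact ⟨q, he, .inr ⟨a, t, rfl, rfl, rfl⟩⟩
      · simp at h
    · next h' =>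
      simp only [List.mem_singleton, Prod.mk.injEq, ← diffState_def, diffState_inj] at h
      obtain ⟨⟨rfl, rfl, rfl, rfl⟩, rfl, rfl⟩ := h
      exact ⟨q, he, .inl ⟨by simpa using h', rfl⟩⟩

theorem diff_trans_silent (hf : f ∈ A₁.accept) {p q q' : Data} {s : List α} {W : List Data}
    {l : Label α V} (hl : l.isLetter = false) (he : (p, l, q) ∈ A₁.trans)
    (hc : (s, q', W) ∈ trackedSets A₁.raw A₂.raw d f) :
    (diffState f p s W, l, diffState f q s W) ∈ (A₁.diff A₂ d).trans := by
  refine List.mem_flatMap.2 ⟨f, hf, List.mem_cons_of_mem _ ?_⟩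
  simp only [List.mem_flatMap]
  exact ⟨_, he, _, hc, by simp [hl, diffState]⟩

theorem diff_trans_letter (hf : f ∈ A₁.accept) {p q q' : Data} {s : List α} {W : List Data}
    {a : α} (he : (p, .letter a, q) ∈ A₁.trans)
    (hc : (a :: s, q', W) ∈ trackedSets A₁.raw A₂.raw d f) :
    (diffState f p (a :: s) W, .letter a,
      diffState f q s (nextStates A₁.raw A₂.raw f p (.letter a) W)) ∈ (A₁.diff A₂ d).trans := by
  refine List.mem_flatMap.2 ⟨f, hf, List.mem_cons_of_mem _ ?_⟩
  simp only [List.mem_flatMap]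
  refine ⟨_, he, _, hc, ?_⟩
  have : (Label.letter a : Label α V).isHead (a :: s) = true := Label.isHead_iff.2 ⟨a, s, rfl, rfl⟩
  simp [this, diffState]

theorem mem_diff_accept {z : Data} : z ∈ (A₁.diff A₂ d).accept ↔
    ∃ f ∈ A₁.accept, ∃ q W, ([], q, W) ∈ trackedSets A₁.raw A₂.raw d f ∧
      (∀ q₂ ∈ W, q₂ ∉ A₂.accept) ∧ z = diffState f f ([] : List α) W := by
  change z ∈ diffAccept A₁.raw A₂.raw d ↔ _
  simp only [diffAccept, List.mem_flatMap, List.mem_map, List.mem_filter, Bool.and_eq_true,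
    List.isEmpty_iff, Bool.not_eq_true', List.any_eq_false, memb_iff]
  constructor
  · rintro ⟨f, hf, ⟨s, q, W⟩, ⟨h1, rfl, h2⟩, rfl⟩
    exact ⟨f, hf, q, W, h1, h2, rfl⟩
  · rintro ⟨f, hf, q, W, h1, h2, rfl⟩
    exact ⟨f, hf, _, ⟨h1, rfl, h2⟩, rfl⟩

end VA

/-! ### Synchronous runs -/

/-- The operations in `O` are executed at the same positions in `w` and in `u`, up to the position
of the last letter of `w`. -/
def SyncOn (O : List (Label α V)) (w u : List (Label α V)) : Prop :=
  ∀ o ∈ O, ∀ k ≤ (letters w).length, OccursAt w o k ↔ OccursAt u o k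

/-- Only one position, the one after the last letter, is not covered by `hS`. An operation that
occurs in both words, but at none of the covered positions, must be there in both. -/
theorem occursAt_of_sync {w u : List (Label α V)} {o : Label α V}
    (hw : ∀ k k', OccursAt w o k → OccursAt w o k' → k = k')
    (hS : ∀ k ≤ (letters w).length, OccursAt w o k ↔ OccursAt u o k)
    (hl : (letters u).length = (letters w).length) (hm : o ∈ w → o ∈ u) {k : ℕ}
    (hk : OccursAt w o k) : OccursAt u o k := by
  by_cases h : k ≤ (letters w).length
  · exact (hS k h).1 hk
  · obtain ⟨j, hj⟩ := exists_occursAt (hm hk.mem)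
    have h1 := hj.le
    have h2 := hk.le
    by_cases h' : j ≤ (letters w).length
    · have := hw _ _ hk ((hS j h').2 hj)
      omega
    · obtain rfl : j = k := by omega
      exact hj

theorem occursAt_iff_of_sync {w u : List (Label α V)} {o : Label α V}
    (hw : ∀ k k', OccursAt w o k → OccursAt w o k' → k = k')
    (hu : ∀ k k', OccursAt u o k → OccursAt u o k' → k = k')
    (hS : ∀ k ≤ (letters w).length, OccursAt w o k ↔ OccursAt u o k)
    (hl : (letters u).length = (letters w).length) (hm : o ∈ w ↔ o ∈ u) (k : ℕ) :
    OccursAt w o k ↔ OccursAt u o k :=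
  ⟨occursAt_of_sync hw hS hl hm.1,
    occursAt_of_sync hu (fun k hk => (hS k (hl ▸ hk)).symm) hl.symm hm.2⟩

/-- Everything executed after the letter has position at least `(letters w).length + 2`. -/
theorem occursAt_append_letter {w u : List (Label α V)} {a : α} {o : Label α V}
    (ho : o.isVarOp = true) {k : ℕ} (hk : k ≤ (letters w).length + 1) :
    OccursAt (w ++ .letter a :: u) o k ↔ OccursAt w o k := by
  rw [occursAt_append, or_iff_left]
  rintro ⟨j, hj, rfl⟩
  rcases occursAt_cons.1 hj with ⟨rfl, -⟩ | ⟨i, hi, rfl⟩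
  · simp at ho
  · have := hi.one_le
    simp at hk
    omega

theorem exists_append_letter {u : List (Label α V)} {l : List α} {a : α}
    (h : letters u = l ++ [a]) :
    ∃ u₀ u₁, u = u₀ ++ .letter a :: u₁ ∧ letters u₀ = l ∧ letters u₁ = [] := by
  induction u generalizing l with
  | nil => simp at h
  | cons o u ih =>
    cases o with
    | letter b =>
      rw [letters_cons_letter] at h
      cases l with
      | nil =>
        simp only [List.nil_append, List.cons.injEq] at h
        obtain ⟨rfl, h⟩ := h
        exact ⟨[], u, rfl, rfl, h⟩
      | cons c l =>
        simp only [List.cons_append, List.cons.injEq] at h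
        obtain ⟨rfl, h⟩ := h
        obtain ⟨u₀, u₁, rfl, rfl, h'⟩ := ih h
        exact ⟨.letter b :: u₀, u₁, rfl, rfl, h'⟩
    | _ =>
      obtain ⟨u₀, u₁, rfl, rfl, h'⟩ := ih h
      exact ⟨_ :: u₀, u₁, rfl, rfl, h'⟩

namespace VA

theorem FunctionalOn.occursAt_unique {Q : Type*} {A : VA α V Q} {F : Set Q} {O : Set (Label α V)}
    (hA : A.FunctionalOn F O) {o : Label α V} (ho : o.isVarOp = true) {q g : Q}
    (hg : g ∈ F) (hqg : A.Reaches q g) {w : List (Label α V)} (hw : A.Path A.start w q) (k k' : ℕ)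
    (h : OccursAt w o k) (h' : OccursAt w o k') : k = k' := by
  obtain ⟨v, hv⟩ := hqg
  exact (hA g hg _ (hw.append hv)).1.occursAt_unique ho (occursAt_append.2 (.inl h))
    (occursAt_append.2 (.inl h'))

/-- What holds after the labels `w` have been processed. -/
def DiffInv (A₁ A₂ : VA α V Data) (d : List α) (f : Data) (w : List (Label α V)) (q : Data)
    (s : List α) (W : List Data) : Prop :=
  A₁.Path A₁.start w q ∧ letters w ++ s = d ∧
    (A₁.Reaches q f → ∀ q₂, A₂.CoReachable q₂ →
      (q₂ ∈ W ↔ ∃ u, A₂.Path A₂.start u q₂ ∧ letters u = letters w ∧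
        SyncOn (sharedOps A₁.raw A₂.raw f) w u))

theorem diffInv_start : DiffInv A₁ A₂ d f [] A₁.start d (initSet A₂) := by
  refine ⟨.nil _, rfl, fun _ q₂ _ => ?_⟩
  rw [initSet, mem_silentClosure]
  constructor
  · rintro ⟨-, r, hr, u, hu, h⟩
    obtain rfl := List.mem_singleton.1 hr
    refine ⟨u, h, hu, fun o _ k hk => ?_⟩
    -- Positions start at `1`, so synchrony with the empty word is vacuous.
    obtain rfl : k = 0 := by simpa using hk
    exact ⟨fun h => by simpa using h.one_le, fun h => by simpa using h.one_le⟩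
  · rintro ⟨u, h, hu, -⟩
    exact ⟨h.mem_states A₂.start_mem, _, by simp, u, hu, h⟩

/-- The new label is executed after the last letter, at a position that `SyncOn` does not look at
yet. Hence `W` stays unchanged. -/
theorem DiffInv.silent {w : List (Label α V)} {p q : Data} {s : List α} {W : List Data}
    {l : Label α V} (h : DiffInv A₁ A₂ d f w p s W) (hl : l.isLetter = false)
    (he : (p, l, q) ∈ A₁.trans) : DiffInv A₁ A₂ d f (w ++ [l]) q s W := by
  obtain ⟨h1, h2, h3⟩ := h
  have hlet : letters (w ++ [l]) = letters w := by
    rw [letters_append, letters_cons_of_not_isLetter hl]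
    simp
  refine ⟨h1.append (.single he), by rw [hlet, h2], fun hq q₂ hq₂ => ?_⟩
  rw [h3 (Reaches.trans ⟨_, .single he⟩ hq) q₂ hq₂, hlet]
  refine exists_congr fun u => and_congr Iff.rfl (and_congr Iff.rfl ?_)
  refine forall₂_congr fun o _ => ?_
  rw [hlet]
  refine forall₂_congr fun k hk => ?_
  rw [occursAt_append, or_iff_left]
  rintro ⟨j, hj, rfl⟩
  have := hj.one_le
  omega

/-- Reading a letter brings one more position into the range of `SyncOn`. Given synchrony at the
earlier positions, synchrony there means that the same shared operations have been executed so far,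
which is what `agreeb` tests. -/
theorem DiffInv.letter (hf₁ : A₁.FunctionalOn {f} {o | o ∈ sharedOps A₁.raw A₂.raw f})
    (hf₂ : A₂.FunctionalOn {q | q ∈ A₂.accept} {o | o ∈ sharedOps A₁.raw A₂.raw f})
    {w : List (Label α V)} {p q : Data} {a : α} {s : List α} {W : List Data}
    (h : DiffInv A₁ A₂ d f w p (a :: s) W) (he : (p, .letter a, q) ∈ A₁.trans) :
    DiffInv A₁ A₂ d f (w ++ [.letter a]) q s
      (nextStates A₁.raw A₂.raw f p (.letter a) W) := by
  obtain ⟨h1, h2, h3⟩ := h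
  have hlet : letters (w ++ [Label.letter a]) = letters w ++ [a] := by
    simp [letters_append]
  refine ⟨h1.append (.single he), by rw [hlet, ← h2]; simp, fun hq q₂ hq₂ => ?_⟩
  have hp : A₁.Reaches p f := Reaches.trans ⟨_, .single he⟩ hq
  rw [mem_nextStates, hlet]
  have hdone₁ : ∀ o ∈ sharedOps A₁.raw A₂.raw f, (A₁.Done o p ↔ o ∈ w) := fun o ho =>
    hf₁.done_iff ho (mem_sharedOps ho).1 rfl hp h1
  constructor
  · rintro ⟨z, hz, hpz, z', hz', v, hv, hv'⟩
    obtain ⟨⟨g, hg, hzg⟩, hpz⟩ := agreeb_iff.1 hpz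
    obtain ⟨u, hu, hlu, hS⟩ := (h3 hp z ⟨g, hg, hzg⟩).1 hz
    refine ⟨u ++ .letter a :: v, hu.append (.cons hz' hv'), by simp [letters_append, hlu, hv], ?_⟩
    intro o ho k hk
    have hk' : k ≤ (letters w).length + 1 := by simpa [hlet] using hk
    have ho' := (mem_sharedOps ho).1
    rw [occursAt_append_letter ho' hk', occursAt_append_letter ho' (by rw [hlu]; exact hk')]
    refine occursAt_iff_of_sync (hf₁.occursAt_unique ho' rfl hp h1)
      (hf₂.occursAt_unique ho' hg hzg hu) (hS o ho) (by rw [hlu]) ?_ k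
    rw [← hdone₁ o ho, hpz o ho]
    exact hf₂.done_iff ho ho' hg hzg hu
  · rintro ⟨u, hu, hlu, hS⟩
    obtain ⟨u₀, v, rfl, hlu₀, hv⟩ := exists_append_letter hlu
    obtain ⟨z, hz, h⟩ := path_append_iff.1 hu
    obtain ⟨z', hz', hzv⟩ := path_cons_iff.1 h
    obtain ⟨g, hg, hqg⟩ := hq₂
    have hzg : A₂.Reaches z g := Reaches.trans ⟨_, h⟩ hqg
    -- The range now includes all positions that can occur in `w` and in `u₀`, so synchrony gives
    -- equality of the executed sets.
    have hS' : ∀ o ∈ sharedOps A₁.raw A₂.raw f, ∀ k ≤ (letters w).length + 1,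
        OccursAt w o k ↔ OccursAt u₀ o k := by
      intro o ho k hk
      have ho' := (mem_sharedOps ho).1
      have := hS o ho k (by simpa [hlet] using hk)
      rwa [occursAt_append_letter ho' hk,
        occursAt_append_letter ho' (by rw [hlu₀]; exact hk)] at this
    refine ⟨z, (h3 hp z ⟨g, hg, hzg⟩).2 ⟨u₀, hz, hlu₀, fun o ho k hk => hS' o ho k (by omega)⟩,
      agreeb_iff.2 ⟨⟨g, hg, hzg⟩, fun o ho => ?_⟩, z', hz', v, hv, hzv⟩
    rw [hdone₁ o ho, hf₂.done_iff ho (mem_sharedOps ho).1 hg hzg hz]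
    constructor
    · intro h
      obtain ⟨k, hk⟩ := exists_occursAt h
      exact ((hS' o ho k hk.le).1 hk).mem
    · intro h
      obtain ⟨k, hk⟩ := exists_occursAt h
      exact ((hS' o ho k (by rw [← hlu₀]; exact hk.le)).2 hk).mem

theorem diffInv_of_path (hf₁ : A₁.FunctionalOn {f} {o | o ∈ sharedOps A₁.raw A₂.raw f})
    (hf₂ : A₂.FunctionalOn {q | q ∈ A₂.accept} {o | o ∈ sharedOps A₁.raw A₂.raw f})
    {x z : Data} {w : List (Label α V)} (h : (A₁.diff A₂ d).Path x w z) :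
    ∀ w₀ p s W, x = diffState f p s W → DiffInv A₁ A₂ d f w₀ p s W →
      ∃ q s' W', z = diffState f q s' W' ∧ DiffInv A₁ A₂ d f (w₀ ++ w) q s' W' := by
  induction h with
  | nil => exact fun w₀ p s W hx h => ⟨p, s, W, hx, by simpa using h⟩
  | @cons x y z l w he _ ih =>
    rintro w₀ p s W rfl h
    obtain ⟨q, hq, ⟨hl, hy⟩ | ⟨a, t, rfl, rfl, hy⟩⟩ := diff_trans_diffState he
    · simpa using ih (w₀ ++ [l]) _ _ _ hy (h.silent hl hq)
    · simpa using ih _ _ _ _ hy (h.letter hf₁ hf₂ hq)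

end VA

end

namespace VA

variable {α V : Type*} [Enc α] [Enc V] {A A₁ A₂ : VA α V Data} {f : Data} {d : List α}

/-! ### Every tracked set is among the listed ones -/

/-- `W` and all sets that can arise from it are listed. -/
def Tracked (A₁ A₂ : VA α V Data) (d : List α) (f q : Data) (s : List α) (W : List Data) : Prop :=
  (∃ q', (s, q', W) ∈ trackedSets A₁.raw A₂.raw d f) ∧ (∀ z ∈ W, A₂.Reaches A₂.start z) ∧
    ∀ p, A₁.Reaches q p → A₁.Reaches p f → ∃ q' U, (s, q', U) ∈ trackedSets A₁.raw A₂.raw d f ∧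
      (∀ z, agreeb A₁.raw A₂.raw f q' z = agreeb A₁.raw A₂.raw f p z) ∧
      ∀ z, agreeb A₁.raw A₂.raw f p z = true → (z ∈ U ↔ z ∈ W)

theorem tracked_start : Tracked A₁ A₂ d f A₁.start d (initSet A₂) := by
  refine ⟨⟨_, mem_trackedSets_singleton A₁.start_mem (List.suffix_refl d) A₂.start_mem⟩, ?_, ?_⟩
  · intro z hz
    obtain ⟨-, r, hr, h⟩ := mem_silentClosure.1 hz
    rw [← List.mem_singleton.1 hr]
    exact h.reaches
  · intro p hp _
    exact ⟨p, _, mem_trackedSets_singleton (hp.mem_states A₁.start_mem) (List.suffix_refl d)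
      A₂.start_mem, fun _ => rfl, fun _ _ => Iff.rfl⟩

theorem Tracked.silent {p q : Data} {s : List α} {W : List Data} {l : Label α V}
    (h : Tracked A₁ A₂ d f p s W) (he : (p, l, q) ∈ A₁.trans) : Tracked A₁ A₂ d f q s W :=
  ⟨h.1, h.2.1, fun r hr => h.2.2 r (Reaches.trans ⟨_, .single he⟩ hr)⟩

/-- This is where unique targets keep the number of sets polynomial. For the state `r` from which
the next letter may be read, the part of the new set that agrees with `r` has to be found in a
listed set. -/
theorem Tracked.letter
    (hf₂ : A₂.FunctionalOn {q | q ∈ A₂.accept} {o | o ∈ sharedOps A₁.raw A₂.raw f})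
    (hu : ∀ o ∈ sharedOps A₁.raw A₂.raw f, A₂.UniqueTarget o)
    {p q : Data} {a : α} {s : List α} {W : List Data} (hs : s <:+ d)
    (h : Tracked A₁ A₂ d f p (a :: s) W) (hp : A₁.Reaches A₁.start p)
    (he : (p, .letter a, q) ∈ A₁.trans) (hq : A₁.Reaches q f) :
    Tracked A₁ A₂ d f q s (nextStates A₁.raw A₂.raw f p (.letter a) W) := by
  have hpq : A₁.Reaches p q := ⟨_, .single he⟩
  obtain ⟨-, hreach, h⟩ := h
  obtain ⟨q', U, hU, hq', hUW⟩ := h p ⟨[], .nil p⟩ (hpq.trans hq)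
  have hW' := mem_trackedSets_next hU
  rw [nextStates_congr hq' hUW] at hW'
  refine ⟨⟨q', hW'⟩, ?_, ?_⟩
  · intro z hz
    obtain ⟨y, hy, -, y', hyy', hz⟩ := mem_nextStates.1 hz
    exact (hreach y hy).trans (Reaches.trans ⟨_, .single hyy'⟩ hz.reaches)
  · intro r hqr hrf
    -- If no shared operation is executed between `p` and `r`, their tests coincide and the
    -- representative `q'` can be kept.
    by_cases hsame : ∀ o ∈ sharedOps A₁.raw A₂.raw f, (A₁.Done o p ↔ A₁.Done o r)
    · refine ⟨q', _, hW', fun z => ?_, fun _ _ => Iff.rfl⟩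
      rw [hq', Bool.eq_iff_iff, agreeb_iff, agreeb_iff]
      refine and_congr Iff.rfl (forall₂_congr fun o ho => ?_)
      rw [hsame o ho]
    have hr : r ∈ A₁.states := ((hp.trans hpq).trans hqr).mem_states A₁.start_mem
    by_cases hne : ∃ z ∈ nextStates A₁.raw A₂.raw f p (.letter a) W,
        agreeb A₁.raw A₂.raw f r z = true
    swap
    · refine ⟨r, [], mem_trackedSets_nil hr hs, fun _ => rfl, fun z hz => ?_⟩
      simp only [List.not_mem_nil, false_iff]
      exact fun h => hne ⟨z, h, hz⟩
    -- `Done` is preserved along paths, so a difference between `p` and `r` is an operation that is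
    -- new at `r`.
    obtain ⟨o, ho, hop, hor⟩ : ∃ o ∈ sharedOps A₁.raw A₂.raw f, ¬ A₁.Done o p ∧ A₁.Done o r := by
      by_contra hcon
      push Not at hcon
      exact hsame fun o ho => ⟨fun h => h.mono (hpq.trans hqr), fun h => by
        by_contra h'
        exact hcon o ho h' h⟩
    obtain ⟨t, ht⟩ := hu o ho
    have ho' := (mem_sharedOps ho).1
    -- The source `y` agrees with `p` and has not executed `o`, while `z` agrees with `r` and has;
    -- thus `o` lies on the silent part after the letter, which therefore passes through `t`.
    have key : ∀ z ∈ nextStates A₁.raw A₂.raw f p (.letter a) W,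
        agreeb A₁.raw A₂.raw f r z = true → t ∈ A₂.states ∧ A₂.SilentReaches t z ∧
          ∃ y ∈ W, agreeb A₁.raw A₂.raw f p y = true ∧
            ∃ y', (y, .letter a, y') ∈ A₂.trans ∧ A₂.SilentReaches y' t := by
      intro z hz hrz
      obtain ⟨y, hy, hpy, y', hyy', v, hv, hv'⟩ := mem_nextStates.1 hz
      obtain ⟨⟨g, hg, hzg⟩, hrz⟩ := agreeb_iff.1 hrz
      obtain ⟨w, hw⟩ := hreach y hy
      have h1 : o ∈ w ++ .letter a :: v :=
        (hf₂.done_iff ho ho' hg hzg (hw.append (.cons hyy' hv'))).1 ((hrz o ho).1 hor)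
      have h2 : o ∉ w := fun h => hop (((agreeb_iff.1 hpy).2 o ho).2 ⟨w, hw, h⟩)
      have h3 : o ∈ v := by
        rcases List.mem_append.1 h1 with h | h
        · exact absurd h h2
        · rcases List.mem_cons.1 h with rfl | h
          · simp at ho'
          · exact h
      obtain ⟨v₁, v₂, rfl⟩ := List.append_of_mem h3
      obtain ⟨x, hx, h⟩ := path_append_iff.1 hv'
      obtain ⟨t', hxt, h⟩ := path_cons_iff.1 h
      obtain rfl := ht _ _ hxt
      rw [letters_append, letters_cons_of_not_isLetter (Label.isLetter_of_isVarOp ho'),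
        List.append_eq_nil_iff] at hv
      refine ⟨(A₂.trans_mem _ hxt).2, ⟨v₂, hv.2, h⟩, y, hy, hpy, y', hyy', v₁ ++ [o], ?_,
        hx.append (.single hxt)⟩
      rw [letters_append, letters_cons_of_not_isLetter (Label.isLetter_of_isVarOp ho'), hv.1]
      rfl
    obtain ⟨z₀, hz₀, hrz₀⟩ := hne
    obtain ⟨ht', -, y, hy, hpy, y', hyy', v, hv, hvt⟩ := key z₀ hz₀ hrz₀
    -- The silent closure of `t` serves: it lies in the new set because `t` is reached silently
    -- after the letter, and by `key` it contains all states that agree with `r`.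
    refine ⟨r, _, mem_trackedSets_singleton hr hs ht', fun _ => rfl, fun z hz => ⟨fun h => ?_,
      fun h => ?_⟩⟩
    · obtain ⟨-, t', ht', u, hu, huz⟩ := mem_silentClosure.1 h
      obtain rfl := List.mem_singleton.1 ht'
      exact mem_nextStates.2 ⟨y, hy, hpy, y', hyy', v ++ u, by rw [letters_append, hv, hu]; rfl,
        hvt.append huz⟩
    · have h' := (key z h hz).2.1
      exact mem_silentClosure.2 ⟨h'.reaches.mem_states ht', t, by simp, h'⟩

/-- Transitions exist only at listed sets, and `Tracked` guarantees that a run towards `f` never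
leaves the list. -/
theorem exists_diff_path (hf : f ∈ A₁.accept)
    (hf₂ : A₂.FunctionalOn {q | q ∈ A₂.accept} {o | o ∈ sharedOps A₁.raw A₂.raw f})
    (hu : ∀ o ∈ sharedOps A₁.raw A₂.raw f, A₂.UniqueTarget o) {p q : Data}
    {w : List (Label α V)} (h : A₁.Path p w q) : ∀ s W, letters w <+: s → s <:+ d →
      A₁.Reaches A₁.start p → A₁.Reaches q f → Tracked A₁ A₂ d f p s W →
      ∃ s' W', letters w ++ s' = s ∧
        (A₁.diff A₂ d).Path (diffState f p s W) w (diffState f q s' W') ∧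
        Tracked A₁ A₂ d f q s' W' := by
  induction h with
  | nil => exact fun s W _ _ _ _ hT => ⟨s, W, rfl, .nil _, hT⟩
  | @cons p q r l w he hw ih =>
    intro s W hws hs hp hr hT
    have hpq : A₁.Reaches p q := ⟨_, .single he⟩
    obtain ⟨q', hc⟩ := hT.1
    by_cases hl : l.isLetter = true
    · obtain ⟨a, rfl⟩ : ∃ a, l = .letter a := by cases l <;> simp at hl ⊢
      cases s with
      | nil => simp at hws
      | cons b s =>
        rw [letters_cons_letter, List.cons_prefix_cons] at hws
        obtain ⟨rfl, hws⟩ := hws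
        have hs' := (List.suffix_cons a s).trans hs
        obtain ⟨s', W', h1, h2, h3⟩ := ih s _ hws hs' (hp.trans hpq) hr
          (hT.letter hf₂ hu hs' hp he (Reaches.trans ⟨_, hw⟩ hr))
        exact ⟨s', W', by simp [h1], .cons (diff_trans_letter hf he hc) h2, h3⟩
    · have hl : l.isLetter = false := by simpa using hl
      rw [letters_cons_of_not_isLetter hl] at hws ⊢
      obtain ⟨s', W', h1, h2, h3⟩ := ih s W hws hs (hp.trans hpq) hr (hT.silent he)
      exact ⟨s', W', h1, .cons (diff_trans_silent hf hl he hc) h2, h3⟩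

/-! ### Correctness of the automaton for the difference -/

theorem mem_vars_of_mem {o : Label α V} {x : V} (ho : o = .op x ∨ o = .cl x) {q : Data}
    (h : A.Done o q) : x ∈ A.vars := by
  obtain ⟨w, hw, how⟩ := h
  obtain ⟨w₁, w₂, rfl⟩ := List.append_of_mem how
  obtain ⟨p, -, h⟩ := path_append_iff.1 hw
  obtain ⟨r, he, -⟩ := path_cons_iff.1 h
  rcases ho with rfl | rfl
  · exact ⟨p, r, .inl he⟩
  · exact ⟨p, r, .inr he⟩

theorem Sequential.valid {Q : Type*} {A : VA α V Q} (h : A.Sequential) {f : Q} (hf : f ∈ A.accept)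
    {w : List (Label α V)} (hw : A.Path A.start w f) : Valid w :=
  h _ w ⟨rfl, f, hf, hw⟩

theorem exists_var_of_mem_sharedOps {o : Label α V} (ho : o ∈ sharedOps A₁.raw A₂.raw f) :
    ∃ x ∈ A₁.vars ∩ A₂.vars, o = .op x ∨ o = .cl x := by
  obtain ⟨ho, h₁, f₂, -, h₂⟩ := mem_sharedOps ho
  obtain ⟨x, hx⟩ := Label.isVarOp_iff.1 ho
  exact ⟨x, ⟨mem_vars_of_mem hx h₁, mem_vars_of_mem hx h₂⟩, hx⟩

/-- A shared operation occurs on some run to `f`, which is valid and so both opens and closes its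
variable. Of the three configurations of `f` only `closed` remains, and it speaks of all runs to
`f`. -/
theorem SemiFunctional.functionalOn (h : A₁.SemiFunctional (A₁.vars ∩ A₂.vars))
    (hseq : A₁.Sequential) (hf : f ∈ A₁.accept) :
    A₁.FunctionalOn {f} {o | o ∈ sharedOps A₁.raw A₂.raw f} := by
  rintro _ rfl w hw
  refine ⟨hseq.valid hf hw, fun o ho => ?_⟩
  obtain ⟨x, hx, hox⟩ := exists_var_of_mem_sharedOps ho
  obtain ⟨-, ⟨u, hu, hou⟩, -⟩ := mem_sharedOps ho
  have hval := hseq.valid hf hu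
  have h1 : .op x ∈ u := by
    rcases hox with rfl | rfl
    · exact hou
    · exact hval.mem_iff.2 hou
  rcases h x hx _ (A₁.accept_mem _ hf) ⟨_, hf, [], .nil _⟩ with h | h | h
  · exact absurd h1 (h u hu)
  · exact absurd (hval.mem_iff.1 h1) (h u hu).2
  · rcases hox with rfl | rfl
    · exact (h w hw).1
    · exact (h w hw).2

/-- An accepting run that contains a shared operation excludes the alternative that no accepting run
operates on its variable. -/
theorem Synchronized.functionalOn (h : A₂.Synchronized (A₁.vars ∩ A₂.vars))
    (hseq : A₂.Sequential) :
    A₂.FunctionalOn {q | q ∈ A₂.accept} {o | o ∈ sharedOps A₁.raw A₂.raw f} := by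
  intro g hg w hw
  refine ⟨hseq.valid hg hw, fun o ho => ?_⟩
  obtain ⟨x, hx, hox⟩ := exists_var_of_mem_sharedOps ho
  obtain ⟨-, -, f₂, hf₂, u, hu, hou⟩ := mem_sharedOps ho
  rcases (h x hx).2.2 with h | h
  · have := h _ w ⟨rfl, g, hg, hw⟩
    rcases hox with rfl | rfl
    · exact this.1
    · exact this.2
  · have := h _ u ⟨rfl, f₂, hf₂, hu⟩
    rcases hox with rfl | rfl
    · exact absurd hou this.1
    · exact absurd hou this.2

theorem Synchronized.uniqueTarget (h : A₂.Synchronized (A₁.vars ∩ A₂.vars)) {o : Label α V}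
    (ho : o ∈ sharedOps A₁.raw A₂.raw f) : A₂.UniqueTarget o := by
  obtain ⟨x, hx, rfl | rfl⟩ := exists_var_of_mem_sharedOps ho
  · exact (h x hx).1
  · exact (h x hx).2.1

/-- A variable with a shared operation is in both domains, so compatibility fixes its positions.
Conversely, if both mappings are defined at a variable, its two operations are shared. -/
theorem compatible_iff
    (hf₁ : A₁.FunctionalOn {f} {o | o ∈ sharedOps A₁.raw A₂.raw f})
    (hf₂ : A₂.FunctionalOn {q | q ∈ A₂.accept} {o | o ∈ sharedOps A₁.raw A₂.raw f})
    {w u : List (Label α V)} {f₂ : Data} (hw : A₁.Path A₁.start w f) (hu : A₂.Path A₂.start u f₂)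
    (hf₂' : f₂ ∈ A₂.accept) {μ ν : Mapping V} (hμ : IsMappingOf w μ) (hν : IsMappingOf u ν) :
    Mapping.Compatible μ ν ↔
      ∀ o ∈ sharedOps A₁.raw A₂.raw f, ∀ k, OccursAt w o k ↔ OccursAt u o k := by
  obtain ⟨hw', hwO⟩ := hf₁ f rfl w hw
  obtain ⟨hu', huO⟩ := hf₂ f₂ hf₂' u hu
  rw [isMappingOf_iff] at hμ hν
  constructor
  · intro h o ho k
    have h1 := hwO o ho
    have h2 := huO o ho
    have ho' := (mem_sharedOps ho).1
    obtain ⟨x, -, hox⟩ := exists_var_of_mem_sharedOps ho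
    obtain ⟨s, hs⟩ := hw'.exists_span (x := x) (by
      rcases hox with rfl | rfl
      · exact h1
      · exact hw'.mem_iff.2 h1)
    obtain ⟨t, ht⟩ := hu'.exists_span (x := x) (by
      rcases hox with rfl | rfl
      · exact h2
      · exact hu'.mem_iff.2 h2)
    obtain rfl := h x s t ((hμ x s).2 hs) ((hν x t).2 ht)
    obtain ⟨j, hj, hj'⟩ : ∃ j, OccursAt w o j ∧ OccursAt u o j := by
      rcases hox with rfl | rfl
      · exact ⟨_, hs.1, ht.1⟩
      · exact ⟨_, hs.2, ht.2⟩
    exact ⟨fun h => hw'.occursAt_unique ho' hj h ▸ hj', fun h => hu'.occursAt_unique ho' hj' h ▸ hj⟩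
  · intro h x s t hs ht
    rw [hμ] at hs
    rw [hν] at ht
    have key : ∀ o : Label α V, o.isVarOp = true → ∀ j k, OccursAt w o j → OccursAt u o k →
        j = k := by
      intro o ho j k hj hk
      have := (h o (mem_sharedOps_of ho ⟨w, hw, hj.mem⟩ hf₂' ⟨u, hu, hk.mem⟩) j).1 hj
      exact hu'.occursAt_unique ho this hk
    exact Span.ext (key (.op x) rfl _ _ hs.1 ht.1) (key (.cl x) rfl _ _ hs.2 ht.2)

/-- Soundness. A compatible mapping would come from an accepting run of `A₂` synchronous with `u`,
and `DiffInv` would put its accepting state into the final set. The document of the run is forced to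
be `d`, since the rest of `d` is part of the state. -/
theorem diff_acceptingRun (hseq₁ : A₁.Sequential) (hseq₂ : A₂.Sequential)
    (h₁ : A₁.SemiFunctional (A₁.vars ∩ A₂.vars)) (h₂ : A₂.Synchronized (A₁.vars ∩ A₂.vars))
    {d' : List α} {w : List (Label α V)} (h : (A₁.diff A₂ d).AcceptingRun d' w) :
    ∃ u, w = .eps :: u ∧ letters u = d ∧ ∃ f ∈ A₁.accept, A₁.Path A₁.start u f ∧
      ∀ μ, IsMappingOf u μ → ∀ ν ∈ A₂.spanner d, ¬ Mapping.Compatible μ ν := by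
  obtain ⟨-, z, hz, hw⟩ := h
  obtain ⟨f, hf, q', W, -, hW, rfl⟩ := mem_diff_accept.1 hz
  cases hw with
  | @cons _ y _ l u he hu =>
    obtain ⟨rfl, g, -, rfl⟩ := diff_trans_nil he
    have hf₂ := h₂.functionalOn hseq₂ (f := g)
    -- No transition changes the guessed accepting state.
    have hg : g = f := by
      by_contra hne
      have : ∀ {x z : Data} {w : List (Label α V)}, (A₁.diff A₂ d).Path x w z → ∀ p (s : List α) W,
          x = diffState g p s W → ∃ q, ∃ s' : List α, ∃ W', z = diffState g q s' W' := by
        intro x z w h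
        induction h with
        | nil => exact fun p s W h => ⟨p, s, W, h⟩
        | cons he _ ih =>
          rintro p s W rfl
          obtain ⟨q, -, ⟨-, hy⟩ | ⟨a, t, -, -, hy⟩⟩ := diff_trans_diffState he
          · exact ih _ _ _ hy
          · exact ih _ _ _ hy
      obtain ⟨q, s', W', h⟩ := this hu _ _ _ rfl
      exact hne (diffState_inj.1 h).1.symm
    subst hg
    have hf₁ := h₁.functionalOn hseq₁ hf
    obtain ⟨q, s', W', h, hpath, hlet, hsets⟩ :=
      diffInv_of_path hf₁ hf₂ hu [] _ _ _ rfl diffInv_start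
    obtain ⟨-, rfl, rfl, rfl⟩ := diffState_inj.1 h
    simp only [List.nil_append, List.append_nil] at hpath hlet hsets
    refine ⟨u, rfl, hlet, g, hf, hpath, ?_⟩
    rintro μ hμ ν ⟨v, ⟨hv, f₂, hf₂', hvp⟩, -, hν⟩ hcomp
    rw [compatible_iff hf₁ hf₂ hpath hvp hf₂' hμ hν] at hcomp
    refine hW f₂ ?_ hf₂'
    exact (hsets ⟨[], .nil _⟩ f₂ ⟨f₂, hf₂', [], .nil _⟩).2
      ⟨v, hvp, by rw [hv, hlet], fun o ho k _ => hcomp o ho k⟩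

/-- Completeness. An accepting state in the final set would give a run of `A₂` synchronous with `w`
up to the last letter. Both runs contain all shared operations, so they are synchronous everywhere
and the mappings would be compatible. -/
theorem exists_diff_acceptingRun (hseq₁ : A₁.Sequential) (hseq₂ : A₂.Sequential)
    (h₁ : A₁.SemiFunctional (A₁.vars ∩ A₂.vars)) (h₂ : A₂.Synchronized (A₁.vars ∩ A₂.vars))
    {w : List (Label α V)} (hf : f ∈ A₁.accept) (hw : A₁.Path A₁.start w f)
    (hlet : letters w = d) {μ : Mapping V} (hμ : IsMappingOf w μ)
    (hcomp : ∀ ν ∈ A₂.spanner d, ¬ Mapping.Compatible μ ν) :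
    (A₁.diff A₂ d).AcceptingRun d (.eps :: w) := by
  have hf₁ := h₁.functionalOn hseq₁ hf
  have hf₂ := h₂.functionalOn hseq₂ (f := f)
  obtain ⟨s, W, h1, h2, ⟨q', h3⟩, -⟩ := exists_diff_path (d := d) hf hf₂
    (fun o ho => h₂.uniqueTarget ho) hw d _ (by rw [hlet]) (List.suffix_refl d) ⟨[], .nil _⟩
    ⟨[], .nil _⟩ tracked_start
  obtain rfl : s = [] := by
    rw [hlet] at h1
    simpa using h1
  refine ⟨hlet, _, mem_diff_accept.2 ⟨f, hf, q', W, h3, ?_, rfl⟩, .cons (diff_trans_start hf) h2⟩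
  intro f₂ hf₂W hf₂'
  obtain ⟨q, s', W', h, -, -, hsets⟩ := diffInv_of_path hf₁ hf₂ h2 [] _ _ _ rfl diffInv_start
  obtain ⟨-, rfl, rfl, rfl⟩ := diffState_inj.1 h
  obtain ⟨u, hu, hlu, hS⟩ := (hsets ⟨[], .nil _⟩ f₂ ⟨f₂, hf₂', [], .nil _⟩).1 hf₂W
  rw [List.nil_append] at hlu hS
  have hval := hseq₂.valid hf₂' hu
  obtain ⟨ν, hν⟩ := hval.exists_isMappingOf
  refine hcomp ν ⟨u, ⟨by rw [hlu, hlet], f₂, hf₂', hu⟩, hval, hν⟩ ?_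
  rw [compatible_iff hf₁ hf₂ hw hu hf₂' hμ hν]
  intro o ho
  have ho' := (mem_sharedOps ho).1
  have hw' := hf₁ f rfl w hw
  exact occursAt_iff_of_sync (fun _ _ => hw'.1.occursAt_unique ho')
    (fun _ _ => hval.occursAt_unique ho') (hS o ho) (by rw [hlu])
    ⟨fun _ => (hf₂ f₂ hf₂' u hu).2 o ho, fun _ => hw'.2 o ho⟩

theorem isMappingOf_cons_eps {w : List (Label α V)} {μ : Mapping V} :
    IsMappingOf (.eps :: w) μ ↔ IsMappingOf w μ := by
  have : ∀ o : Label α V, o ≠ .eps → ∀ k, OccursAt (.eps :: w) o k ↔ OccursAt w o k := by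
    intro o ho k
    rw [occursAt_cons]
    simp [ho.symm]
  rw [isMappingOf_iff, isMappingOf_iff]
  simp [this]

theorem diff_sequential (hseq₁ : A₁.Sequential) (hseq₂ : A₂.Sequential)
    (h₁ : A₁.SemiFunctional (A₁.vars ∩ A₂.vars)) (h₂ : A₂.Synchronized (A₁.vars ∩ A₂.vars)) :
    (A₁.diff A₂ d).Sequential := by
  intro d' w h
  obtain ⟨u, rfl, -, f, hf, hu, -⟩ := diff_acceptingRun hseq₁ hseq₂ h₁ h₂ h
  exact valid_cons_eps.2 (hseq₁.valid hf hu)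

theorem diff_spanner (hseq₁ : A₁.Sequential) (hseq₂ : A₂.Sequential)
    (h₁ : A₁.SemiFunctional (A₁.vars ∩ A₂.vars)) (h₂ : A₂.Synchronized (A₁.vars ∩ A₂.vars)) :
    (A₁.diff A₂ d).spanner d = SchemalessSpanner.difference A₁.spanner A₂.spanner d := by
  ext μ
  constructor
  · rintro ⟨w, hw, hval, hμ⟩
    obtain ⟨u, rfl, hlet, f, hf, hu, hcomp⟩ := diff_acceptingRun hseq₁ hseq₂ h₁ h₂ hw
    rw [isMappingOf_cons_eps] at hμ
    exact ⟨⟨u, ⟨hlet, f, hf, hu⟩, valid_cons_eps.1 hval, hμ⟩, hcomp μ hμ⟩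
  · rintro ⟨⟨w, ⟨hlet, f, hf, hw⟩, hval, hμ⟩, hcomp⟩
    exact ⟨_, exists_diff_acceptingRun hseq₁ hseq₂ h₁ h₂ hf hw hlet hμ hcomp,
      valid_cons_eps.2 hval, isMappingOf_cons_eps.2 hμ⟩

end VA

section

variable {β γ δ : Type*} [Enc β] [Enc γ] [Enc δ]

/-! ### Enumeration by binary search on the members of sets

A node of the search tree consists of the list of the elements chosen so far, the list of the
elements rejected so far and the list of the remaining elements. -/

/-- The sets (as lists) found below a feasible node of the search tree. -/
def solutions (feas : List β → List β → Bool) : List β → List β → List β → List (List β)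
  | C, _, [] => [C]
  | C, N, a :: R =>
    (if feas (a :: C) N = true then solutions feas (a :: C) N R else []) ++
      (if feas C (a :: N) = true then solutions feas C (a :: N) R else [])

/-- One step towards the first leaf of the search tree; skipped feasible nodes are put on a
stack. -/
def descendStep (feas : List β → List β → Bool)
    (s : List β × List β × List (List β × List β × List β)) (a : β) (R : List β) :
    List β × List β × List (List β × List β × List β) :=
  if feas (a :: s.1) s.2.1 = true then
    (a :: s.1, s.2.1, if feas s.1 (a :: s.2.1) = true then (s.1, a :: s.2.1, R) :: s.2.2 else s.2.2)
  else (s.1, a :: s.2.1, s.2.2)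

/-- The first leaf below a node, and the new stack. -/
def descend (feas : List β → List β → Bool) (n : List β × List β × List β)
    (stk : List (List β × List β × List β)) :
    List β × List β × List (List β × List β × List β) :=
  foldTails (descendStep feas) (n.1, n.2.1, stk) n.2.2

/-- Invariant of the nodes of the search. -/
def GoodNode (feas : List β → List β → Bool) (E : List β) (n : List β × List β × List β) : Prop :=
  feas n.1 n.2.1 = true ∧ (n.1 ++ (n.2.1 ++ n.2.2)).Perm E

/-- Invariant of the stack. -/
def GoodStack (feas : List β → List β → Bool) (E : List β) :
    List (List β × List β × List β) → Prop
  | [] => True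
  | n :: stk => GoodNode feas E n ∧ stk.length + n.2.2.length ≤ E.length ∧ GoodStack feas E stk

/-- The solutions below the nodes of a stack. -/
def stackSolutions (feas : List β → List β → Bool) (stk : List (List β × List β × List β)) :
    List (List β) :=
  stk.flatMap fun n => solutions feas n.1 n.2.1 n.2.2

/-- Below a feasible node one of the two children is feasible, so the descent always ends in a
solution, and the pushed siblings hold exactly the remaining ones, in order. A sibling is pushed
when one element leaves the remaining list, which preserves the bound on the length of the stack. -/
theorem descend_spec {feas : List β → List β → Bool} {E : List β}
    (hfeas : ∀ C N a R, (C ++ (N ++ a :: R)).Perm E → feas C N = true →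
      feas (a :: C) N = true ∨ feas C (a :: N) = true) (R : List β) :
    ∀ C N stk, GoodNode feas E (C, N, R) → stk.length + R.length ≤ E.length →
      GoodStack feas E stk →
      GoodStack feas E (descend feas (C, N, R) stk).2.2 ∧
        solutions feas C N R ++ stackSolutions feas stk =
          (descend feas (C, N, R) stk).1 ::
            stackSolutions feas (descend feas (C, N, R) stk).2.2 := by
  induction R with
  | nil => exact fun C N stk _ _ h => ⟨h, rfl⟩
  | cons a R ih =>
    intro C N stk ⟨hCN, hperm⟩ hlen hstk
    simp only at hCN hperm
    simp only [List.length_cons] at hlen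
    have hperm₁ : (a :: C ++ (N ++ R)).Perm E := by
      refine List.Perm.trans ?_ hperm
      rw [← List.append_assoc, ← List.append_assoc]
      exact List.perm_middle.symm
    have hperm₂ : (C ++ (a :: N ++ R)).Perm E :=
      (List.Perm.append_left C List.perm_middle.symm).trans hperm
    by_cases h₁ : feas (a :: C) N = true
    · by_cases h₂ : feas C (a :: N) = true
      · obtain ⟨h3, h4⟩ := ih (a :: C) N ((C, a :: N, R) :: stk) ⟨h₁, hperm₁⟩ (by simp; omega)
          ⟨⟨h₂, hperm₂⟩, by simp; omega, hstk⟩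
        have h5 : descend feas (C, N, a :: R) stk =
            descend feas (a :: C, N, R) ((C, a :: N, R) :: stk) := by
          simp [descend, foldTails, descendStep, h₁, h₂]
        rw [h5, ← h4]
        refine ⟨h3, ?_⟩
        simp [solutions, h₁, h₂, stackSolutions]
      · obtain ⟨h3, h4⟩ := ih (a :: C) N stk ⟨h₁, hperm₁⟩ (by omega) hstk
        have h5 : descend feas (C, N, a :: R) stk = descend feas (a :: C, N, R) stk := by
          simp [descend, foldTails, descendStep, h₁, h₂]
        rw [h5, ← h4]
        refine ⟨h3, ?_⟩
        simp [solutions, h₁, h₂]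
    · have h₂ := (hfeas C N a R hperm hCN).resolve_left h₁
      obtain ⟨h3, h4⟩ := ih C (a :: N) stk ⟨h₂, hperm₂⟩ (by omega) hstk
      have h5 : descend feas (C, N, a :: R) stk = descend feas (C, a :: N, R) stk := by
        simp [descend, foldTails, descendStep, h₁]
      rw [h5, ← h4]
      refine ⟨h3, ?_⟩
      simp [solutions, h₁, h₂]

@[fun_prop]
theorem PolyTime.descend {feas : γ → List β → List β → Bool}
    (hfeas : PolyTime fun p : γ × List β × List β => feas p.1 p.2.1 p.2.2)
    {x : δ → γ} (hx : PolyTime x) {n : δ → List β × List β × List β} (hn : PolyTime n)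
    {stk : δ → List (List β × List β × List β)} (hstk : PolyTime stk) :
    PolyTime fun y => Spanner.descend (feas (x y)) (n y) (stk y) := by
  suffices key : PolyTime fun y : γ × (List β × List β × List β) ×
      List (List β × List β × List β) => Spanner.descend (feas y.1) y.2.1 y.2.2 from
    key.comp (hx.prodMk (hn.prodMk hstk))
  unfold Spanner.descend
  -- `D` bounds the size of one pushed node: `2 * X + X * (X + 1)` for the chosen and rejected lists
  -- together, `X` for what remains, and a constant for the constructors.
  let D : Polynomial ℕ := 2 * .X + .X * (.X + 1) + .X + 10
  refine foldTails_of_invariant (γ := γ × (List β × List β × List β) ×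
      List (List β × List β × List β)) (g := fun y s a R => descendStep (feas y.1) s a R) ?_
    (by fun_prop) (by fun_prop)
    (fun y l s => l <:+ y.2.1.2.2 ∧
      esize s.1 + esize s.2.1 + l.length * (esize y + 1) ≤ 2 * esize y + esize y * (esize y + 1) ∧
      esize s.2.2 + l.length * D.eval (esize y) ≤ esize y + esize y * D.eval (esize y))
    ?_ ?_ (D + .X + .X * D) ?_
  · unfold descendStep
    have h1 : PolyTime fun p : (γ × (List β × List β × List β) × List (List β × List β × List β)) ×
        (List β × List β × List (List β × List β × List β)) × β × List β =>
        feas p.1.1 (p.2.2.1 :: p.2.1.1) p.2.1.2.1 :=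
      hfeas.comp (f := fun p : (γ × (List β × List β × List β) ×
        List (List β × List β × List β)) ×
        (List β × List β × List (List β × List β × List β)) × β × List β =>
        (p.1.1, p.2.2.1 :: p.2.1.1, p.2.1.2.1)) (by fun_prop)
    have h2 : PolyTime fun p : (γ × (List β × List β × List β) × List (List β × List β × List β)) ×
        (List β × List β × List (List β × List β × List β)) × β × List β =>
        feas p.1.1 p.2.1.1 (p.2.2.1 :: p.2.1.2.1) :=
      hfeas.comp (f := fun p : (γ × (List β × List β × List β) ×
        List (List β × List β × List β)) ×
        (List β × List β × List (List β × List β × List β)) × β × List β =>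
        (p.1.1, p.2.1.1, p.2.2.1 :: p.2.1.2.1)) (by fun_prop)
    exact .ite h1 (by fun_prop) (by fun_prop)
  · rintro ⟨x, ⟨C, N, R⟩, stk⟩
    have h1 : R.length ≤ esize (x, (C, N, R), stk) := by
      have := length_lt_esize R
      simp; omega
    have h2 := Nat.mul_le_mul_right (esize (x, (C, N, R), stk) + 1) h1
    have h3 := Nat.mul_le_mul_right (D.eval (esize (x, (C, N, R), stk))) h1
    have h4 : esize C + esize N + esize stk ≤ esize (x, (C, N, R), stk) := by simp; omega
    exact ⟨List.suffix_refl _, by simp only; omega, by simp only; omega⟩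
  · rintro y ⟨C, N, stk⟩ a R ⟨h1, h2, h3⟩
    have h4 : esize (a :: R) ≤ esize y := by
      refine (esize_le_of_sublist h1.sublist).trans ?_
      simp only [esize_prod]
      omega
    have h5 := Nat.le_mul_of_pos_left (esize y + 1) (show 0 < (a :: R).length by simp)
    simp only [esize_cons, List.length_cons, Nat.add_mul, one_mul] at h2 h3 h4 h5
    have hD : D.eval (esize y) = 2 * esize y + esize y * (esize y + 1) + esize y + 10 := by
      simp [D]
    refine ⟨(List.suffix_cons a R).trans h1, ?_, ?_⟩
    · unfold descendStep
      split <;> simp only [esize_cons] <;> omega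
    · have : esize (descendStep (feas y.1) (C, N, stk) a R).2.2 ≤
          esize stk + D.eval (esize y) := by
        rw [hD]
        unfold descendStep
        split
        · simp only
          split
          · simp only [esize_cons, esize_pair]
            omega
          · omega
        · simp only
          omega
      omega
  · rintro y ⟨C, N, stk⟩ l ⟨-, h2, h3⟩
    have hD : D.eval (esize y) = 2 * esize y + esize y * (esize y + 1) + esize y + 10 := by
      simp [D]
    simp only [Polynomial.eval_add, Polynomial.eval_mul, Polynomial.eval_X, esize_pair] at *
    omega

theorem esize_perm {l l' : List β} (h : l.Perm l') : esize l = esize l' := by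
  induction h with
  | nil => rfl
  | cons a _ ih => simp [ih]
  | swap a b l => simp; omega
  | trans _ _ h1 h2 => rw [h1, h2]

theorem GoodStack.length_le {feas : List β → List β → Bool} {E : List β}
    {stk : List (List β × List β × List β)} (h : GoodStack feas E stk) :
    stk.length ≤ E.length + 1 := by
  cases stk with
  | nil => simp
  | cons n stk =>
    have := h.2.1
    simp
    omega

/-- A node is a partition of `E` into three lists, which costs two additional empty lists and two
pairs. -/
theorem GoodStack.esize_le_of_mem {feas : List β → List β → Bool} {E : List β}
    {stk : List (List β × List β × List β)} (h : GoodStack feas E stk) :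
    ∀ n ∈ stk, esize n ≤ esize E + 4 := by
  induction stk with
  | nil => simp
  | cons n stk ih =>
    intro m hm
    rcases List.mem_cons.1 hm with rfl | hm
    · obtain ⟨C, N, R⟩ := m
      have h1 := esize_perm h.1.2
      have h2 := esize_append C (N ++ R)
      have h3 := esize_append N R
      simp only [esize_pair] at *
      omega
    · exact ih h.2.2 m hm

/-- The first element of a list of nodes. -/
def topNode (stk : List (List β × List β × List β)) : List β × List β × List β :=
  stk.headD ([], [], [])

@[fun_prop]
theorem PolyTime.topNode {f : γ → List (List β × List β × List β)} (hf : PolyTime f) :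
    PolyTime fun x => Spanner.topNode (f x) := by
  have h1 : PolyTime fun x : Data => if Spanner.eqb x .nil = true then
      enc (([], [], []) : List β × List β × List β) else x.head := by fun_prop
  have h2 : PolyTime fun l : List (List β × List β × List β) => Spanner.topNode l :=
    h1.ofData fun l => by cases l <;> rfl
  exact h2.comp hf

/-- One use of the enumeration program: outputs the next element and the new memory content. -/
def enumStep (feas : γ → List β → List β → Bool) (out : γ → List β → δ)
    (m : γ × List (List β × List β × List β)) : Data :=
  if m.2.isEmpty = true then .nil
  else .cons (enc (out m.1 (descend (feas m.1) (topNode m.2) m.2.tail).1))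
    (enc (m.1, (descend (feas m.1) (topNode m.2) m.2.tail).2.2))

theorem PolyTime.enumStep {feas : γ → List β → List β → Bool}
    (hfeas : PolyTime fun p : γ × List β × List β => feas p.1 p.2.1 p.2.2)
    {out : γ → List β → δ} (hout : PolyTime fun p : γ × List β => out p.1 p.2) :
    PolyTime fun m => Spanner.enumStep feas out m := by
  have h1 : PolyTime fun m : γ × List (List β × List β × List β) =>
      Spanner.descend (feas m.1) (Spanner.topNode m.2) m.2.tail :=
    PolyTime.descend hfeas (by fun_prop) (by fun_prop) (by fun_prop)
  have h2 : PolyTime fun m : γ × List (List β × List β × List β) =>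
      out m.1 (Spanner.descend (feas m.1) (Spanner.topNode m.2) m.2.tail).1 :=
    hout.comp (f := fun m : γ × List (List β × List β × List β) =>
      (m.1, (Spanner.descend (feas m.1) (Spanner.topNode m.2) m.2.tail).1)) (by fun_prop)
  unfold Spanner.enumStep
  fun_prop

/-- All solutions. -/
def allSolutions (feas : List β → List β → Bool) (E : List β) : List (List β) :=
  if feas [] [] = true then solutions feas [] [] E else []

theorem enumerates_of_goodStack {feas : γ → List β → List β → Bool} {out : γ → List β → δ}
    {E : List β} {P : Prog} {b : ℕ} {c : γ}
    (hfeas : ∀ C N a R, (C ++ (N ++ a :: R)).Perm E → feas c C N = true →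
      feas c (a :: C) N = true ∨ feas c C (a :: N) = true)
    (hP : ∀ stk, GoodStack (feas c) E stk →
      ∃ t, Eval P (enc (c, stk)) (enumStep feas out (c, stk)) t ∧ t ≤ b) (k : ℕ) :
    ∀ stk, GoodStack (feas c) E stk → (stackSolutions (feas c) stk).length = k →
      Enumerates P b (enc (c, stk)) ((stackSolutions (feas c) stk).map fun L => enc (out c L)) := by
  induction k with
  | zero =>
    intro stk hstk hk
    cases stk with
    | nil =>
      obtain ⟨t, h1, h2⟩ := hP [] hstk
      exact .done h1 h2
    | cons n stk =>
      have := (descend_spec hfeas n.2.2 n.1 n.2.1 stk hstk.1 hstk.2.1 hstk.2.2).2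
      have h1 : stackSolutions (feas c) (n :: stk) = _ := this
      -- A nonempty stack of feasible nodes has a solution, so this case is impossible.
      rw [h1] at hk
      simp at hk
  | succ k ih =>
    intro stk hstk hk
    cases stk with
    | nil => simp [stackSolutions] at hk
    | cons n stk =>
      obtain ⟨h2, h1⟩ := descend_spec hfeas n.2.2 n.1 n.2.1 stk hstk.1 hstk.2.1 hstk.2.2
      replace h1 : stackSolutions (feas c) (n :: stk) = _ := h1
      rw [h1] at hk ⊢
      obtain ⟨t, h3, h4⟩ := hP _ hstk
      exact .step h3 h4 (ih _ h2 (by simpa [topNode] using hk))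

theorem exists_enumeration {feas : γ → List β → List β → Bool}
    (hfeas : PolyTime fun p : γ × List β × List β => feas p.1 p.2.1 p.2.2)
    {E : γ → List β} (hE : PolyTime E)
    {out : γ → List β → δ} (hout : PolyTime fun p : γ × List β => out p.1 p.2) :
    ∃ (I P : Prog) (p : Polynomial ℕ), ∀ c,
      (∀ C N a R, (C ++ (N ++ a :: R)).Perm (E c) → feas c C N = true →
        feas c (a :: C) N = true ∨ feas c C (a :: N) = true) →
      ∃ (m : Data) (t : ℕ), Eval I (enc c) m t ∧ t ≤ p.eval (esize c) ∧
        Enumerates P (p.eval (esize c)) m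
          ((allSolutions (feas c) (E c)).map fun L => enc (out c L)) := by
  obtain ⟨P, p, hP⟩ := PolyTime.enumStep hfeas hout
  obtain ⟨q, hq⟩ := hE.esize_le
  have hinit : PolyTime fun c => (c, if feas c [] [] = true then
      [(([] : List β), ([] : List β), E c)] else []) := by
    have : PolyTime fun c => feas c [] [] :=
      hfeas.comp (f := fun c => (c, [], [])) (by fun_prop)
    fun_prop
  obtain ⟨I, r, hI⟩ := hinit
  -- The memory holds the parameter and a stack of at most `q + 1` nodes, each of size at most `q +
  -- 4`, plus one constructor per node.
  refine ⟨I, P, r + p.comp (.X + (q + 1) * (q + 5) + 2), fun c hc => ?_⟩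
  obtain ⟨t, ht, ht'⟩ := hI c
  refine ⟨_, t, ht, by rw [Polynomial.eval_add]; omega, ?_⟩
  have key := enumerates_of_goodStack (feas := feas) (out := out) (P := P)
    (b := (r + p.comp (.X + (q + 1) * (q + 5) + 2)).eval (esize c)) hc (by
      intro stk hstk
      obtain ⟨u, hu, hu'⟩ := hP (c, stk)
      refine ⟨u, hu, hu'.trans ?_⟩
      rw [Polynomial.eval_add, Polynomial.eval_comp]
      refine (eval_mono p ?_).trans (Nat.le_add_left _ _)
      have h1 := esize_le_of_forall hstk.esize_le_of_mem
      have h2 := hstk.length_le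
      have h3 := length_lt_esize (E c)
      have h4 := hq c
      have h5 : stk.length * (esize (E c) + 4 + 1) ≤
          (q.eval (esize c) + 1) * (q.eval (esize c) + 5) :=
        Nat.mul_le_mul (by omega) (by omega)
      simp only [Polynomial.eval_add, Polynomial.eval_mul, Polynomial.eval_X, Polynomial.eval_one,
        Polynomial.eval_ofNat, esize_pair]
      omega) _ (if feas c [] [] = true then [([], [], E c)] else []) (by
      split
      · exact ⟨⟨by assumption, by simp⟩, by simp, trivial⟩
      · trivial) rfl
  have h1 : stackSolutions (feas c) (if feas c [] [] = true then [([], [], E c)] else []) =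
      allSolutions (feas c) (E c) := by
    unfold stackSolutions allSolutions
    split <;> simp
  rwa [h1] at key

/-! ### The solutions of a search problem -/

theorem subset_of_mem_solutions {feas : List β → List β → Bool} {R : List β} :
    ∀ {C N L : List β}, L ∈ solutions feas C N R → C ⊆ L ∧ ∀ a ∈ L, a ∈ C ∨ a ∈ R := by
  induction R with
  | nil =>
    intro C N L h
    obtain rfl := List.mem_singleton.1 h
    exact ⟨fun _ h => h, fun a h => .inl h⟩
  | cons b R ih =>
    intro C N L h
    rw [solutions, List.mem_append] at h
    rcases h with h | h
    · split at h
      · obtain ⟨h1, h2⟩ := ih h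
        refine ⟨fun a ha => h1 (List.mem_cons_of_mem _ ha), fun a ha => ?_⟩
        have := h2 a ha
        simp only [List.mem_cons] at this ⊢
        tauto
      · simp at h
    · split at h
      · obtain ⟨h1, h2⟩ := ih h
        refine ⟨h1, fun a ha => ?_⟩
        have := h2 a ha
        simp only [List.mem_cons] at this ⊢
        tauto
      · simp at h

/-- Sets from the first branch contain `b`; those from the second do not, as `b` is neither in `C`
nor in `R`. -/
theorem pairwise_solutions {feas : List β → List β → Bool} {R : List β} :
    ∀ {C N : List β}, (C ++ R).Nodup →
      (solutions feas C N R).Pairwise fun L L' => ¬ ∀ a, a ∈ L ↔ a ∈ L' := by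
  induction R with
  | nil => exact fun _ => List.pairwise_singleton _ _
  | cons b R ih =>
    intro C N h
    have h1 : (b :: C ++ R).Nodup := List.perm_middle.nodup_iff.1 h
    rw [solutions, List.pairwise_append]
    refine ⟨?_, ?_, ?_⟩
    · split
      · exact ih h1
      · exact List.Pairwise.nil
    · split
      · exact ih (List.nodup_cons.1 h1).2
      · exact List.Pairwise.nil
    · intro L hL L' hL' hcon
      split at hL
      · split at hL'
        · have h2 := (subset_of_mem_solutions hL).1 (List.mem_cons_self)
          have h3 := (subset_of_mem_solutions hL').2 b ((hcon b).1 h2)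
          exact (List.nodup_cons.1 h1).1 (by simpa using h3)
        · simp at hL'
      · simp at hL

/-- `feas C N` decides whether a set in `𝓕` contains `C` and avoids `N`. -/
def IsOracle (feas : List β → List β → Bool) (𝓕 : Set (Set β)) : Prop :=
  ∀ C N, C.Nodup → (feas C N = true ↔ ∃ S ∈ 𝓕, (∀ a ∈ C, a ∈ S) ∧ ∀ a ∈ N, a ∉ S)

theorem exists_mem_solutions {feas : List β → List β → Bool} {𝓕 : Set (Set β)}
    (hfeas : IsOracle feas 𝓕) {S : Set β} (hS : S ∈ 𝓕) {R : List β} :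
    ∀ {C N : List β}, (C ++ R).Nodup → (∀ a ∈ C, a ∈ S) → (∀ a ∈ N, a ∉ S) →
      (∀ a ∈ S, a ∈ C ∨ a ∈ R) → ∃ L ∈ solutions feas C N R, ∀ a, a ∈ L ↔ a ∈ S := by
  induction R with
  | nil =>
    intro C N _ h1 _ h3
    exact ⟨C, by simp [solutions], fun a => ⟨h1 a, fun h => by simpa using h3 a h⟩⟩
  | cons b R ih =>
    intro C N h h1 h2 h3
    have h4 : (b :: C ++ R).Nodup := List.perm_middle.nodup_iff.1 h
    by_cases hb : b ∈ S
    · have h5 : ∀ a ∈ b :: C, a ∈ S := by simpa [hb] using h1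
      have h6 := (hfeas (b :: C) N h4.of_append_left).2 ⟨S, hS, h5, h2⟩
      obtain ⟨L, hL, h7⟩ := ih h4 h5 h2 fun a ha => by
        have := h3 a ha
        simp only [List.mem_cons] at this ⊢
        tauto
      exact ⟨L, by simp [solutions, h6, hL], h7⟩
    · have h5 : ∀ a ∈ b :: N, a ∉ S := by simpa [hb] using h2
      have h6 := (hfeas C (b :: N) h.of_append_left).2 ⟨S, hS, h1, h5⟩
      obtain ⟨L, hL, h7⟩ := ih (List.nodup_cons.1 h4).2 h1 h5 fun a ha => by
        have := h3 a ha
        simp only [List.mem_cons] at this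
        rcases this with h | rfl | h
        · exact .inl h
        · exact absurd ha hb
        · exact .inr h
      exact ⟨L, by simp [solutions, h6, hL], h7⟩

theorem exists_of_mem_solutions {feas : List β → List β → Bool} {𝓕 : Set (Set β)}
    (hfeas : IsOracle feas 𝓕) {R : List β} :
    ∀ {C N L : List β}, (C ++ R).Nodup → feas C N = true →
      (∀ S ∈ 𝓕, ∀ a ∈ S, a ∈ C ∨ a ∈ N ∨ a ∈ R) → L ∈ solutions feas C N R →
      ∃ S ∈ 𝓕, ∀ a, a ∈ L ↔ a ∈ S := by
  induction R with
  | nil =>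
    intro C N L h h1 h2 h3
    obtain rfl := List.mem_singleton.1 h3
    obtain ⟨S, hS, h4, h5⟩ := (hfeas L N h.of_append_left).1 h1
    refine ⟨S, hS, fun a => ⟨h4 a, fun ha => ?_⟩⟩
    rcases h2 S hS a ha with h | h | h
    · exact h
    · exact absurd ha (h5 a h)
    · simp at h
  | cons b R ih =>
    intro C N L h _ h2 h3
    have h4 : (b :: C ++ R).Nodup := List.perm_middle.nodup_iff.1 h
    rw [solutions, List.mem_append] at h3
    rcases h3 with h3 | h3
    · split at h3
      · next h5 =>
        exact ih h4 h5 (fun S hS a ha => by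
          have := h2 S hS a ha
          simp only [List.mem_cons] at this ⊢
          tauto) h3
      · simp at h3
    · split at h3
      · next h5 =>
        exact ih (List.nodup_cons.1 h4).2 h5 (fun S hS a ha => by
          have := h2 S hS a ha
          simp only [List.mem_cons] at this ⊢
          tauto) h3
      · simp at h3

/-- A witness for the node contains `a` or does not. The permutation of the duplicate-free list `E`
ensures that `a :: C` has no duplicates, as the oracle requires. -/
theorem IsOracle.split {feas : List β → List β → Bool} {𝓕 : Set (Set β)}
    (hfeas : IsOracle feas 𝓕) {E C N R : List β} {a : β} (hE : E.Nodup)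
    (hperm : (C ++ (N ++ a :: R)).Perm E) (h : feas C N = true) :
    feas (a :: C) N = true ∨ feas C (a :: N) = true := by
  have h1 := hperm.nodup_iff.2 hE
  have hC : C.Nodup := h1.of_append_left
  have haC : a ∉ C := fun h => List.disjoint_of_nodup_append h1 h (by simp)
  obtain ⟨S, hS, h2, h3⟩ := (hfeas C N hC).1 h
  by_cases ha : a ∈ S
  · exact .inl ((hfeas _ _ (List.nodup_cons.2 ⟨haC, hC⟩)).2 ⟨S, hS, by simpa [ha] using h2, h3⟩)
  · exact .inr ((hfeas _ _ hC).2 ⟨S, hS, h2, by simpa [ha] using h3⟩)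

theorem pairwise_allSolutions {feas : List β → List β → Bool} {E : List β} (hE : E.Nodup) :
    (allSolutions feas E).Pairwise fun L L' => ¬ ∀ a, a ∈ L ↔ a ∈ L' := by
  unfold allSolutions
  split
  · exact pairwise_solutions (by simpa using hE)
  · exact List.Pairwise.nil

theorem exists_mem_allSolutions {feas : List β → List β → Bool} {𝓕 : Set (Set β)}
    (hfeas : IsOracle feas 𝓕) {E : List β} (hE : E.Nodup) {S : Set β} (hS : S ∈ 𝓕)
    (hSE : ∀ a ∈ S, a ∈ E) : ∃ L ∈ allSolutions feas E, ∀ a, a ∈ L ↔ a ∈ S := by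
  have h := (hfeas [] [] List.nodup_nil).2 ⟨S, hS, by simp, by simp⟩
  rw [allSolutions, if_pos h]
  exact exists_mem_solutions hfeas hS (by simpa using hE) (by simp) (by simp)
    fun a ha => .inr (hSE a ha)

theorem exists_of_mem_allSolutions {feas : List β → List β → Bool} {𝓕 : Set (Set β)}
    (hfeas : IsOracle feas 𝓕) {E : List β} (hE : E.Nodup) (hSE : ∀ S ∈ 𝓕, ∀ a ∈ S, a ∈ E)
    {L : List β} (hL : L ∈ allSolutions feas E) : ∃ S ∈ 𝓕, ∀ a, a ∈ L ↔ a ∈ S := by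
  rw [allSolutions] at hL
  split at hL
  · next h =>
    exact exists_of_mem_solutions hfeas (by simpa using hE) h
      (fun S hS a ha => .inr (.inr (hSE S hS a ha))) hL
  · simp at hL

end

section

variable {α V β : Type*} [Enc α] [Enc V] [Enc β]

/-! ### Events of runs -/

/-- The operations on variables in `w`, each with the rest of the document at its execution. -/
def events : List α → List (Label α V) → List (Label α V × List α)
  | _, [] => []
  | s, o :: w =>
    if o.isLetter = true then events s.tail w
    else if o.isVarOp = true then (o, s) :: events s w
    else events s w

/-- The position in the document `d` at which the rest of the document is `s`. -/
def posOf (d s : List α) : ℕ := (d.drop s.length).length + 1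

/-- Suffixes of `d` stand for positions. The prefix condition ensures that `tail` is never applied
to the empty document. -/
theorem mem_events {w : List (Label α V)} : ∀ {d s : List α} {o : Label α V}, letters w <+: d →
    ((o, s) ∈ events d w ↔
      o.isVarOp = true ∧ s <:+ d ∧ OccursAt w o (posOf d s)) := by
  induction w with
  | nil => intro d s o _; simp [events, not_occursAt_nil]
  | cons l w ih =>
    intro d s o hw
    rw [occursAt_cons]
    by_cases hl : l.isLetter = true
    · obtain ⟨a, rfl⟩ : ∃ a, l = .letter a := by cases l <;> simp at hl ⊢
      cases d with
      | nil => simp at hw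
      | cons b d =>
        rw [letters_cons_letter, List.cons_prefix_cons] at hw
        rw [events, if_pos hl, List.tail_cons, ih hw.2]
        refine and_congr_right fun ho => ?_
        have h1 : Label.letter a ≠ o := by rintro rfl; simp at ho
        simp only [h1, false_and, false_or]
        constructor
        · rintro ⟨h2, h3⟩
          refine ⟨h2.trans (List.suffix_cons b d), _, h3, ?_⟩
          have := h2.length_le
          simp [posOf]
          omega
        · rintro ⟨h2, j, h3, h4⟩
          have h5 := h3.one_le
          have h6 := h2.length_le
          rcases List.suffix_cons_iff.1 h2 with rfl | h2
          · simp [posOf] at h4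
            omega
          · refine ⟨h2, ?_⟩
            have h7 := h2.length_le
            have : posOf d s = j := by
              simp [posOf] at h4 h6 ⊢
              omega
            rwa [this]
    · have hl : l.isLetter = false := by simpa using hl
      have hlet : letters [l] = [] := by rw [letters_cons_of_not_isLetter hl]; rfl
      rw [letters_cons_of_not_isLetter hl] at hw
      have h0 : (∃ j, OccursAt w o j ∧ (letters [l]).length + j = posOf d s) ↔
          OccursAt w o (posOf d s) := by simp [hlet]
      rw [h0, events, if_neg (by simp [hl])]
      have h1 : s <:+ d → (posOf d s = 1 ↔ s = d) := by
        intro hs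
        have := hs.length_le
        simp only [posOf, List.length_drop]
        constructor
        · intro h
          exact hs.eq_of_length (by omega)
        · rintro rfl
          simp
      split
      · next hvar =>
        rw [List.mem_cons, ih hw]
        constructor
        · rintro (h | ⟨h2, h3, h4⟩)
          · simp only [Prod.mk.injEq] at h
            obtain ⟨rfl, rfl⟩ := h
            exact ⟨hvar, List.suffix_refl _, .inl ⟨rfl, (h1 (List.suffix_refl _)).2 rfl⟩⟩
          · exact ⟨h2, h3, .inr h4⟩
        · rintro ⟨h2, h3, ⟨rfl, h4⟩ | h4⟩
          · exact .inl (by rw [(h1 h3).1 h4])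
          · exact .inr ⟨h2, h3, h4⟩
      · next hvar =>
        rw [ih hw]
        refine and_congr_right fun ho => and_congr_right fun _ => ?_
        have : l ≠ o := by rintro rfl; exact hvar ho
        simp [this]

theorem map_fst_events (w : List (Label α V)) (d : List α) :
    (events d w).map (fun a => a.1) = w.filter Label.isVarOp := by
  induction w generalizing d with
  | nil => rfl
  | cons o w ih => cases o <;> simp [events, ih, List.filter_cons]

/-- On a valid run the operations are distinct even without their positions. -/
theorem Valid.nodup_events {w : List (Label α V)} (hw : Valid w) (d : List α) :
    (events d w).Nodup := by
  refine List.Nodup.of_map (fun a => a.1) ?_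
  rw [map_fst_events]
  have h : ∀ w₁ (o : Label α V) w₂, w = w₁ ++ o :: w₂ → o.isVarOp = true → o ∉ w₂ := by
    rintro w₁ o w₂ rfl ho
    rw [show w₁ ++ o :: w₂ = (w₁ ++ [o]) ++ w₂ by simp] at hw
    exact hw.not_mem_append ho (by simp)
  clear hw
  induction w with
  | nil => exact List.nodup_nil
  | cons o w ih =>
    have h1 := ih fun w₁ o' w₂ hw => h (o :: w₁) o' w₂ (by rw [hw]; rfl)
    by_cases ho : o.isVarOp = true
    · rw [List.filter_cons_of_pos ho, List.nodup_cons]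
      exact ⟨fun h2 => h [] o w rfl ho (List.mem_filter.1 h2).1, h1⟩
    · rwa [List.filter_cons_of_neg ho]

/-! ### Existence of runs with prescribed events -/

/-- Edges between triples that consist of a state, the rest of the document and a list that
counts the prescribed events in `C` that are still to come; events in `N` are forbidden. -/
def searchEdges (T : List (Data × Label α V × Data)) (d : List α) (C N : List (Label α V × List α)) :
    List ((Data × List α × List (Label α V × List α)) ×
      (Data × List α × List (Label α V × List α))) :=
  T.flatMap fun e => (suffixes d).flatMap fun s => (suffixes C).flatMap fun c =>
    if e.2.1.isLetter = true then
      if e.2.1.isHead s = true then [((e.1, s, c), (e.2.2, s.tail, c))] else []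
    else if e.2.1.isVarOp = true then
      if memb (e.2.1, s) N = true then []
      else if memb (e.2.1, s) C = true then
        if c.isEmpty = true then [] else [((e.1, s, c), (e.2.2, s, c.tail))]
      else [((e.1, s, c), (e.2.2, s, c))]
    else [((e.1, s, c), (e.2.2, s, c))]

/-- Is there an accepting run on `d` whose events contain `C` and avoid `N`? -/
def runExists (R : RawVA α V) (d : List α) (C N : List (Label α V × List α)) : Bool :=
  (closure (searchEdges R.2.2.2 d C N) [(R.2.1, d, C)]).any fun n =>
    memb n.1 R.2.2.1 && (n.2.1.isEmpty && n.2.2.isEmpty)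

/-- All pairs of an operation that occurs in the automaton and a suffix of `d`. -/
def allEvents (R : RawVA α V) (d : List α) : List (Label α V × List α) :=
  dedupl (((R.2.2.2.map fun e => e.2.1).filter fun o => o.isVarOp).flatMap fun o =>
    (suffixes d).map fun s => (o, s))

@[fun_prop]
theorem PolyTime.runExists {R : β → RawVA α V} {d : β → List α}
    {C N : β → List (Label α V × List α)} (hR : PolyTime R) (hd : PolyTime d) (hC : PolyTime C)
    (hN : PolyTime N) : PolyTime fun x => Spanner.runExists (R x) (d x) (C x) (N x) := by
  unfold Spanner.runExists searchEdges
  fun_prop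

@[fun_prop]
theorem PolyTime.allEvents {R : β → RawVA α V} {d : β → List α} (hR : PolyTime R)
    (hd : PolyTime d) : PolyTime fun x => Spanner.allEvents (R x) (d x) := by
  unfold Spanner.allEvents
  fun_prop

/-- Does `o` open the variable that `o'` closes? -/
def Label.matches (o o' : Label α V) : Bool :=
  eqb (enc o) (.cons (encNat 2) (enc o).tail) && eqb (enc o') (.cons (encNat 3) (enc o).tail)

theorem Label.matches_iff {o o' : Label α V} :
    o.matches o' = true ↔ ∃ x, o = .op x ∧ o' = .cl x := by
  have h1 : ∀ x, enc (Label.op x : Label α V) = .cons (encNat 2) (enc x) := fun _ => rfl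
  have h2 : ∀ x, enc (Label.cl x : Label α V) = .cons (encNat 3) (enc x) := fun _ => rfl
  rw [Label.matches, Bool.and_eq_true, eqb_iff, eqb_iff]
  constructor
  · rintro ⟨h3, h4⟩
    cases o with
    | op x =>
      rw [h1, Data.tail, ← h2] at h4
      exact ⟨x, rfl, Enc.inj h4⟩
    | eps => exact absurd (Data.cons.inj h3).1 (by simp [encNat_injective.eq_iff])
    | letter a => exact absurd (Data.cons.inj h3).1 (by simp [encNat_injective.eq_iff])
    | cl x => exact absurd (Data.cons.inj h3).1 (by simp [encNat_injective.eq_iff])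
  · rintro ⟨x, rfl, rfl⟩
    exact ⟨rfl, rfl⟩

/-- The mapping with the events `L`, as a list. -/
def mappingList (d : List α) (L : List (Label α V × List α)) : List (Data × ℕ × ℕ) :=
  dedupl (L.flatMap fun a => (L.filter fun b => a.1.matches b.1).map fun b =>
    ((enc a.1).tail, posOf d a.2, posOf d b.2))

@[fun_prop]
theorem PolyTime.mappingList {d : β → List α} {L : β → List (Label α V × List α)}
    (hd : PolyTime d) (hL : PolyTime L) :
    PolyTime fun x => Spanner.mappingList (d x) (L x) := by
  unfold Spanner.mappingList Label.matches posOf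
  fun_prop

namespace VA

variable {A : VA α V Data} {d : List α}

theorem mem_searchEdges {C N : List (Label α V × List α)}
    {m n : Data × List α × List (Label α V × List α)} :
    (m, n) ∈ searchEdges A.trans d C N ↔ m.2.1 <:+ d ∧ m.2.2 <:+ C ∧
      ∃ o, (m.1, o, n.1) ∈ A.trans ∧
        ((∃ a, o = .letter a ∧ m.2.1 = a :: n.2.1 ∧ n.2.2 = m.2.2) ∨
        (o.isLetter = false ∧ n.2.1 = m.2.1 ∧
          ((o.isVarOp = true ∧ (o, m.2.1) ∉ N ∧ (o, m.2.1) ∈ C ∧ ∃ a, m.2.2 = a :: n.2.2) ∨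
          (o.isVarOp = true ∧ (o, m.2.1) ∉ N ∧ (o, m.2.1) ∉ C ∧ n.2.2 = m.2.2) ∨
          (o.isVarOp = false ∧ n.2.2 = m.2.2)))) := by
  obtain ⟨p, s, c⟩ := m
  obtain ⟨q, t, c'⟩ := n
  simp only [searchEdges, List.mem_flatMap, mem_suffixes]
  constructor
  · rintro ⟨⟨p', o, q'⟩, he, s', hs', c₀, hc₀, h⟩
    split at h
    · split at h
      · next h' =>
        obtain ⟨a, t', h1, h2⟩ := Label.isHead_iff.1 h'
        simp only at h1 h2
        subst h1 h2
        simp only [List.mem_singleton, Prod.mk.injEq, List.tail_cons] at h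
        obtain ⟨⟨rfl, rfl, rfl⟩, rfl, rfl, rfl⟩ := h
        exact ⟨hs', hc₀, _, he, .inl ⟨a, rfl, rfl, rfl⟩⟩
      · simp at h
    · next hl =>
      replace hl : o.isLetter = false := by simpa using hl
      split at h
      · next hv =>
        split at h
        · simp at h
        · next hN =>
          rw [memb_iff] at hN
          split at h
          · next hC =>
            rw [memb_iff] at hC
            cases c₀ with
            | nil => simp at h
            | cons b c₀ =>
              simp only [List.isEmpty_cons, Bool.false_eq_true, if_false, List.mem_singleton,
                Prod.mk.injEq, List.tail_cons] at h
              obtain ⟨⟨rfl, rfl, rfl⟩, rfl, rfl, rfl⟩ := h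
              exact ⟨hs', hc₀, _, he, .inr ⟨hl, rfl, .inl ⟨hv, hN, hC, b, rfl⟩⟩⟩
          · next hC =>
            rw [memb_iff] at hC
            simp only [List.mem_singleton, Prod.mk.injEq] at h
            obtain ⟨⟨rfl, rfl, rfl⟩, rfl, rfl, rfl⟩ := h
            exact ⟨hs', hc₀, _, he, .inr ⟨hl, rfl, .inr (.inl ⟨hv, hN, hC, rfl⟩)⟩⟩
      · next hv =>
        replace hv : o.isVarOp = false := by simpa using hv
        simp only [List.mem_singleton, Prod.mk.injEq] at h
        obtain ⟨⟨rfl, rfl, rfl⟩, rfl, rfl, rfl⟩ := h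
        exact ⟨hs', hc₀, _, he, .inr ⟨hl, rfl, .inr (.inr ⟨hv, rfl⟩)⟩⟩
  · rintro ⟨hs, hc, o, he, h⟩
    refine ⟨_, he, s, hs, c, hc, ?_⟩
    rcases h with ⟨a, rfl, rfl, rfl⟩ | ⟨hl, rfl, ⟨hv, hN, hC, b, rfl⟩ | ⟨hv, hN, hC, rfl⟩ |
      ⟨hv, rfl⟩⟩
    · have : (Label.letter a : Label α V).isHead (a :: t) = true :=
        Label.isHead_iff.2 ⟨a, t, rfl, rfl⟩
      simp [this]
    · simp [hl, hv, hN, hC]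
    · simp [hl, hv, hN, hC]
    · simp [hl, hv]

/-- Each event in `C` shortens the third component by one, whichever event it is; the difference of
lengths counts them. -/
theorem exists_path_of_search {C N : List (Label α V × List α)}
    {m n : Data × List α × List (Label α V × List α)}
    (h : Relation.ReflTransGen (fun a b => (a, b) ∈ searchEdges A.trans d C N) m n) :
    ∃ w, A.Path m.1 w n.1 ∧ letters w ++ n.2.1 = m.2.1 ∧ (∀ a ∈ events m.2.1 w, a ∉ N) ∧
      ((events m.2.1 w).filter fun a => memb a C).length + n.2.2.length = m.2.2.length := by
  induction h using Relation.ReflTransGen.head_induction_on with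
  | refl => exact ⟨[], .nil _, rfl, by simp [events], by simp [events]⟩
  | @head m k hmk _ ih =>
    obtain ⟨p, s, c⟩ := m
    obtain ⟨q, t, c'⟩ := k
    obtain ⟨w, h1, h2, h3, h4⟩ := ih
    obtain ⟨-, -, o, he, h⟩ := mem_searchEdges.1 hmk
    simp only at *
    refine ⟨o :: w, .cons he h1, ?_⟩
    rcases h with ⟨a, rfl, rfl, rfl⟩ | ⟨hl, rfl, ⟨hv, hN, hC, b, rfl⟩ | ⟨hv, hN, hC, rfl⟩ |
      ⟨hv, rfl⟩⟩
    · simp [events, h2, h4]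
      exact fun a b => h3 (a, b)
    · simp [events, letters_cons_of_not_isLetter hl, h2, hl, hv, hN, hC, ← h4]
      exact ⟨fun a b => h3 (a, b), by omega⟩
    · simp [events, letters_cons_of_not_isLetter hl, h2, hl, hv, hN, hC, ← h4]
      exact fun a b => h3 (a, b)
    · simp [events, letters_cons_of_not_isLetter hl, h2, hl, hv, ← h4]
      exact fun a b => h3 (a, b)

theorem search_of_path {C N : List (Label α V × List α)} {p q : Data} {w : List (Label α V)}
    (h : A.Path p w q) : ∀ s t c c', s <:+ d → c <:+ C → letters w ++ t = s →
      (∀ a ∈ events s w, a ∉ N) → c' <:+ c →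
      ((events s w).filter fun a => memb a C).length + c'.length = c.length →
      Relation.ReflTransGen (fun a b => (a, b) ∈ searchEdges A.trans d C N) (p, s, c) (q, t, c') := by
  induction h with
  | nil =>
    intro s t c c' _ _ h1 _ h2 h3
    obtain rfl : t = s := by simpa using h1
    obtain rfl := h2.eq_of_length (by simpa [events] using h3)
    exact .refl
  | @cons p r q o w he _ ih =>
    intro s t c c' hs hc h1 h2 h3 h4
    by_cases hl : o.isLetter = true
    · obtain ⟨a, rfl⟩ : ∃ a, o = .letter a := by cases o <;> simp at hl ⊢
      simp only [letters_cons_letter, List.cons_append] at h1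
      subst h1
      refine .head (b := (r, letters w ++ t, c))
        (mem_searchEdges.2 ⟨hs, hc, _, he, .inl ⟨a, rfl, rfl, rfl⟩⟩)
        (ih _ _ _ _ ((List.suffix_cons a _).trans hs) hc rfl (by simpa [events] using h2) h3
          (by simpa [events] using h4))
    · have hl : o.isLetter = false := by simpa using hl
      rw [letters_cons_of_not_isLetter hl] at h1
      by_cases hv : o.isVarOp = true
      · have hN : (o, s) ∉ N := h2 _ (by simp [events, hl, hv])
        have h2' : ∀ a ∈ events s w, a ∉ N := fun a ha => h2 a (by simp [events, hl, hv, ha])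
        by_cases hC : (o, s) ∈ C
        · simp only [events, hl, hv, Bool.false_eq_true, if_false, if_true,
            List.filter_cons_of_pos (p := fun a => memb a C) (memb_iff.2 hC),
            List.length_cons] at h4
          cases c with
          | nil => simp at h4
          | cons b c =>
            rw [List.length_cons] at h4
            have h3' : c' <:+ c := by
              rcases List.suffix_cons_iff.1 h3 with rfl | h
              · simp at h4
              · exact h
            exact .head (b := (r, s, c)) (mem_searchEdges.2 ⟨hs, hc, _, he,
              .inr ⟨hl, rfl, .inl ⟨hv, hN, hC, b, rfl⟩⟩⟩)
              (ih _ _ _ _ hs ((List.suffix_cons b c).trans hc) h1 h2' h3' (by omega))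
        · exact .head (b := (r, s, c)) (mem_searchEdges.2 ⟨hs, hc, _, he,
            .inr ⟨hl, rfl, .inr (.inl ⟨hv, hN, hC, rfl⟩)⟩⟩)
            (ih _ _ _ _ hs hc h1 h2' h3 (by simpa [events, hl, hv, hC] using h4))
      · have hv : o.isVarOp = false := by simpa using hv
        exact .head (b := (r, s, c)) (mem_searchEdges.2 ⟨hs, hc, _, he,
          .inr ⟨hl, rfl, .inr (.inr ⟨hv, rfl⟩)⟩⟩)
          (ih _ _ _ _ hs hc h1 (by simpa [events, hl, hv] using h2) h3
            (by simpa [events, hl, hv] using h4))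

/-- The sets of events of accepting runs on `d`. -/
def eventSets (A : VA α V Data) (d : List α) : Set (Set (Label α V × List α)) :=
  {S | ∃ w, A.AcceptingRun d w ∧ S = {a | a ∈ events d w}}

/-- Neither list has duplicates and the filtered one is contained in `C`. So counting replaces
remembering which members of `C` have occurred, and the search graph stays polynomial. -/
theorem length_filter_events {w : List (Label α V)} (hw : Valid w)
    {C : List (Label α V × List α)} (hC : C.Nodup) :
    ((events d w).filter fun a => memb a C).length = C.length ↔ ∀ a ∈ C, a ∈ events d w := by
  have h1 : ((events d w).filter fun a => memb a C).Nodup := (hw.nodup_events d).filter _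
  have h2 : ((events d w).filter fun a => memb a C) ⊆ C := fun a ha => by
    simpa using (List.mem_filter.1 ha).2
  have h3 := List.subperm_of_subset h1 h2
  constructor
  · intro h a ha
    have := (h3.perm_of_length_le h.ge).mem_iff.2 ha
    exact (List.mem_filter.1 this).1
  · intro h
    refine le_antisymm h3.length_le (List.Subperm.length_le (List.subperm_of_subset hC ?_))
    intro a ha
    exact List.mem_filter.2 ⟨h a ha, memb_iff.2 ha⟩

theorem isOracle_runExists (hA : A.Sequential) :
    IsOracle (runExists A.raw d) (A.eventSets d) := by
  intro C N hC
  simp only [runExists, raw, List.any_eq_true, mem_closure, Bool.and_eq_true, memb_iff,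
    List.isEmpty_iff, List.mem_singleton, exists_eq_left]
  constructor
  · rintro ⟨⟨q, t, c⟩, h, hq, ht, hc⟩
    simp only at hq ht hc
    subst ht hc
    obtain ⟨w, h1, h2, h3, h4⟩ := exists_path_of_search h
    simp only [List.append_nil, List.length_nil, Nat.add_zero] at h1 h2 h3 h4
    have hrun : A.AcceptingRun d w := ⟨h2, q, hq, h1⟩
    exact ⟨_, ⟨w, hrun, rfl⟩, (length_filter_events (hA d w hrun) hC).1 h4,
      fun a ha h => h3 a h ha⟩
  · rintro ⟨_, ⟨w, hrun, rfl⟩, h1, h2⟩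
    obtain ⟨hlet, f, hf, hw⟩ := id hrun
    exact ⟨(f, [], []), search_of_path hw d [] C [] (List.suffix_refl _) (List.suffix_refl _)
      (by simp [hlet]) (fun a ha h => h2 a h ha) (List.nil_suffix)
      (by simpa using (length_filter_events (hA d w hrun) hC).2 h1), hf, rfl, rfl⟩

theorem mem_allEvents {S : Set (Label α V × List α)} (hS : S ∈ A.eventSets d)
    {a : Label α V × List α} (ha : a ∈ S) : a ∈ allEvents A.raw d := by
  obtain ⟨w, ⟨hlet, f, hf, hw⟩, rfl⟩ := hS
  obtain ⟨o, s⟩ := a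
  obtain ⟨ho, hs, hocc⟩ := (mem_events (by rw [hlet])).1 ha
  obtain ⟨w₁, w₂, rfl⟩ := List.append_of_mem hocc.mem
  obtain ⟨p, -, h⟩ := path_append_iff.1 hw
  obtain ⟨r, he, -⟩ := path_cons_iff.1 h
  rw [allEvents, mem_dedupl]
  simp only [List.mem_flatMap, List.mem_filter, List.mem_map]
  exact ⟨o, ⟨⟨_, he, rfl⟩, ho⟩, s, mem_suffixes.2 hs, rfl⟩

end VA

/-! ### Mappings and lists of events -/

/-- `L` is a list of the events of an accepting run on `d` with the mapping `μ`. -/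
def IsEventList (A : VA α V Data) (d : List α) (L : List (Label α V × List α)) (μ : Mapping V) :
    Prop :=
  ∃ w, A.AcceptingRun d w ∧ Valid w ∧ IsMappingOf w μ ∧ ∀ a, a ∈ L ↔ a ∈ events d w

theorem exists_posOf (d : List α) {k : ℕ} (h1 : 1 ≤ k) (h2 : k ≤ d.length + 1) :
    ∃ s, s <:+ d ∧ posOf d s = k :=
  ⟨d.drop (k - 1), List.drop_suffix _ _, by simp [posOf]; omega⟩

theorem IsEventList.eq_some_iff {A : VA α V Data} {d : List α} {L : List (Label α V × List α)}
    {μ : Mapping V} (h : IsEventList A d L μ) (x : V) (s : Span) :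
    μ x = some s ↔ ∃ t t', (.op x, t) ∈ L ∧ (.cl x, t') ∈ L ∧ posOf d t = s.lower ∧
      posOf d t' = s.upper := by
  obtain ⟨w, ⟨hlet, -⟩, -, hμ, hL⟩ := h
  have hpre : letters w <+: d := by rw [hlet]
  rw [isMappingOf_iff.1 hμ]
  simp only [hL, mem_events hpre, Label.isVarOp_op, Label.isVarOp_cl, true_and]
  constructor
  · rintro ⟨h1, h2⟩
    obtain ⟨t, ht, ht'⟩ := exists_posOf d h1.one_le (by rw [← hlet]; exact h1.le)
    obtain ⟨u, hu, hu'⟩ := exists_posOf d h2.one_le (by rw [← hlet]; exact h2.le)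
    exact ⟨t, u, ⟨ht, ht'.symm ▸ h1⟩, ⟨hu, hu'.symm ▸ h2⟩, ht', hu'⟩
  · rintro ⟨t, u, ⟨-, h1⟩, ⟨-, h2⟩, h3, h4⟩
    exact ⟨h3 ▸ h1, h4 ▸ h2⟩

theorem IsEventList.mapping_unique {A : VA α V Data} {d : List α}
    {L L' : List (Label α V × List α)} {μ μ' : Mapping V} (h : IsEventList A d L μ)
    (h' : IsEventList A d L' μ') (hL : ∀ a, a ∈ L ↔ a ∈ L') : μ = μ' := by
  funext x
  refine Option.ext fun s => ?_
  rw [h.eq_some_iff, h'.eq_some_iff]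
  simp only [hL]

/-- On a valid run every operation belongs to a variable in the domain of the mapping, and the span
fixes its position. Together with `IsEventList.mapping_unique`, distinct event sets give distinct
mappings and conversely. -/
theorem IsEventList.mem_of_mem {A : VA α V Data} {d : List α}
    {L L' : List (Label α V × List α)} {μ : Mapping V} (h : IsEventList A d L μ)
    (h' : IsEventList A d L' μ) {a : Label α V × List α} (ha : a ∈ L) : a ∈ L' := by
  obtain ⟨o, t⟩ := a
  obtain ⟨w, ⟨hlet, -⟩, hw, hμ, hL⟩ := h
  obtain ⟨w', ⟨hlet', -⟩, hw', hμ', hL'⟩ := h'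
  rw [isMappingOf_iff] at hμ hμ'
  obtain ⟨ho, ht, hocc⟩ := (mem_events (by rw [hlet])).1 ((hL _).1 ha)
  rw [hL', mem_events (by rw [hlet'])]
  refine ⟨ho, ht, ?_⟩
  obtain ⟨x, hx⟩ := Label.isVarOp_iff.1 ho
  have h1 : .op x ∈ w := by
    rcases hx with rfl | rfl
    · exact hocc.mem
    · exact hw.mem_iff.2 hocc.mem
  obtain ⟨s, hs⟩ := hw.exists_span h1
  have hs' := (hμ' x s).1 ((hμ x s).2 hs)
  rcases hx with rfl | rfl
  · rw [hw.occursAt_unique ho hocc hs.1]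
    exact hs'.1
  · rw [hw.occursAt_unique ho hocc hs.2]
    exact hs'.2

theorem exists_map_eq {β γ : Type*} {f : β → γ} {p : β → Prop} {l : List γ}
    (h : ∀ y ∈ l, ∃ x, p x ∧ f x = y) : ∃ l' : List β, l'.map f = l ∧ ∀ x ∈ l', p x := by
  induction l with
  | nil => exact ⟨[], rfl, by simp⟩
  | cons y l ih =>
    obtain ⟨x, hx, rfl⟩ := h y (by simp)
    obtain ⟨l', rfl, h'⟩ := ih fun z hz => h z (by simp [hz])
    exact ⟨x :: l', rfl, by simpa [hx] using h'⟩

theorem IsEventList.encodesMapping {A : VA α V Data} {d : List α}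
    {L : List (Label α V × List α)} {μ : Mapping V} (h : IsEventList A d L μ) (nV : V ↪ Data)
    (hV : ∀ x, nV x = enc x) : EncodesMapping nV (enc (mappingList d L)) μ := by
  have hmem : ∀ y : Data × ℕ × ℕ, y ∈ mappingList d L ↔
      ∃ x s, μ x = some s ∧ (enc x, s.lower, s.upper) = y := by
    intro y
    rw [mappingList, mem_dedupl]
    simp only [List.mem_flatMap, List.mem_map, List.mem_filter, Label.matches_iff]
    constructor
    · rintro ⟨⟨_, t⟩, ha, ⟨_, t'⟩, ⟨hb, x, rfl, rfl⟩, rfl⟩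
      have hμ : ∃ s, μ x = some s := by
        obtain ⟨w, ⟨hlet, -⟩, hw, hμ, hL⟩ := h
        have := ((mem_events (by rw [hlet])).1 ((hL _).1 ha)).2.2
        obtain ⟨s, hs⟩ := hw.exists_span this.mem
        exact ⟨s, (isMappingOf_iff.1 hμ x s).2 hs⟩
      obtain ⟨s, hs⟩ := hμ
      refine ⟨x, s, hs, ?_⟩
      obtain ⟨w, ⟨hlet, -⟩, hw, hμ, hL⟩ := h
      have h1 := ((mem_events (by rw [hlet])).1 ((hL _).1 ha)).2.2
      have h2 := ((mem_events (by rw [hlet])).1 ((hL _).1 hb)).2.2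
      have h3 := (isMappingOf_iff.1 hμ x s).1 hs
      rw [hw.occursAt_unique rfl h3.1 h1, hw.occursAt_unique rfl h3.2 h2]
      rfl
    · rintro ⟨x, s, hs, rfl⟩
      obtain ⟨t, t', h1, h2, h3, h4⟩ := (h.eq_some_iff x s).1 hs
      exact ⟨_, h1, _, ⟨h2, x, rfl, rfl⟩, by rw [h3, h4]; rfl⟩
  -- The computed list names variables by codes; it is pulled back to genuine variables and spans.
  obtain ⟨l, hl, hl'⟩ := exists_map_eq (l := mappingList d L)
    (f := fun e : V × Span => (enc e.1, e.2.lower, e.2.upper)) (p := fun e => μ e.1 = some e.2) (by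
      intro y hy
      obtain ⟨x, s, h1, h2⟩ := (hmem y).1 hy
      exact ⟨(x, s), h1, h2⟩)
  have hinj : ∀ e e' : V × Span, ((enc e.1, e.2.lower, e.2.upper) : Data × ℕ × ℕ) =
      (enc e'.1, e'.2.lower, e'.2.upper) → e = e' := by
    intro e e' h
    simp only [Prod.mk.injEq] at h
    exact Prod.ext (Enc.inj h.1) (Span.ext h.2.1 h.2.2)
  have hnodup : (mappingList d L).Nodup := nodup_dedupl _
  rw [← hl] at hnodup
  refine ⟨l, ?_, ?_, ?_⟩
  · refine List.Nodup.map_on ?_ (List.Nodup.of_map _ hnodup)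
    rintro ⟨x, s⟩ h1 ⟨y, t⟩ h2 (rfl : x = y)
    have : some s = some t := (hl' (x, s) h1).symm.trans (hl' (x, t) h2)
    rw [Option.some.inj this]
  · intro x s
    refine ⟨fun hs => ?_, fun h => hl' _ h⟩
    have := (hmem _).2 ⟨x, s, hs, rfl⟩
    rw [← hl, List.mem_map] at this
    obtain ⟨e, he, h⟩ := this
    rwa [← hinj e (x, s) h]
  · change encList ((mappingList d L).map enc) = _
    rw [← hl, List.map_map]
    congr 1
    refine List.map_congr_left fun e _ => ?_
    rw [hV]
    rfl

end

/-! ### Programs for the construction and the enumeration -/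

section

variable {α V : Type*} [Enc α] [Enc V]

/-- The lists that describe the automaton for the difference. -/
def diffRaw (x : List α × RawVA α V × RawVA α V) : RawVA α V :=
  (diffStates x.2.1 x.2.2 x.1, .nil, diffAccept x.2.1 x.2.2 x.1, diffTrans x.2.1 x.2.2 x.1)

theorem polyTime_diffRaw :
    PolyTime fun x : List α × RawVA α V × RawVA α V => diffRaw x := by
  have h1 : PolyTime fun x : List α × RawVA α V × RawVA α V => diffStates x.2.1 x.2.2 x.1 :=
    .diffStates (by fun_prop) (by fun_prop) (by fun_prop)
  have h2 : PolyTime fun x : List α × RawVA α V × RawVA α V => diffAccept x.2.1 x.2.2 x.1 :=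
    .diffAccept (by fun_prop) (by fun_prop) (by fun_prop)
  have h3 : PolyTime fun x : List α × RawVA α V × RawVA α V => diffTrans x.2.1 x.2.2 x.1 :=
    .diffTrans (by fun_prop) (by fun_prop) (by fun_prop)
  unfold diffRaw
  fun_prop

theorem raw_diff (A₁ A₂ : VA α V Data) (d : List α) :
    (A₁.diff A₂ d).raw = diffRaw (d, A₁.raw, A₂.raw) := rfl

theorem enc_input (nα : α ↪ Data) (nV : V ↪ Data) (hα : ∀ a, nα a = enc a)
    (hV : ∀ x, nV x = enc x) (d : List α) (A₁ A₂ : VA α V Data) :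
    encInput nα nV d A₁ A₂ = enc (d, A₁.raw, A₂.raw) := by
  rw [encInput, enc_raw nα nV hα hV, enc_raw nα nV hα hV]
  have : d.map nα = d.map enc := List.map_congr_left fun a _ => hα a
  rw [this]
  rfl

theorem exists_diff_program (nα : α ↪ Data) (nV : V ↪ Data) (hα : ∀ a, nα a = enc a)
    (hV : ∀ x, nV x = enc x) :
    ∃ (P : Prog) (p : Polynomial ℕ), ∀ (d : List α) (A₁ A₂ : VA α V Data),
      ∃ t, Eval P (encInput nα nV d A₁ A₂) (encVA nα nV (A₁.diff A₂ d)) t ∧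
        t ≤ p.eval (encInput nα nV d A₁ A₂).size := by
  obtain ⟨P, p, hP⟩ := polyTime_diffRaw (α := α) (V := V)
  refine ⟨P, p, fun d A₁ A₂ => ?_⟩
  rw [enc_input nα nV hα hV, enc_raw nα nV hα hV, raw_diff]
  exact hP (d, A₁.raw, A₂.raw)

open Classical in
theorem exists_enumeration_of_oracle {A : VA α V Data} (hA : A.Sequential) (d : List α)
    (nV : V ↪ Data) (hV : ∀ x, nV x = enc x) :
    ∃ μs : List (Mapping V),
      List.Forall₂ (EncodesMapping nV)
        ((allSolutions (runExists A.raw d) (allEvents A.raw d)).map fun L =>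
          enc (mappingList d L)) μs ∧
      μs.Nodup ∧ ∀ μ, μ ∈ μs ↔ μ ∈ A.spanner d := by
  let Ls := allSolutions (runExists A.raw d) (allEvents A.raw d)
  have hE : (allEvents A.raw d).Nodup := nodup_dedupl _
  have horacle := A.isOracle_runExists (d := d) hA
  have hex : ∀ L ∈ Ls, ∃ μ, IsEventList A d L μ := by
    intro L hL
    obtain ⟨_, ⟨w, hw, rfl⟩, hLw⟩ :=
      exists_of_mem_allSolutions horacle hE (fun S hS a ha => VA.mem_allEvents hS ha) hL
    obtain ⟨μ, hμ⟩ := (hA d w hw).exists_isMappingOf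
    exact ⟨μ, w, hw, hA d w hw, hμ, hLw⟩
  -- The default value is never taken on solutions, by `hex`.
  let m : List (Label α V × List α) → Mapping V := fun L =>
    if h : ∃ μ, IsEventList A d L μ then h.choose else fun _ => none
  have hm : ∀ L ∈ Ls, IsEventList A d L (m L) := by
    intro L hL
    have := hex L hL
    simp only [m, this, dif_pos]
    exact this.choose_spec
  refine ⟨Ls.map m, ?_, ?_, fun μ => ⟨fun h => ?_, ?_⟩⟩
  · rw [List.forall₂_map_left_iff, List.forall₂_map_right_iff, List.forall₂_same]
    exact fun L hL => (hm L hL).encodesMapping nV hV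
  · rw [List.Nodup, List.pairwise_map]
    refine (pairwise_allSolutions hE).imp_of_mem fun {L L'} hL hL' hne heq => hne fun a => ?_
    have h1 := hm L hL
    have h2 := hm L' hL'
    rw [← heq] at h2
    exact ⟨fun h => h1.mem_of_mem h2 h, fun h => h2.mem_of_mem h1 h⟩
  · obtain ⟨L, hL, rfl⟩ := List.mem_map.1 h
    obtain ⟨w, h1, h2, h3, -⟩ := hm L hL
    exact ⟨w, h1, h2, h3⟩
  · rintro ⟨w, h1, h2, h3⟩
    obtain ⟨L, hL, hLw⟩ := exists_mem_allSolutions horacle hE (S := {a | a ∈ events d w})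
      ⟨w, h1, rfl⟩ fun a ha => VA.mem_allEvents ⟨w, h1, rfl⟩ ha
    have h4 : IsEventList A d L μ := ⟨w, h1, h2, h3, hLw⟩
    rw [h4.mapping_unique (hm L hL) fun _ => Iff.rfl]
    exact List.mem_map.2 ⟨L, hL, rfl⟩

theorem exists_enum_program (nα : α ↪ Data) (nV : V ↪ Data) (hα : ∀ a, nα a = enc a)
    (hV : ∀ x, nV x = enc x) :
    ∃ (I P : Prog) (p : Polynomial ℕ), ∀ (d : List α) (A₁ A₂ : VA α V Data),
      (A₁.diff A₂ d).Sequential →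
      ∃ (m : Data) (t : ℕ) (ys : List Data) (μs : List (Mapping V)),
        Eval I (encInput nα nV d A₁ A₂) m t ∧
        t ≤ p.eval (encInput nα nV d A₁ A₂).size ∧
        Enumerates P (p.eval (encInput nα nV d A₁ A₂).size) m ys ∧
        List.Forall₂ (EncodesMapping nV) ys μs ∧
        μs.Nodup ∧ ∀ μ, μ ∈ μs ↔ μ ∈ (A₁.diff A₂ d).spanner d := by
  have hraw := polyTime_diffRaw (α := α) (V := V)
  obtain ⟨I, P, p, h⟩ := exists_enumeration (γ := List α × RawVA α V × RawVA α V)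
    (feas := fun x C N => runExists (diffRaw x) x.1 C N) (E := fun x => allEvents (diffRaw x) x.1)
    (out := fun x L => mappingList x.1 L)
    (by
      have : PolyTime fun p : (List α × RawVA α V × RawVA α V) × List (Label α V × List α) ×
          List (Label α V × List α) => diffRaw p.1 := hraw.comp (by fun_prop)
      fun_prop)
    (by fun_prop) (by fun_prop)
  refine ⟨I, P, p, fun d A₁ A₂ hseq => ?_⟩
  -- The programs and their polynomial are fixed beforehand; sequentiality enters only through the
  -- splitting property of the oracle at this input.
  obtain ⟨m, t, h1, h2, h3⟩ := h (d, A₁.raw, A₂.raw) fun C N a R hperm hfeas =>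
    ((A₁.diff A₂ d).isOracle_runExists hseq).split (nodup_dedupl _) hperm hfeas
  obtain ⟨μs, h4, h5, h6⟩ := exists_enumeration_of_oracle hseq d nV hV
  rw [enc_input nα nV hα hV]
  exact ⟨m, t, _, μs, h1, h2, h3, h4, h5, h6⟩

end

end Spanner

theorem mainTheorem6 {α V : Type*} [Finite α]
    (nα : α ↪ Spanner.Data) (nV : V ↪ Spanner.Data) :
    -- construction of an ad-hoc sequential VA in polynomial time
    (∃ (P : Spanner.Prog) (p : Polynomial ℕ),
      ∀ (d : List α) (A₁ A₂ : Spanner.VA α V Spanner.Data),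
        A₁.Sequential → A₂.Sequential →
        A₁.SemiFunctional (A₁.vars ∩ A₂.vars) → A₂.Synchronized (A₁.vars ∩ A₂.vars) →
        ∃ (A : Spanner.VA α V Spanner.Data) (t : ℕ),
          Spanner.Eval P (Spanner.encInput nα nV d A₁ A₂) (Spanner.encVA nα nV A) t ∧
          t ≤ p.eval (Spanner.encInput nα nV d A₁ A₂).size ∧
          A.Sequential ∧
          A.spanner d = Spanner.SchemalessSpanner.difference A₁.spanner A₂.spanner d) ∧
    -- enumeration of the difference with polynomial delay, after preprocessing by `I`
    (∃ (I P : Spanner.Prog) (p : Polynomial ℕ),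
      ∀ (d : List α) (A₁ A₂ : Spanner.VA α V Spanner.Data),
        A₁.Sequential → A₂.Sequential →
        A₁.SemiFunctional (A₁.vars ∩ A₂.vars) → A₂.Synchronized (A₁.vars ∩ A₂.vars) →
        ∃ (m : Spanner.Data) (t : ℕ) (ys : List Spanner.Data)
          (μs : List (Spanner.Mapping V)),
          Spanner.Eval I (Spanner.encInput nα nV d A₁ A₂) m t ∧
          t ≤ p.eval (Spanner.encInput nα nV d A₁ A₂).size ∧
          Spanner.Enumerates P (p.eval (Spanner.encInput nα nV d A₁ A₂).size) m ys ∧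
          List.Forall₂ (Spanner.EncodesMapping nV) ys μs ∧
          μs.Nodup ∧
          ∀ μ : Spanner.Mapping V, μ ∈ μs ↔
            μ ∈ Spanner.SchemalessSpanner.difference A₁.spanner A₂.spanner d) := by
  -- The given names serve as the encodings, so they agree with `enc` by `rfl`.
  let _ : Spanner.Enc α := ⟨nα, nα.injective⟩
  let _ : Spanner.Enc V := ⟨nV, nV.injective⟩
  constructor
  · obtain ⟨P, p, h⟩ := Spanner.exists_diff_program nα nV (fun _ => rfl) fun _ => rfl
    refine ⟨P, p, fun d A₁ A₂ h₁ h₂ h₃ h₄ => ?_⟩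
    obtain ⟨t, ht, ht'⟩ := h d A₁ A₂
    exact ⟨A₁.diff A₂ d, t, ht, ht', Spanner.VA.diff_sequential h₁ h₂ h₃ h₄,
      Spanner.VA.diff_spanner h₁ h₂ h₃ h₄⟩
  · obtain ⟨I, P, p, h⟩ := Spanner.exists_enum_program nα nV (fun _ => rfl) fun _ => rfl
    refine ⟨I, P, p, fun d A₁ A₂ h₁ h₂ h₃ h₄ => ?_⟩
    obtain ⟨m, t, ys, μs, h5, h6, h7, h8, h9, h10⟩ :=
      h d A₁ A₂ (Spanner.VA.diff_sequential h₁ h₂ h₃ h₄)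
    refine ⟨m, t, ys, μs, h5, h6, h7, h8, h9, fun μ => ?_⟩
    rw [h10, Spanner.VA.diff_spanner h₁ h₂ h₃ h₄]
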